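/- **Collar Neighborhood Theorem.** *Manifolds with faces.* A manifold with corners is a second countable Hausdorff space with a smooth atlas modelled on $\mathbb R_+^n$, $\mathbb R_+=[0,\infty)$; $\partial_kX$ is the set of corners of codimension $k$ (points at which exactly $k$ coordinates of a chart to $\mathbb R_+^n$ vanish). A connected face of $X$ is the closure of a connected component of $\partial_1X$, and $\operatorname{bd}X$ is the set of connected faces. $X$ is a manifold with finite faces if $\operatorname{bd}X$ is finite and each corner of codimension $k$ lies in exactly $k$ connected faces. For $\sigma\subset\operatorname{bd}X$ put $\overline\partial_\sigma X=\bigcap_{C\in\sigma}C$ ($=X$ if $\sigma=\varnothing$). An embedding is a smooth map with injective differentials that is a topological embedding. *Arrangements.* Let $S$ be a finite lattice. An arrangement $\mathcal X$ of shape $S$ is a functor from $S$ to manifolds with corners and embeddings with $\mathcal X(s\wedge t)=\mathcal X(s)\cap\mathcal X(t)$ inside the ambient manifold $|\mathcal X|=\mathcal X(\max S)$. For $p\in|\mathcal X|$ let $s(p)=\bigwedge\{s: p\in\mathcal X(s)\}$. The arrangement is excellent if around each $p$ there are an open $U\ni p$, sets $I_0(s)\subset I(s)\subset\{1,\dots,m\}$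 for $s\ge s(p)$, both compatible with meets and with $I(\max S)=\{1,\dots,m\}$, $m=\dim|\mathcal X|$, and an open embedding $\varphi:U\to\mathbb H^{I(\max S)}$, $\varphi(p)=0$, such that $U$ meets $\mathcal X(s)$ only if $s\ge s(p)$, and $U\cap\mathcal X(s)=\varphi^{-1}(\mathbb H^{I(s)})$ for $s\ge s(p)$; here $\mathbb H^{I(s)}=\{x\in\mathbb R^m: x_i=0\ (i\notin I(s)),\ x_i\ge0\ (i\in I(s)\setminus I_0(s))\}$. It is neat if it is excellent, every $\mathcal X(s)$ is a manifold with finite faces, and $\partial_k\mathcal X(s)=\mathcal X(s)\cap\partial_k|\mathcal X|$ for all $s,k$. *Edgings.* Let $Y$ be a manifold with finite faces. An edging $\beta$ of $\mathcal X$ with $Y$ is a partial map $\beta:\operatorname{bd}|\mathcal X|\rightharpoonup\operatorname{bd}Y$ with domain $D(\beta)$ such that, whenever $C_1,\dots,C_r\in D(\beta)$ ($r\ge1$) are distinct and $C_1\cap\dots\cap C_r\ne\varnothing$, the faces $\beta(C_1),\dots,\beta(C_r)$ are distinct and have a common point. For $\tau\subset\operatorname{bd}Y$ put $\overline\partial^\beta_\tau|\mathcal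 X|=\bigcup\{\overline\partial_\sigma|\mathcal X| : \sigma\subset\operatorname{bd}|\mathcal X|,\ \beta(\sigma\cap D(\beta))=\tau\}$ and let $\overline\partial^\beta_\tau\mathcal X$ be the arrangement $s\mapsto\mathcal X(s)\cap\overline\partial^\beta_\tau|\mathcal X|$. Order the subsets of $\operatorname{bd}Y$ by reverse inclusion: $\tau\le\tau'$ iff $\tau'\subset\tau$. *Theorem.* Let $\mathcal X$ be a neat arrangement, $Y$ a manifold with finite faces and $\beta$ an edging of $\mathcal X$ with $Y$. Then $\mathcal X$ admits a $\beta$-collaring, that is, a family of open embeddings of arrangements $$\gamma^\tau_{\tau'}:\ \mathbb R_+^{\tau\setminus\tau'}\times\overline\partial^\beta_\tau\mathcal X\longrightarrow\overline\partial^\beta_{\tau'}\mathcal X\qquad(\tau\le\tau')$$ such that for all $\tau\le\tau'\le\tau''$, $u\in\mathbb R_+^{\tau'\setminus\tau''}$, $t\in\mathbb R_+^{\tau\setminus\tau'}$ and $p\in\overline\partial^\beta_\tau|\mathcal X|$, $$\gamma^{\tau'}_{\tau''}\bigl(u,\gamma^\tau_{\tau'}(t,p)\bigr)=\gamma^\tau_{\tau''}\bigl((u,t),p\bigr),$$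 where $(u,t)\in\mathbb R_+^{\tau\setminus\tau''}$ is the combined vector. (An open embedding of arrangements is an open embedding of the ambient manifolds which restricts to an open embedding on every member, each member of the source being the preimage of the corresponding member of the target.) Moreover, the collaring can be chosen so that $\gamma^\tau_{\tau'}(0,p)=p$ for all $\tau\le\tau'$ and $p\in\overline\partial^\beta_\tau|\mathcal X|$. -/

import Mathlib

open Set
open scoped Manifold ContDiff

universe u v w

/-! ### Manifolds with corners -/

/-- A manifold with corners: a second countable Hausdorff space with a smooth atlas modelled on
the quadrant `{x ∈ ℝⁿ | ∀ i, 0 ≤ x i}`, where `n` is the dimension. -/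
structure CornerMfd where
  carrier : Type u
  dim : ℕ
  [topology : TopologicalSpace carrier]
  [t2 : T2Space carrier]
  [secondCountable : SecondCountableTopology carrier]
  [charted : ChartedSpace (EuclideanQuadrant dim) carrier]
  [smooth : IsManifold (modelWithCornersEuclideanQuadrant dim) ∞ carrier]

namespace CornerMfd

instance : CoeSort CornerMfd.{u} (Type u) := ⟨CornerMfd.carrier⟩

attribute [instance] CornerMfd.topology CornerMfd.t2 CornerMfd.secondCountable
  CornerMfd.charted CornerMfd.smooth

/-- The model with corners on which the manifold `M` is modelled. -/
noncomputable abbrev model (M : CornerMfd.{u}) :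
    ModelWithCorners ℝ (EuclideanSpace ℝ (Fin M.dim)) (EuclideanQuadrant M.dim) :=
  modelWithCornersEuclideanQuadrant M.dim

/-- An embedding of manifolds with corners: a smooth map with injective differentials which is a
topological embedding. Nothing is required about its position relative to the corners. -/
structure IsEmb {M : CornerMfd.{u}} {N : CornerMfd.{v}} (f : M → N) : Prop where
  contMDiff : ContMDiff M.model N.model ∞ f
  immersion : ∀ x, Function.Injective (mfderiv M.model N.model f x)
  isEmbedding : Topology.IsEmbedding f

/-- The codimension of the corner `p`: the number of vanishing coordinates of `p` in a chart with
values in the quadrant. -/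
noncomputable def codim (M : CornerMfd.{u}) (p : M) : ℕ :=
  {i : Fin M.dim | (chartAt (EuclideanQuadrant M.dim) p p).1 i = 0}.ncard

/-- `∂ₖ M`, the set of corners of codimension `k`. -/
def corners (M : CornerMfd.{u}) (k : ℕ) : Set M := {p | M.codim p = k}

/-- `bd M`, the set of connected faces of `M`: closures of connected components of `∂₁ M`. -/
def bd (M : CornerMfd.{u}) : Set (Set M) :=
  {C | ∃ p ∈ M.corners 1, C = closure (connectedComponentIn (M.corners 1) p)}

/-- The type of connected faces of `M`. -/
def Face (M : CornerMfd.{u}) : Type u := {C : Set M // C ∈ M.bd}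

noncomputable instance (M : CornerMfd.{u}) : DecidableEq M.Face := Classical.decEq _

/-- `M` is a manifold with finite faces: `bd M` is finite, and every corner of codimension `k`
belongs to exactly `k` connected faces. -/
structure HasFiniteFaces (M : CornerMfd.{u}) : Prop where
  finite : M.bd.Finite
  faces : ∀ p : M, {C ∈ M.bd | p ∈ C}.ncard = M.codim p

/-- `∂̄_σ M`, the intersection of the connected faces in `σ` (all of `M` if `σ = ∅`). -/
def faceInter (M : CornerMfd.{u}) (σ : Finset M.Face) : Set M := {p | ∀ C ∈ σ, p ∈ C.1}

end CornerMfd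

/-- `f` restricts to an open embedding `A → B` of submanifolds `A ⊆ M` and `B ⊆ N`, that is, to
a diffeomorphism of `A` onto an open subset of `B`. Smoothness of a map on a subset of a manifold is
meant within that subset; on a submanifold this is smoothness for its own smooth structure. -/
structure IsOpenEmbOn {E : Type*} [NormedAddCommGroup E] [NormedSpace ℝ E]
    {H : Type*} [TopologicalSpace H] (I : ModelWithCorners ℝ E H)
    {E' : Type*} [NormedAddCommGroup E'] [NormedSpace ℝ E']
    {H' : Type*} [TopologicalSpace H'] (J : ModelWithCorners ℝ E' H')
    {M : Type*} [TopologicalSpace M] [ChartedSpace H M]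
    {N : Type*} [TopologicalSpace N] [ChartedSpace H' N]
    (f : M → N) (A : Set M) (B : Set N) : Prop where
  contMDiffOn : ContMDiffOn I J ∞ f A
  image_open : ∃ W : Set N, IsOpen W ∧ f '' A = B ∩ W
  inverse : ∃ g : N → M, ContMDiffOn J I ∞ g (f '' A) ∧ LeftInvOn g f A

/-! ### Arrangements of manifolds -/

/-- An arrangement of manifolds whose shape is the finite lattice `S`: a functor from `S` to
manifolds with corners and embeddings which preserves meets. -/
structure Arrangement (S : Type w) [Lattice S] [OrderTop S] where
  obj : S → CornerMfd.{u}
  map : ∀ {s t : S}, s ≤ t → obj s → obj t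
  isEmb : ∀ {s t : S} (h : s ≤ t), CornerMfd.IsEmb (map h)
  map_id : ∀ (s : S) (x : obj s), map (le_refl s) x = x
  map_comp : ∀ {r s t : S} (h : r ≤ s) (k : s ≤ t) (x : obj r),
    map k (map h x) = map (h.trans k) x
  map_inf : ∀ s t : S, range (map (le_top : s ⊓ t ≤ ⊤)) =
    range (map (le_top : s ≤ ⊤)) ∩ range (map (le_top : t ≤ ⊤))

/-- The local model `ℍ^J` inside `ℝᵐ`, for a marked set `(J, J₀)` with `J₀ ⊆ J ⊆ {1, …, m}`: the
coordinates outside `J` vanish, and the unmarked coordinates in `J` are non-negative. -/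
def stdCorner {m : ℕ} (J J₀ : Finset (Fin m)) : Set (Fin m → ℝ) :=
  {x | (∀ i, i ∉ J → x i = 0) ∧ ∀ i ∈ J, i ∉ J₀ → 0 ≤ x i}

namespace Arrangement

variable {S : Type w} [Lattice S] [OrderTop S]

/-- The ambient manifold `|𝒳|`. -/
def ambient (𝒳 : Arrangement.{u} S) : CornerMfd.{u} := 𝒳.obj ⊤

/-- The member `𝒳(s)`, seen as a subset of the ambient manifold. -/
def sub (𝒳 : Arrangement.{u} S) (s : S) : Set 𝒳.ambient := range (𝒳.map (le_top : s ≤ ⊤))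

open Classical in
/-- The scope `s(p)`: the meet of all `s` with `p ∈ 𝒳(s)`. -/
noncomputable def scope [Fintype S] (𝒳 : Arrangement.{u} S) (p : 𝒳.ambient) : S :=
  (Finset.univ.filter fun s => p ∈ 𝒳.sub s).inf id

/-- `(U, (J, J₀), φ)` is an `𝒳`-chart around `p`. The arrangement of marked finite sets
`(J s, J₀ s)`, which matters only for `s ≥ s(p)`, is realised inside `J ⊤ = {1, …, m}` with
`m = dim |𝒳|`. -/
structure IsChart [Fintype S] (𝒳 : Arrangement.{u} S) (p : 𝒳.ambient) (U : Set 𝒳.ambient)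
    (J J₀ : S → Finset (Fin 𝒳.ambient.dim))
    (φ : 𝒳.ambient → (Fin 𝒳.ambient.dim → ℝ)) : Prop where
  isOpen : IsOpen U
  mem : p ∈ U
  map_center : φ p = 0
  marked_subset : ∀ s, 𝒳.scope p ≤ s → J₀ s ⊆ J s
  top : J ⊤ = Finset.univ
  inf : ∀ s t, 𝒳.scope p ≤ s → 𝒳.scope p ≤ t → J (s ⊓ t) = J s ∩ J t
  marked_inf : ∀ s t, 𝒳.scope p ≤ s → 𝒳.scope p ≤ t → J₀ (s ⊓ t) = J₀ s ∩ J₀ t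
  openEmb : IsOpenEmbOn 𝒳.ambient.model (modelWithCornersSelf ℝ (Fin 𝒳.ambient.dim → ℝ)) φ U
    (stdCorner (J ⊤) (J₀ ⊤))
  scope_le : ∀ s, (U ∩ 𝒳.sub s).Nonempty → 𝒳.scope p ≤ s
  pullback : ∀ s, 𝒳.scope p ≤ s → ∀ q ∈ U, q ∈ 𝒳.sub s ↔ φ q ∈ stdCorner (J s) (J₀ s)

/-- `𝒳` is excellent: every point of the ambient manifold admits an `𝒳`-chart. -/
def IsExcellent [Fintype S] (𝒳 : Arrangement.{u} S) : Prop :=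
  ∀ p : 𝒳.ambient, ∃ U J J₀ φ, 𝒳.IsChart p U J J₀ φ

/-- `𝒳` is neat: it is excellent, its members are manifolds with finite faces, and
`∂ₖ 𝒳(s) = 𝒳(s) ∩ ∂ₖ |𝒳|` for all `s` and `k`. -/
structure IsNeat [Fintype S] (𝒳 : Arrangement.{u} S) : Prop where
  excellent : 𝒳.IsExcellent
  finiteFaces : ∀ s, (𝒳.obj s).HasFiniteFaces
  corners : ∀ s k, 𝒳.map (le_top : s ≤ ⊤) '' (𝒳.obj s).corners k =
    𝒳.sub s ∩ 𝒳.ambient.corners k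

end Arrangement

/-! ### Edgings -/

/-- A pre-edging of `X` with `Y`: a partial map from `bd X` to `bd Y`. -/
def PreEdging (X : CornerMfd.{u}) (Y : CornerMfd.{v}) : Type (max u v) := X.Face → Option Y.Face

namespace PreEdging

variable {X : CornerMfd.{u}} {Y : CornerMfd.{v}}

/-- `β` is an edging: if finitely many distinct connected faces in the domain of `β` have a common
point, then so do their images under `β`, and these images are distinct. -/
def IsEdging (β : PreEdging X Y) : Prop :=
  ∀ σ : Finset X.Face, σ.Nonempty → (∀ C ∈ σ, (β C).isSome) → (X.faceInter σ).Nonempty →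
    (∃ q : Y, ∀ C ∈ σ, ∀ D, β C = some D → q ∈ D.1) ∧
    ∀ C ∈ σ, ∀ C' ∈ σ, β C = β C' → C = C'

/-- The induced map on subsets, `σ ↦ β(σ ∩ D(β))`, where `D(β)` is the domain of `β`. -/
noncomputable def push (β : PreEdging X Y) (σ : Finset X.Face) : Finset Y.Face :=
  σ.biUnion fun C => (β C).toFinset

/-- `∂̄^β_τ X`, the union of all `∂̄_σ X` such that `β` induces `σ ↦ τ`. -/
def faceUnion (β : PreEdging X Y) (τ : Finset Y.Face) : Set X :=
  {p | ∃ σ : Finset X.Face, β.push σ = τ ∧ p ∈ X.faceInter σ}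

end PreEdging

/-! ### Collarings -/

/-- The closed orthant `ℝ₊^K` in `ℝ^K`. -/
def orthant (K : Type*) : Set (K → ℝ) := {t | ∀ i, 0 ≤ t i}

/-- The canonical map `ℝ₊^{τ' ∖ τ''} × ℝ₊^{τ ∖ τ'} → ℝ₊^{τ ∖ τ''}`, a bijection for
`τ'' ⊆ τ' ⊆ τ`. -/
noncomputable def glue {Y : CornerMfd.{v}} {τ τ' τ'' : Finset Y.Face}
    (u : {D // D ∈ τ' \ τ''} → ℝ) (t : {D // D ∈ τ \ τ'} → ℝ) : {D // D ∈ τ \ τ''} → ℝ :=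
  fun D =>
    if h : D.1 ∈ τ' then u ⟨D.1, Finset.mem_sdiff.2 ⟨h, (Finset.mem_sdiff.1 D.2).2⟩⟩
    else t ⟨D.1, Finset.mem_sdiff.2 ⟨(Finset.mem_sdiff.1 D.2).1, h⟩⟩

namespace Arrangement

variable {S : Type w} [Lattice S] [OrderTop S]

/-- The member at `s` of the arrangement `∂̄^β_τ 𝒳`, namely `𝒳(s) ∩ ∂̄^β_τ |𝒳|`. Its ambient
manifold, the member at `⊤`, is `∂̄^β_τ |𝒳|`. -/
def faceSub (𝒳 : Arrangement.{u} S) {Y : CornerMfd.{v}} (β : PreEdging 𝒳.ambient Y)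
    (τ : Finset Y.Face) (s : S) : Set 𝒳.ambient := 𝒳.sub s ∩ β.faceUnion τ

/-- A family of maps `γ τ τ' : ℝ^{τ ∖ τ'} × |𝒳| → |𝒳|` of which only the restrictions to
`ℝ₊^{τ ∖ τ'} × ∂̄^β_τ |𝒳|` with `τ' ⊆ τ` matter. -/
abbrev CollarFamily (𝒳 : Arrangement.{u} S) (Y : CornerMfd.{v}) : Type (max u v) :=
  ∀ τ τ' : Finset Y.Face, ({D // D ∈ τ \ τ'} → ℝ) × 𝒳.ambient → 𝒳.ambient

/-- `γ` is a `β`-collaring of `𝒳`. In the face lattice of `Y`, which is ordered by reverse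
inclusion, `τ ≤ τ'` means `τ' ⊆ τ`. The first two clauses say that `γ τ τ'` is an open embedding
`ℝ₊^{τ ∖ τ'} × ∂̄^β_τ 𝒳 → ∂̄^β_τ' 𝒳` of arrangements: an open embedding on every member (for
`s = ⊤`, on the ambient manifolds), each member of the source being the preimage of the
corresponding member of the target. -/
structure IsCollaring (𝒳 : Arrangement.{u} S) {Y : CornerMfd.{v}} (β : PreEdging 𝒳.ambient Y)
    (γ : 𝒳.CollarFamily Y) : Prop where
  openEmb : ∀ τ τ' : Finset Y.Face, τ' ⊆ τ → ∀ s : S,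
    IsOpenEmbOn
      ((modelWithCornersSelf ℝ ({D // D ∈ τ \ τ'} → ℝ)).prod 𝒳.ambient.model) 𝒳.ambient.model
      (γ τ τ') (orthant {D // D ∈ τ \ τ'} ×ˢ 𝒳.faceSub β τ s) (𝒳.faceSub β τ' s)
  preimage : ∀ τ τ' : Finset Y.Face, τ' ⊆ τ → ∀ s : S, ∀ t ∈ orthant {D // D ∈ τ \ τ'},
    ∀ p ∈ β.faceUnion τ, γ τ τ' (t, p) ∈ 𝒳.sub s → p ∈ 𝒳.sub s
  comp : ∀ τ τ' τ'' : Finset Y.Face, τ' ⊆ τ → τ'' ⊆ τ' →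
    ∀ u ∈ orthant {D // D ∈ τ' \ τ''}, ∀ t ∈ orthant {D // D ∈ τ \ τ'}, ∀ p ∈ β.faceUnion τ,
      γ τ' τ'' (u, γ τ τ' (t, p)) = γ τ τ'' (glue u t, p)

end Arrangement

open Filter Topology
open scoped NNReal

set_option linter.unusedSectionVars false

/-! ### The inverse function theorem on quadrants -/

/-! For a connected face `D` of `Y` let `F D` be the union of the faces of `|𝒳|` with label `D`
(`labelFace`). Then `∂̄^β_τ|𝒳|` is the intersection of the `F D` with `D ∈ τ` (`mem_faceUnion`). So
it suffices to find one collar `γ D` of each `F D` such that these collars commute on common faces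
and preserve the members `𝒳(s)` and the other `F D'`. The map for `τ ≤ τ'` is the composition of the
`γ D` with `D ∈ τ \ τ'`, and the composition law is commutativity (`exists_isCollaring`).

The collars come from pushes: germs at time zero of smooth one-sided motions which start at the
identity and preserve strata. No vector field is integrated. Pushes are composed and slowed down by
functions, and since their velocity normal to `F` is never negative, transversality survives
composition. Hence chart translations slowed down by a partition of unity compose to a transverse
push (`exists_push`), and an inverse function theorem on quadrants (`quad_inverse`) turns it into a
tube, that is, an inverse `(ρ, π)` near `F` (`exists_isTube`).

Commutation is arranged one label at a time. Near an earlier `F j` the new push is replaced by its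
transport, which keeps `ρ j` and acts on `π j`; the two are glued with a cutoff that is constant
along the tubes already treated (`exists_compatPush_succ`). Such cutoffs exist because smooth
functions can be uniformly approximated by functions constant along the tubes near the faces
(`IsSystem.exists_inv`). The same approximation, applied to an exhaustion function, yields a
positive size function constant along the tubes; rescaling time by it extends the germs to all of
`ℝ₊` without losing commutation (`exists_collars`).

Neatness and the edging supply charts in which normal translation preserves the strata
(`nonempty_adaptedChart`). The boundary hyperplanes of an `𝒳`-chart are the connected faces it
meets, by counting faces through a point (`exists_faces`); the edging leaves only one with label
`D`; and neatness forces its normal coordinate to be a coordinate of every member near the point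
(`mem_of_isChart`). -/

/-- The derivative of `g` is the inverse of the derivative of `f` taken along `g`, so it is of class
`C^n` as soon as `g` is; induction gives all orders. -/
theorem contDiffOn_inverse_of_hasFDerivWithinAt {E : Type*} [NormedAddCommGroup E]
    [NormedSpace ℝ E] [CompleteSpace E] {f g : E → E} {s t : Set E}
    (hs : UniqueDiffOn ℝ s) (ht : UniqueDiffOn ℝ t) (hgt : MapsTo g t s)
    (hfg : ∀ y ∈ t, f (g y) = y) (hf : ContDiffOn ℝ ∞ f s) (hg : ContinuousOn g t)
    (hd : ∀ x ∈ s, ∃ e : E ≃L[ℝ] E, HasFDerivWithinAt f (e : E →L[ℝ] E) s x) :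
    ContDiffOn ℝ ∞ g t := by
  have key : ∀ y ∈ t, HasFDerivWithinAt g
      (ContinuousLinearMap.inverse (fderivWithin ℝ f s (g y))) t y := by
    intro y hy
    obtain ⟨e, he⟩ := hd (g y) (hgt hy)
    rw [he.fderivWithin (hs _ (hgt hy)), ContinuousLinearMap.inverse_equiv]
    have := HasFDerivWithinAt.of_comp_of_leftInverse (g := g) (f := f) (h := id) (s := t) (t := s)
      (a := y) (h' := ContinuousLinearMap.id ℝ E) (f'symm := (e.symm : E →L[ℝ] E))
      (f' := (e : E →L[ℝ] E))
      ((hg y hy).tendsto_nhdsWithin hgt) he (hasFDerivWithinAt_id y t)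
      (eventually_nhdsWithin_of_forall hfg) (fun v => by simp) hy
    simpa using this
  have main : ∀ n : ℕ, ContDiffOn ℝ n g t := by
    intro n
    induction n with
    | zero => exact contDiffOn_zero (𝕜 := ℝ).2 hg
    | succ n ih =>
      have : ((n + 1 : ℕ) : WithTop ℕ∞) = (n : WithTop ℕ∞) + 1 := by push_cast; rfl
      rw [this, contDiffOn_succ_iff_fderivWithin ht]
      refine ⟨fun y hy => (key y hy).differentiableWithinAt, fun h => by simp at h, ?_⟩
      have h1 : ContDiffOn ℝ n
          (fun y => ContinuousLinearMap.inverse (fderivWithin ℝ f s (g y))) t := by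
        have h2 : ContDiffOn ℝ n (fderivWithin ℝ f s) s := hf.fderivWithin hs (by
          rw [← this]; exact_mod_cast le_top)
        intro y hy
        obtain ⟨e, he⟩ := hd (g y) (hgt hy)
        have h3 : ContDiffWithinAt ℝ n (fun y => fderivWithin ℝ f s (g y)) t y :=
          (h2.comp ih hgt) y hy
        refine ContDiffAt.comp_contDiffWithinAt y (g := ContinuousLinearMap.inverse) ?_ h3
        rw [he.fderivWithin (hs _ (hgt hy))]
        exact contDiffAt_map_inverse e
      exact h1.congr fun y hy => (key y hy).fderivWithin (ht y hy)
  exact contDiffOn_infty.2 main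

section Quadrant

variable {ι : Type*}

/-- The quadrant on which the coordinates in `K` are non-negative. -/
def quad (K : Set ι) : Set (ι → ℝ) := {x | ∀ l ∈ K, 0 ≤ x l}

theorem zero_mem_quad (K : Set ι) : (0 : ι → ℝ) ∈ quad K := fun _ _ => le_rfl

theorem convex_quad (K : Set ι) : Convex ℝ (quad K) := by
  intro x hx y hy a b ha hb _ l hl
  have := hx l hl
  have := hy l hl
  simp only [Pi.add_apply, Pi.smul_apply, smul_eq_mul]
  positivity

theorem isClosed_quad (K : Set ι) : IsClosed (quad K) := by
  have : quad K = ⋂ l ∈ K, {x : ι → ℝ | 0 ≤ x l} := by ext; simp [quad]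
  rw [this]
  exact isClosed_biInter fun l _ => isClosed_le continuous_const (continuous_apply l)

theorem uniqueDiffOn_quad [Fintype ι] (K : Set ι) : UniqueDiffOn ℝ (quad K) := by
  refine uniqueDiffOn_convex (convex_quad K) ⟨fun _ => 1, ?_⟩
  rw [mem_interior]
  refine ⟨Set.pi univ fun _ => Ioi 0, fun x hx l _ => le_of_lt (hx l trivial),
    isOpen_set_pi finite_univ fun _ _ => isOpen_Ioi, fun l _ => by simp⟩

theorem HasFDerivWithinAt.tendsto_ray {E F : Type*} [NormedAddCommGroup E] [NormedSpace ℝ E]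
    [NormedAddCommGroup F] [NormedSpace ℝ F] {f : E → F} {A : E →L[ℝ] F} {s : Set E} {x v : E}
    (hA : HasFDerivWithinAt f A s x) (hv : ∀ᶠ t in 𝓝[>] (0 : ℝ), x + t • v ∈ s) :
    Tendsto (fun t : ℝ => t⁻¹ • (f (x + t • v) - f x)) (𝓝[>] 0) (𝓝 (A v)) := by
  refine hA.lim ?_ hv ?_
  · have : Continuous fun t : ℝ => t • v := by fun_prop
    simpa using (this.tendsto 0).mono_left nhdsWithin_le_nhds
  · refine tendsto_const_nhds.congr' ?_
    filter_upwards [self_mem_nhdsWithin] with t ht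
    rw [smul_smul, inv_mul_cancel₀ (ne_of_gt ht), one_smul]

/-- Preservation of the hyperplanes makes the rows of `A` in `K` multiples of single coordinates,
with positive factors because `A` is invertible. Extending `f` beyond the quadrant by its linear
part makes the classical inverse function theorem applicable, and positivity of the factors shows
that a preimage of a point of the quadrant lies in the quadrant. -/
theorem quad_inverse [Fintype ι] {K : Set ι} {f : (ι → ℝ) → ι → ℝ} {V : Set (ι → ℝ)}
    (hV : IsOpen V) (h0 : 0 ∈ V) (hf : ContDiffOn ℝ ∞ f (quad K ∩ V)) (f0 : f 0 = 0)
    (hmaps : ∀ x ∈ quad K ∩ V, f x ∈ quad K)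
    (hface : ∀ x ∈ quad K ∩ V, ∀ l ∈ K, x l = 0 → f x l = 0)
    {A : (ι → ℝ) →L[ℝ] ι → ℝ} (hA : HasFDerivWithinAt f A (quad K ∩ V) 0)
    (hinj : Function.Injective A) :
    ∃ V' : Set (ι → ℝ), IsOpen V' ∧ 0 ∈ V' ∧ V' ⊆ V ∧ ∃ W : Set (ι → ℝ), IsOpen W ∧
      ∃ g : (ι → ℝ) → ι → ℝ, f '' (quad K ∩ V') = quad K ∩ W ∧
        ContDiffOn ℝ ∞ g (quad K ∩ W) ∧ ∀ x ∈ quad K ∩ V', g (f x) = x := by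
  classical
  set s := quad K ∩ V with hs
  have hsu : UniqueDiffOn ℝ s := (uniqueDiffOn_quad K).inter hV
  have h0s : (0 : ι → ℝ) ∈ s := ⟨zero_mem_quad K, h0⟩
  -- the rows of `A` indexed by `K` are positive multiples of the coordinates
  have hray : ∀ k, ∀ᶠ t in 𝓝[>] (0 : ℝ), (0 : ι → ℝ) + t • Pi.single k 1 ∈ s := by
    intro k
    have hc : Continuous fun t : ℝ => (0 : ι → ℝ) + t • Pi.single k (1 : ℝ) := by fun_prop
    have h1 : ∀ᶠ t in 𝓝[>] (0 : ℝ), (0 : ι → ℝ) + t • Pi.single k 1 ∈ V :=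
      nhdsWithin_le_nhds (hc.continuousAt.eventually_mem (hV.mem_nhds (by simpa using h0)))
    filter_upwards [h1, self_mem_nhdsWithin] with t ht ht'
    refine ⟨fun l _ => ?_, ht⟩
    rw [mem_Ioi] at ht'
    by_cases hl : l = k
    · subst hl; simp [ht'.le]
    · simp [hl]
  have hlim : ∀ k l, Tendsto (fun t : ℝ => t⁻¹ * f (t • Pi.single k 1) l) (𝓝[>] 0)
      (𝓝 (A (Pi.single k 1) l)) := by
    intro k l
    have := (continuous_apply l).continuousAt.tendsto.comp (hA.tendsto_ray (hray k))
    simpa [Function.comp_def, f0] using this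
  have hA0 : ∀ l ∈ K, ∀ k, k ≠ l → A (Pi.single k 1) l = 0 := by
    intro l hl k hk
    refine tendsto_nhds_unique (hlim k l) (tendsto_const_nhds.congr' ?_)
    filter_upwards [hray k] with t ht
    rw [zero_add] at ht
    rw [hface _ ht l hl (by simp [hk.symm]), mul_zero]
  have hAnn : ∀ l ∈ K, 0 ≤ A (Pi.single l 1) l := by
    intro l hl
    refine ge_of_tendsto (hlim l l) ?_
    filter_upwards [hray l, self_mem_nhdsWithin] with t ht ht'
    rw [zero_add] at ht
    exact mul_nonneg (inv_nonneg.2 (le_of_lt ht')) (hmaps _ ht l hl)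
  have hArow : ∀ l ∈ K, ∀ v, A v l = A (Pi.single l 1) l * v l := by
    intro l hl v
    have : v = ∑ k, v k • Pi.single k (1 : ℝ) := by
      ext j; simp [Finset.sum_apply, Pi.single_apply]
    conv_lhs => rw [this, map_sum, Finset.sum_apply]
    rw [Finset.sum_eq_single l]
    · simp [mul_comm]
    · intro k _ hk; simp [hA0 l hl k hk]
    · simp
  have hsurj : Function.Surjective A :=
    LinearMap.surjective_of_injective (f := (A : (ι → ℝ) →ₗ[ℝ] ι → ℝ)) hinj
  have hApos : ∀ l ∈ K, 0 < A (Pi.single l 1) l := by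
    intro l hl
    refine lt_of_le_of_ne (hAnn l hl) fun h => ?_
    obtain ⟨v, hv⟩ := hsurj (Pi.single l 1)
    have := hArow l hl v
    rw [hv, ← h] at this
    simp at this
  let e : (ι → ℝ) ≃L[ℝ] ι → ℝ :=
    (LinearEquiv.ofBijective (A : (ι → ℝ) →ₗ[ℝ] ι → ℝ) ⟨hinj, hsurj⟩).toContinuousLinearEquiv
  have heA : (e : (ι → ℝ) →L[ℝ] ι → ℝ) = A := by ext; rfl
  obtain ⟨c, hc0, hc⟩ : ∃ c : ℝ≥0, 0 < c ∧
      (Subsingleton (ι → ℝ) ∨ c < ‖(e.symm : (ι → ℝ) →L[ℝ] ι → ℝ)‖₊⁻¹) := by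
    rcases subsingleton_or_nontrivial (ι → ℝ) with h | h
    · exact ⟨1, one_pos, Or.inl h⟩
    · have : 0 < ‖(e.symm : (ι → ℝ) →L[ℝ] ι → ℝ)‖₊⁻¹ := inv_pos.2 e.nnnorm_symm_pos
      obtain ⟨c, h1, h2⟩ := exists_between this
      exact ⟨c, h1, Or.inr h2⟩
  have hfd : ContinuousOn (fderivWithin ℝ f s) s := hf.continuousOn_fderivWithin hsu (by simp)
  have hfd0 : fderivWithin ℝ f s 0 = A := hA.fderivWithin (hsu 0 h0s)
  have hnear : ∀ᶠ x in 𝓝[s] (0 : ι → ℝ), fderivWithin ℝ f s x ∈ Metric.ball A c ∩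
      range ((↑) : ((ι → ℝ) ≃L[ℝ] ι → ℝ) → (ι → ℝ) →L[ℝ] ι → ℝ) := by
    refine (hfd 0 h0s).eventually_mem ?_
    rw [hfd0]
    refine inter_mem (Metric.ball_mem_nhds _ (by exact_mod_cast hc0)) ?_
    rw [← heA]; exact ContinuousLinearEquiv.nhds e
  rw [eventually_nhdsWithin_iff, Metric.eventually_nhds_iff_ball] at hnear
  obtain ⟨ε₁, hε₁, hb₁⟩ := hnear
  obtain ⟨ε₂, hε₂, hb₂⟩ := Metric.isOpen_iff.1 hV 0 h0
  set ε := min ε₁ ε₂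
  have hε : 0 < ε := lt_min hε₁ hε₂
  set V' : Set (ι → ℝ) := Metric.ball 0 ε with hV'
  have hV'V : V' ⊆ V := (Metric.ball_subset_ball (min_le_right _ _)).trans hb₂
  have hqs : quad K ∩ V' ⊆ s := inter_subset_inter_right _ hV'V
  have hgood : ∀ x ∈ quad K ∩ V', fderivWithin ℝ f s x ∈ Metric.ball A c ∩
      range ((↑) : ((ι → ℝ) ≃L[ℝ] ι → ℝ) → (ι → ℝ) →L[ℝ] ι → ℝ) := fun x hx =>
    hb₁ x (Metric.ball_subset_ball (min_le_left _ _) hx.2) (hqs hx)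
  have hder : ∀ x ∈ quad K ∩ V', HasFDerivWithinAt f (fderivWithin ℝ f s x) (quad K ∩ V') x :=
    fun x hx => ((hf.differentiableOn (by simp) x (hqs hx)).hasFDerivWithinAt).mono hqs
  have hlip : LipschitzOnWith c (fun x => f x - A x) (quad K ∩ V') := by
    refine Convex.lipschitzOnWith_of_nnnorm_hasFDerivWithin_le
      (f' := fun x => fderivWithin ℝ f s x - A)
      (fun x hx => (hder x hx).sub A.hasFDerivWithinAt) (fun x hx => ?_)
      ((convex_quad K).inter (convex_ball _ _))
    have := (hgood x hx).1
    rw [mem_ball_iff_norm] at this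
    exact_mod_cast this.le
  -- extension of `f` to a full neighbourhood
  let r : (ι → ℝ) → ι → ℝ := fun x l => if l ∈ K then max (x l) 0 else x l
  have hr1 : ∀ x, r x ∈ quad K := fun x l hl => by simp [r, hl]
  have hr2 : ∀ x ∈ quad K, r x = x := fun x hx => by
    ext l
    by_cases hl : l ∈ K
    · simp [r, hl, hx l hl]
    · simp [r, hl]
  have hr3 : ∀ x y, ‖r x - r y‖ ≤ ‖x - y‖ := by
    intro x y
    refine (pi_norm_le_iff_of_nonneg (norm_nonneg _)).2 fun l => ?_
    refine le_trans ?_ (norm_le_pi_norm (x - y) l)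
    by_cases hl : l ∈ K
    · simpa [r, hl] using abs_max_sub_max_le_abs (x l) (y l) 0
    · simp [r, hl]
  have hr4 : ∀ x ∈ V', r x ∈ V' := by
    intro x hx
    have h := hr3 x 0
    rw [hr2 0 (zero_mem_quad K), sub_zero, sub_zero] at h
    rw [hV', mem_ball_zero_iff] at hx ⊢
    exact h.trans_lt hx
  let F : (ι → ℝ) → ι → ℝ := fun x => f (r x) + A (x - r x)
  have hFf : ∀ x ∈ quad K, F x = f x := fun x hx => by simp [F, hr2 x hx]
  -- `F - A` is `f - A` composed with the retraction `r`, which does not increase distances, so the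
  -- Lipschitz constant carries over to the full ball.
  have happ : ApproximatesLinearOn F (e : (ι → ℝ) →L[ℝ] ι → ℝ) V' c := by
    rw [heA]
    refine ApproximatesLinearOn.approximatesLinearOn_iff_lipschitzOnWith.2 ?_
    refine LipschitzOnWith.of_dist_le_mul fun x hx y hy => ?_
    have h1 := hlip.dist_le_mul (r x) ⟨hr1 x, hr4 x hx⟩ (r y) ⟨hr1 y, hr4 y hy⟩
    have h2 : ∀ z, (F - ⇑A) z = f (r z) - A (r z) := fun z => by simp [F]; abel
    rw [h2, h2]
    refine h1.trans (mul_le_mul_of_nonneg_left ?_ c.2)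
    rw [dist_eq_norm, dist_eq_norm]; exact hr3 x y
  let P := happ.toOpenPartialHomeomorph F V' hc Metric.isOpen_ball
  have hPF : ∀ x, P x = F x := fun x => rfl
  have himage : f '' (quad K ∩ V') = quad K ∩ P.target := by
    ext y
    constructor
    · rintro ⟨x, hx, rfl⟩
      refine ⟨hmaps x (hqs hx), ?_⟩
      rw [← hFf x hx.1]
      exact P.map_source hx.2
    · rintro ⟨hy, hyW⟩
      have hx := P.map_target hyW
      have hFx : F (P.symm y) = y := P.right_inv hyW
      set x := P.symm y
      have hxV : x ∈ V' := hx
      -- A negative coordinate `x l` with `l ∈ K` would be set to `0` by `r`, leaving `F x l` a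
      -- positive multiple of `x l`, although `F x = y` lies in the quadrant.
      have hxq : x ∈ quad K := by
        intro l hl
        by_contra hneg
        push Not at hneg
        have h1 : r x l = 0 := by simp [r, hl, hneg.le]
        have h2 : f (r x) l = 0 := hface _ (hqs ⟨hr1 x, hr4 x hxV⟩) l hl h1
        have h3 : F x l = A (Pi.single l 1) l * x l := by
          simp only [F, Pi.add_apply, h2, zero_add]
          rw [hArow l hl, Pi.sub_apply, h1, sub_zero]
        have h4 := hy l hl
        rw [← hFx, h3] at h4
        exact absurd h4 (not_le.2 (mul_neg_of_pos_of_neg (hApos l hl) hneg))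
      exact ⟨x, ⟨hxq, hxV⟩, by rw [← hFf x hxq, hFx]⟩
  have hleft : ∀ x ∈ quad K ∩ V', P.symm (f x) = x := by
    intro x hx
    rw [← hFf x hx.1]
    exact P.left_inv hx.2
  refine ⟨V', Metric.isOpen_ball, Metric.mem_ball_self hε, hV'V, P.target, P.open_target, P.symm,
    himage, ?_, hleft⟩
  refine contDiffOn_inverse_of_hasFDerivWithinAt
    ((uniqueDiffOn_quad K).inter Metric.isOpen_ball) ((uniqueDiffOn_quad K).inter P.open_target)
    ?_ ?_ (hf.mono hqs) (P.continuousOn_symm.mono inter_subset_right) ?_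
  · intro y hy
    rw [← himage] at hy
    obtain ⟨x, hx, rfl⟩ := hy
    rw [hleft x hx]; exact hx
  · intro y hy
    rw [← himage] at hy
    obtain ⟨x, hx, rfl⟩ := hy
    rw [hleft x hx]
  · intro x hx
    obtain ⟨e', he'⟩ := (hgood x hx).2
    exact ⟨e', he' ▸ hder x hx⟩

end Quadrant

/-! ### Germs of pushes -/

section Push

/-- The half-cylinder `ℝ₊ × F`. -/
def cyl {M : Type*} (F : Set M) : Set (ℝ × M) := Ici 0 ×ˢ F

theorem cyl_mono {M : Type*} {F F' : Set M} (h : F ⊆ F') : cyl F ⊆ cyl F' :=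
  fun _ hz => ⟨hz.1, h hz.2⟩

variable {E : Type*} [NormedAddCommGroup E] [NormedSpace ℝ E] {H : Type*} [TopologicalSpace H]
  {M : Type*} [TopologicalSpace M] [ChartedSpace H M]

variable (I : ModelWithCorners ℝ E H)

/-- A push is the germ along `{0} × M` of a smooth map `ℝ₊ × M → M` which starts at the identity
and preserves every set in `𝒵`. -/
structure IsPush (𝒵 : Set (Set M)) (Φ : ℝ × M → M) : Prop where
  zero : ∀ x, Φ (0, x) = x
  germ : ∀ x, ∀ᶠ z in 𝓝[cyl univ] ((0 : ℝ), x),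
    ContMDiffWithinAt (𝓘(ℝ, ℝ).prod I) I ∞ Φ (cyl univ) z ∧ ∀ Z ∈ 𝒵, (z.2 ∈ Z ↔ Φ z ∈ Z)

variable {I} {𝒵 : Set (Set M)} {Φ Ψ : ℝ × M → M}

theorem mem_cyl_univ_zero (x : M) : ((0 : ℝ), x) ∈ cyl (univ : Set M) :=
  ⟨le_refl (0 : ℝ), trivial⟩

theorem IsPush.contMDiffWithinAt (hΦ : IsPush I 𝒵 Φ) (x : M) :
    ContMDiffWithinAt (𝓘(ℝ, ℝ).prod I) I ∞ Φ (cyl univ) (0, x) :=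
  ((hΦ.germ x).self_of_nhdsWithin (mem_cyl_univ_zero x)).1

theorem IsPush.tendsto (hΦ : IsPush I 𝒵 Φ) (x : M) :
    Tendsto Φ (𝓝[cyl univ] (0, x)) (𝓝 x) := by
  have := (hΦ.contMDiffWithinAt x).continuousWithinAt.tendsto
  rwa [hΦ.zero] at this

theorem tendsto_scale {b : M → ℝ} (hb : Continuous b) (hb0 : ∀ x, 0 ≤ b x) (x : M) :
    Tendsto (fun z : ℝ × M => (b z.2 * z.1, z.2)) (𝓝[cyl univ] (0, x)) (𝓝[cyl univ] (0, x)) := by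
  refine tendsto_nhdsWithin_iff.2 ⟨?_, ?_⟩
  · have : Continuous fun z : ℝ × M => (b z.2 * z.1, z.2) := by fun_prop
    simpa using (this.tendsto ((0 : ℝ), x)).mono_left nhdsWithin_le_nhds
  · filter_upwards [self_mem_nhdsWithin] with z hz
    exact ⟨mul_nonneg (hb0 _) hz.1, trivial⟩

theorem IsPush.tendsto_prodMk (hΦ : IsPush I 𝒵 Φ) (x : M) :
    Tendsto (fun z : ℝ × M => (z.1, Φ z)) (𝓝[cyl univ] (0, x)) (𝓝[cyl univ] (0, x)) := by
  refine tendsto_nhdsWithin_iff.2 ⟨?_, ?_⟩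
  · refine Tendsto.prodMk_nhds ?_ (hΦ.tendsto x)
    exact (continuous_fst.tendsto ((0 : ℝ), x)).mono_left nhdsWithin_le_nhds
  · filter_upwards [self_mem_nhdsWithin] with z hz
    exact ⟨hz.1, trivial⟩

theorem isPush_snd : IsPush I 𝒵 (Prod.snd : ℝ × M → M) :=
  ⟨fun _ => rfl, fun _ => Eventually.of_forall fun _ =>
    ⟨contMDiffWithinAt_snd, fun _ _ => Iff.rfl⟩⟩

/-- Multiply the speed of a push with a function. -/
def scalePush (b : M → ℝ) (Φ : ℝ × M → M) : ℝ × M → M := fun z => Φ (b z.2 * z.1, z.2)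

/-- First follow `Ψ`, then `Φ`. -/
def compPush (Φ Ψ : ℝ × M → M) : ℝ × M → M := fun z => Φ (z.1, Ψ z)

theorem IsPush.scale (hΦ : IsPush I 𝒵 Φ) {b : M → ℝ} (hb : ContMDiff I 𝓘(ℝ, ℝ) ∞ b)
    (hb0 : ∀ x, 0 ≤ b x) : IsPush I 𝒵 (scalePush b Φ) := by
  refine ⟨fun x => by simp [scalePush, hΦ.zero], fun x => ?_⟩
  filter_upwards [(tendsto_scale hb.continuous hb0 x).eventually (hΦ.germ x)] with z hz
  refine ⟨?_, hz.2⟩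
  refine ContMDiffWithinAt.comp (I' := 𝓘(ℝ, ℝ).prod I) z
    (f := fun z : ℝ × M => (b z.2 * z.1, z.2)) hz.1 ?_ ?_
  · exact (((hb.comp contMDiff_snd).mul contMDiff_fst).prodMk
      contMDiff_snd).contMDiffAt.contMDiffWithinAt
  · exact fun z hz => ⟨mul_nonneg (hb0 _) hz.1, trivial⟩

theorem IsPush.comp (hΦ : IsPush I 𝒵 Φ) (hΨ : IsPush I 𝒵 Ψ) : IsPush I 𝒵 (compPush Φ Ψ) := by
  refine ⟨fun x => by simp [compPush, hΦ.zero, hΨ.zero], fun x => ?_⟩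
  filter_upwards [hΨ.germ x, (hΨ.tendsto_prodMk x).eventually (hΦ.germ x)] with z hz hz'
  refine ⟨?_, fun Z hZ => (hz.2 Z hZ).trans (hz'.2 Z hZ)⟩
  refine ContMDiffWithinAt.comp (I' := 𝓘(ℝ, ℝ).prod I) z
    (f := fun z : ℝ × M => (z.1, Ψ z)) hz'.1 (contMDiffWithinAt_fst.prodMk hz.1) ?_
  exact fun z hz => ⟨hz.1, trivial⟩

/-- The value at `r` of the initial velocity of `Φ` at `q` is `v`. -/
def HasVel (Φ : ℝ × M → M) (q : M) (r : M → ℝ) (v : ℝ) : Prop :=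
  HasDerivWithinAt (fun t => r (Φ (t, q))) v (Ici 0) 0

theorem hasDerivWithinAt_of_hasMFDerivWithinAt {c : ℝ → ℝ} {s : Set ℝ} {x : ℝ} {L : ℝ →L[ℝ] ℝ}
    (h : HasMFDerivWithinAt 𝓘(ℝ, ℝ) 𝓘(ℝ, ℝ) c s x L) : HasDerivWithinAt c (L 1) s x := by
  have h' : HasFDerivWithinAt c L s x := hasMFDerivWithinAt_iff_hasFDerivWithinAt.1 h
  exact h'.hasDerivWithinAt

theorem HasVel.unique {q : M} {r : M → ℝ} {v w : ℝ} (h : HasVel Φ q r v) (h' : HasVel Φ q r w) :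
    v = w :=
  UniqueDiffWithinAt.eq_deriv _ (uniqueDiffOn_Ici (0 : ℝ) 0 (by simp)) h h'

theorem IsPush.hasMFDerivWithinAt_curve (hΦ : IsPush I 𝒵 Φ) (q : M) :
    ∃ L, HasMFDerivWithinAt 𝓘(ℝ, ℝ) I (fun t => Φ (t, q)) (Ici 0) 0 L := by
  have h : ContMDiffWithinAt 𝓘(ℝ, ℝ) I ∞ (fun t : ℝ => Φ (t, q)) (Ici 0) 0 :=
    ContMDiffWithinAt.comp (I' := 𝓘(ℝ, ℝ).prod I) (0 : ℝ) (f := fun t : ℝ => (t, q))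
      (hΦ.contMDiffWithinAt q) (contMDiffWithinAt_id.prodMk contMDiffWithinAt_const)
      fun t ht => ⟨ht, trivial⟩
  exact ⟨_, (h.mdifferentiableWithinAt (by simp)).hasMFDerivWithinAt⟩

theorem IsPush.exists_hasVel (hΦ : IsPush I 𝒵 Φ) {q : M} {r : M → ℝ}
    (hr : MDifferentiableAt I 𝓘(ℝ, ℝ) r q) : ∃ v, HasVel Φ q r v := by
  obtain ⟨L, hL⟩ := hΦ.hasMFDerivWithinAt_curve q
  have hr' : HasMFDerivAt I 𝓘(ℝ, ℝ) r (Φ (0, q)) (mfderiv I 𝓘(ℝ, ℝ) r (Φ (0, q))) := by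
    rw [hΦ.zero]; exact hr.hasMFDerivAt
  exact ⟨_, hasDerivWithinAt_of_hasMFDerivWithinAt (hr'.comp_hasMFDerivWithinAt (0 : ℝ) hL)⟩

theorem HasVel.scale {q : M} {r : M → ℝ} {v : ℝ} (h : HasVel Φ q r v) {b : M → ℝ}
    (hb0 : ∀ x, 0 ≤ b x) : HasVel (scalePush b Φ) q r (b q * v) := by
  have h1 : HasDerivWithinAt (fun t : ℝ => b q * t) (b q) (Ici 0) 0 := by
    simpa using ((hasDerivAt_id (0 : ℝ)).const_mul (b q)).hasDerivWithinAt
  have h2 : HasDerivWithinAt (fun t => r (Φ (t, q))) v (Ici 0) (b q * 0) := by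
    rw [mul_zero]; exact h
  have := h2.scomp (0 : ℝ) h1 (fun t ht => mul_nonneg (hb0 q) ht)
  simpa [HasVel, scalePush, Function.comp_def] using this

/-- Chain rule for `r ∘ Φ` at `(0, q)`: its derivative splits into a time part, which gives `v`, and
a space part, which is that of `r` because `Φ (0, ·)` is the identity, and so gives `w` along the
curve of `Ψ`. -/
theorem HasVel.comp (hΦ : IsPush I 𝒵 Φ) (hΨ : IsPush I 𝒵 Ψ) {q : M} {r : M → ℝ}
    (hr : MDifferentiableAt I 𝓘(ℝ, ℝ) r q) {v w : ℝ}
    (h : HasVel Φ q r v) (h' : HasVel Ψ q r w) : HasVel (compPush Φ Ψ) q r (v + w) := by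
  obtain ⟨L, hL⟩ := hΨ.hasMFDerivWithinAt_curve q
  have hr' : HasMFDerivAt I 𝓘(ℝ, ℝ) r (Ψ (0, q)) (mfderiv I 𝓘(ℝ, ℝ) r (Ψ (0, q))) := by
    rw [hΨ.zero]; exact hr.hasMFDerivAt
  have hw : mfderiv I 𝓘(ℝ, ℝ) r (Ψ (0, q)) (L 1) = w :=
    HasVel.unique (hasDerivWithinAt_of_hasMFDerivWithinAt
      (hr'.comp_hasMFDerivWithinAt (0 : ℝ) hL)) h'
  have hg : MDifferentiableWithinAt (𝓘(ℝ, ℝ).prod I) 𝓘(ℝ, ℝ) (fun z => r (Φ z)) (cyl univ)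
      (0, Ψ (0, q)) := by
    have hr1 : MDifferentiableAt I 𝓘(ℝ, ℝ) r (Φ (0, q)) := by rwa [hΦ.zero]
    rw [hΨ.zero]
    exact hr1.comp_mdifferentiableWithinAt _
      ((hΦ.contMDiffWithinAt q).mdifferentiableWithinAt (by simp))
  obtain ⟨D, hD⟩ : ∃ D, HasMFDerivWithinAt (𝓘(ℝ, ℝ).prod I) 𝓘(ℝ, ℝ) (fun z => r (Φ z))
      (cyl univ) (0, Ψ (0, q)) D := ⟨_, hg.hasMFDerivWithinAt⟩
  have hcurve : HasMFDerivWithinAt 𝓘(ℝ, ℝ) (𝓘(ℝ, ℝ).prod I) (fun t => (t, Ψ (t, q))) (Ici 0) 0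
      ((ContinuousLinearMap.id ℝ ℝ).prod L) := (hasMFDerivWithinAt_id _ _).prodMk hL
  have hconst : HasMFDerivWithinAt 𝓘(ℝ, ℝ) (𝓘(ℝ, ℝ).prod I) (fun t : ℝ => (t, Ψ (0, q)))
      (Ici 0) 0 ((ContinuousLinearMap.id ℝ ℝ).prod 0) :=
    (hasMFDerivWithinAt_id _ _).prodMk (hasMFDerivWithinAt_const _ _ _)
  have hspace : HasMFDerivAt I (𝓘(ℝ, ℝ).prod I) (fun x => ((0 : ℝ), x)) (Ψ (0, q))
      ((0 : TangentSpace I (Ψ (0, q)) →L[ℝ] ℝ).prod (ContinuousLinearMap.id ℝ _)) :=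
    (hasMFDerivAt_const _ _).prodMk (hasMFDerivAt_id _)
  have h1 := hasDerivWithinAt_of_hasMFDerivWithinAt (hD.comp (0 : ℝ) hcurve
    (show Ici (0 : ℝ) ⊆ (fun t => (t, Ψ (t, q))) ⁻¹' cyl univ from fun t ht => ⟨ht, trivial⟩))
  have h2 := hasDerivWithinAt_of_hasMFDerivWithinAt (HasMFDerivWithinAt.comp (0 : ℝ) hD hconst
    (show Ici (0 : ℝ) ⊆ (fun t => (t, Ψ (0, q))) ⁻¹' cyl univ from fun t ht => ⟨ht, trivial⟩))
  have h3 := HasMFDerivWithinAt.comp (s := univ) (Ψ (0, q)) hD hspace.hasMFDerivWithinAt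
    (fun x _ => ⟨le_refl (0 : ℝ), trivial⟩)
  have e2 : HasVel Φ q r (D ((ContinuousLinearMap.id ℝ ℝ).prod 0 (1 : ℝ))) := by
    have : (fun t => r (Φ (t, q))) = (fun z => r (Φ z)) ∘ fun t : ℝ => (t, Ψ (0, q)) := by
      ext t; simp [hΨ.zero]
    change HasDerivWithinAt (fun t => r (Φ (t, q))) _ _ _
    rw [this]; exact h2
  have e3 : mfderiv I 𝓘(ℝ, ℝ) r (Ψ (0, q)) =
      D.comp ((0 : TangentSpace I (Ψ (0, q)) →L[ℝ] ℝ).prod (ContinuousLinearMap.id ℝ _)) := by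
    have : r = (fun z => r (Φ z)) ∘ fun x : M => ((0 : ℝ), x) := by
      ext x; simp [hΦ.zero]
    conv_lhs => rw [this]
    exact (hasMFDerivWithinAt_univ.1 h3).mfderiv
  have e2' := HasVel.unique e2 h
  rw [e3] at hw
  have hsum : D (((ContinuousLinearMap.id ℝ ℝ).prod L) (1 : ℝ)) = v + w := by
    rw [← e2', ← hw]
    refine Eq.trans ?_ (map_add D _ _)
    congr 1
    exact Prod.ext (add_zero (1 : ℝ)).symm (zero_add (L (1 : ℝ))).symm
  rw [← hsum]
  exact h1

end Push

/-! ### Adapted charts and transversality of pushes -/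

section AdaptedChart

variable {E : Type*} [NormedAddCommGroup E] [NormedSpace ℝ E] {H : Type*} [TopologicalSpace H]
  {M : Type*} [TopologicalSpace M] [ChartedSpace H M]

/-- A chart at `p` with values in a quadrant in which `F` is the hyperplane `x i = 0`, the sets in
`𝒵` are invariant under translation in the direction of `i`, and all the other boundary hyperplanes
of the quadrant belong to `𝒵`. -/
structure AdaptedChart (I : ModelWithCorners ℝ E H) (m : ℕ) (F : Set M) (𝒵 : Set (Set M))
    (p : M) where
  U : Set M
  φ : M → Fin m → ℝ
  ψ : (Fin m → ℝ) → M
  K : Set (Fin m)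
  i : Fin m
  W : Set (Fin m → ℝ)
  isOpen_U : IsOpen U
  mem_U : p ∈ U
  map_center : φ p = 0
  i_mem : i ∈ K
  isOpen_W : IsOpen W
  image_eq : φ '' U = quad K ∩ W
  left_inv : ∀ q ∈ U, ψ (φ q) = q
  smooth_φ : ContMDiffOn I 𝓘(ℝ, Fin m → ℝ) ∞ φ U
  smooth_ψ : ContMDiffOn 𝓘(ℝ, Fin m → ℝ) I ∞ ψ (quad K ∩ W)
  mem_F : ∀ q ∈ U, q ∈ F ↔ φ q i = 0
  push : ∀ Z ∈ 𝒵, ∀ q ∈ U, ∀ t : ℝ, 0 ≤ t → φ q + t • Pi.single i 1 ∈ W →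
    (q ∈ Z ↔ ψ (φ q + t • Pi.single i 1) ∈ Z)
  face : ∀ l ∈ K, l ≠ i → ∃ Z ∈ 𝒵, ∀ q ∈ U, q ∈ Z ↔ φ q l = 0

variable {I : ModelWithCorners ℝ E H} {m : ℕ} {F : Set M} {𝒵 : Set (Set M)} {p : M}
  {Φ Ψ : ℝ × M → M}

namespace AdaptedChart

variable (c : AdaptedChart I m F 𝒵 p)

theorem map_mem {q : M} (hq : q ∈ c.U) : c.φ q ∈ quad c.K ∩ c.W :=
  c.image_eq ▸ mem_image_of_mem _ hq

theorem symm_mem {y : Fin m → ℝ} (hy : y ∈ quad c.K ∩ c.W) : c.ψ y ∈ c.U := by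
  rw [← c.image_eq] at hy
  obtain ⟨q, hq, rfl⟩ := hy
  rwa [c.left_inv q hq]

theorem right_inv {y : Fin m → ℝ} (hy : y ∈ quad c.K ∩ c.W) : c.φ (c.ψ y) = y := by
  rw [← c.image_eq] at hy
  obtain ⟨q, hq, rfl⟩ := hy
  rw [c.left_inv q hq]

theorem zero_mem : (0 : Fin m → ℝ) ∈ quad c.K ∩ c.W := c.map_center ▸ c.map_mem c.mem_U

theorem symm_zero : c.ψ 0 = p := by
  rw [← c.map_center, c.left_inv p c.mem_U]

theorem contMDiffAt {q : M} (hq : q ∈ c.U) : ContMDiffAt I 𝓘(ℝ, Fin m → ℝ) ∞ c.φ q :=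
  c.smooth_φ.contMDiffAt (c.isOpen_U.mem_nhds hq)

theorem contMDiffWithinAt_symm {y : Fin m → ℝ} (hy : y ∈ quad c.K ∩ c.W) :
    ContMDiffWithinAt 𝓘(ℝ, Fin m → ℝ) I ∞ c.ψ (quad c.K) y :=
  (c.smooth_ψ y hy).mono_of_mem_nhdsWithin
    (inter_mem_nhdsWithin _ (c.isOpen_W.mem_nhds hy.2))

theorem contMDiffAt_apply {q : M} (hq : q ∈ c.U) (l : Fin m) :
    ContMDiffAt I 𝓘(ℝ, ℝ) ∞ (fun x => c.φ x l) q :=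
  contMDiffAt_pi_space.1 (c.contMDiffAt hq) l

theorem mdifferentiableAt_apply {q : M} (hq : q ∈ c.U) (l : Fin m) :
    MDifferentiableAt I 𝓘(ℝ, ℝ) (fun x => c.φ x l) q :=
  (c.contMDiffAt_apply hq l).mdifferentiableAt (by simp)

end AdaptedChart

/-- The initial velocity of `Φ` at `q` is transverse to `F`. -/
def PosPush (I : ModelWithCorners ℝ E H) (F : Set M) (Φ : ℝ × M → M) (q : M) : Prop :=
  ∃ (r : M → ℝ) (v : ℝ), MDifferentiableAt I 𝓘(ℝ, ℝ) r q ∧ (∀ᶠ x in 𝓝 q, x ∈ F → r x = 0) ∧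
    HasVel Φ q r v ∧ v ≠ 0

theorem hasVel_iff_tendsto {q : M} {r : M → ℝ} {v : ℝ} : HasVel Φ q r v ↔
    Tendsto (fun t : ℝ => t⁻¹ * (r (Φ (t, q)) - r (Φ (0, q)))) (𝓝[>] 0) (𝓝 v) := by
  have h5 : Ici (0 : ℝ) \ {0} = Ioi 0 := by
    ext x; simp [lt_iff_le_and_ne, eq_comm]
  unfold HasVel
  rw [hasDerivWithinAt_iff_tendsto_slope, h5]
  refine tendsto_congr fun t => ?_
  simp [slope]

theorem tendsto_ray_cyl (q : M) :
    Tendsto (fun t : ℝ => (t, q)) (𝓝[>] 0) (𝓝[cyl univ] ((0 : ℝ), q)) := by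
  refine tendsto_nhdsWithin_iff.2 ⟨?_, ?_⟩
  · have : Continuous fun t : ℝ => (t, q) := by fun_prop
    exact (this.tendsto 0).mono_left nhdsWithin_le_nhds
  · filter_upwards [self_mem_nhdsWithin] with t ht
    exact ⟨le_of_lt (show (0 : ℝ) < t from ht), trivial⟩

/-- The curve starts at coordinate `0` and stays in the quadrant. This sign prevents velocities from
cancelling when pushes are composed. -/
theorem HasVel.nonneg (hΦ : IsPush I 𝒵 Φ) (c : AdaptedChart I m F 𝒵 p) {v : ℝ} {l : Fin m}
    (hl : l ∈ c.K) (h : HasVel Φ p (fun x => c.φ x l) v) : 0 ≤ v := by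
  rw [hasVel_iff_tendsto] at h
  refine ge_of_tendsto h ?_
  filter_upwards [((hΦ.tendsto p).comp (tendsto_ray_cyl p)).eventually_mem
    (c.isOpen_U.mem_nhds c.mem_U), self_mem_nhdsWithin] with t ht ht'
  rw [hΦ.zero, c.map_center]
  refine mul_nonneg (inv_nonneg.2 (le_of_lt ht')) ?_
  simpa using (c.map_mem ht).1 l hl

theorem AdaptedChart.eventually_ray_mem (c : AdaptedChart I m F 𝒵 p) (l : Fin m) :
    ∀ᶠ t in 𝓝[>] (0 : ℝ), (0 : Fin m → ℝ) + t • Pi.single l 1 ∈ quad c.K ∩ c.W := by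
  have hc : Continuous fun t : ℝ => (0 : Fin m → ℝ) + t • Pi.single l (1 : ℝ) := by fun_prop
  have h1 : ∀ᶠ t in 𝓝[>] (0 : ℝ), (0 : Fin m → ℝ) + t • Pi.single l 1 ∈ c.W :=
    nhdsWithin_le_nhds (hc.continuousAt.eventually_mem
      (c.isOpen_W.mem_nhds (by simpa using c.zero_mem.2)))
  filter_upwards [h1, self_mem_nhdsWithin] with t ht ht'
  refine ⟨fun j _ => ?_, ht⟩
  rw [mem_Ioi] at ht'
  by_cases hj : j = l
  · subst hj; simp [ht'.le]
  · simp [hj]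

/-- Since `r` vanishes on `F`, its derivative in the chart kills all basis vectors except that of
`c.i`, so the velocity of `r` is a multiple of the velocity of the coordinate `c.i`. Transversality
can thus be tested by this coordinate in any adapted chart at `p`. -/
theorem PosPush.hasVel_ne_zero (hΦ : IsPush I 𝒵 Φ) (hP : PosPush I F Φ p)
    (c : AdaptedChart I m F 𝒵 p) {v : ℝ} (h : HasVel Φ p (fun x => c.φ x c.i) v) : v ≠ 0 := by
  obtain ⟨r, w, hr, hrF, hw, hw0⟩ := hP
  have hV : ∀ l, ∃ V, HasVel Φ p (fun x => c.φ x l) V := fun l =>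
    hΦ.exists_hasVel (c.mdifferentiableAt_apply c.mem_U l)
  choose V hV using hV
  have hVi : V c.i = v := HasVel.unique (hV c.i) h
  have hψ : MDifferentiableWithinAt 𝓘(ℝ, Fin m → ℝ) I c.ψ (quad c.K ∩ c.W) 0 :=
    (c.smooth_ψ 0 c.zero_mem).mdifferentiableWithinAt (by simp)
  have hrψ : DifferentiableWithinAt ℝ (fun y => r (c.ψ y)) (quad c.K ∩ c.W) 0 := by
    rw [← mdifferentiableWithinAt_iff_differentiableWithinAt]
    refine MDifferentiableAt.comp_mdifferentiableWithinAt (I' := I) _ ?_ hψ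
    rwa [c.symm_zero]
  obtain ⟨R, hR⟩ : ∃ R, HasFDerivWithinAt (fun y => r (c.ψ y)) R (quad c.K ∩ c.W) 0 :=
    ⟨_, hrψ.hasFDerivWithinAt⟩
  -- the derivative vanishes in the directions of the hyperplane
  have hR0 : ∀ l, l ≠ c.i → R (Pi.single l 1) = 0 := by
    intro l hl
    refine tendsto_nhds_unique (hR.tendsto_ray (c.eventually_ray_mem l))
      (tendsto_const_nhds.congr' ?_)
    have h1 : Tendsto (fun t : ℝ => c.ψ (0 + t • Pi.single l 1)) (𝓝[>] 0) (𝓝 p) := by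
      have h2 := (c.smooth_ψ 0 c.zero_mem).continuousWithinAt.tendsto
      rw [c.symm_zero] at h2
      refine h2.comp (tendsto_nhdsWithin_iff.2 ⟨?_, c.eventually_ray_mem l⟩)
      have hc : Continuous fun t : ℝ => (0 : Fin m → ℝ) + t • Pi.single l (1 : ℝ) := by fun_prop
      simpa using (hc.tendsto 0).mono_left nhdsWithin_le_nhds
    filter_upwards [h1.eventually hrF, c.eventually_ray_mem l] with t ht ht'
    have hpF : r p = 0 := hrF.self_of_nhds ((c.mem_F p c.mem_U).2 (by simp [c.map_center]))
    rw [ht ((c.mem_F _ (c.symm_mem ht')).2 (by rw [c.right_inv ht']; simp [hl.symm]))]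
    simp [c.symm_zero, hpF]
  have hlim : Tendsto (fun t : ℝ => t⁻¹ • c.φ (Φ (t, p))) (𝓝[>] 0) (𝓝 V) := by
    refine tendsto_pi_nhds.2 fun l => ?_
    have := hasVel_iff_tendsto.1 (hV l)
    simpa [hΦ.zero, c.map_center] using this
  have hU : ∀ᶠ t in 𝓝[>] (0 : ℝ), Φ (t, p) ∈ c.U :=
    ((hΦ.tendsto p).comp (tendsto_ray_cyl p)).eventually_mem (c.isOpen_U.mem_nhds c.mem_U)
  have hφ0 : Tendsto (fun t : ℝ => c.φ (Φ (t, p))) (𝓝[>] 0) (𝓝 0) := by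
    have h2 := (c.contMDiffAt c.mem_U).continuousAt.tendsto
    rw [c.map_center] at h2
    exact h2.comp ((hΦ.tendsto p).comp (tendsto_ray_cyl p))
  have hlim2 := hR.lim hφ0 (hU.mono fun t ht => by simpa using c.map_mem ht) hlim
  have hRV : R V = w := by
    refine tendsto_nhds_unique hlim2 ((hasVel_iff_tendsto.1 hw).congr' ?_)
    filter_upwards [hU] with t ht
    simp [c.left_inv _ ht, c.symm_zero, hΦ.zero]
  have hsum : V = ∑ k, V k • Pi.single k (1 : ℝ) := by
    ext j; simp [Finset.sum_apply, Pi.single_apply]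
  rw [hsum, map_sum, Finset.sum_eq_single c.i (fun k _ hk => by simp [hR0 k hk]) (by simp),
    map_smul, hVi] at hRV
  rintro rfl
  exact hw0 (by simpa using hRV.symm)

theorem PosPush.exists_hasVel_pos (hΦ : IsPush I 𝒵 Φ) (hP : PosPush I F Φ p)
    (c : AdaptedChart I m F 𝒵 p) : ∃ v, HasVel Φ p (fun x => c.φ x c.i) v ∧ 0 < v := by
  obtain ⟨v, hv⟩ := hΦ.exists_hasVel (c.mdifferentiableAt_apply c.mem_U c.i)
  exact ⟨v, hv, lt_of_le_of_ne (hv.nonneg hΦ c c.i_mem) (hP.hasVel_ne_zero hΦ c hv).symm⟩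

theorem AdaptedChart.posPush (c : AdaptedChart I m F 𝒵 p) {v : ℝ}
    (h : HasVel Φ p (fun x => c.φ x c.i) v) (hv : v ≠ 0) : PosPush I F Φ p :=
  ⟨_, v, c.mdifferentiableAt_apply c.mem_U c.i, by
    filter_upwards [c.isOpen_U.mem_nhds c.mem_U] with x hx using (c.mem_F x hx).1, h, hv⟩

theorem PosPush.scale {q : M} (hP : PosPush I F Φ q) {b : M → ℝ}
    (hb0 : ∀ x, 0 ≤ b x) (hb : b q ≠ 0) : PosPush I F (scalePush b Φ) q := by
  obtain ⟨r, w, hr, hrF, hw, hw0⟩ := hP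
  exact ⟨r, _, hr, hrF, hw.scale hb0, mul_ne_zero hb hw0⟩

/-- Normal velocities add and are non-negative, so one positive contribution suffices. -/
theorem PosPush.comp (c : AdaptedChart I m F 𝒵 p) (hΦ : IsPush I 𝒵 Φ) (hΨ : IsPush I 𝒵 Ψ)
    (h : PosPush I F Φ p ∨ PosPush I F Ψ p) : PosPush I F (compPush Φ Ψ) p := by
  obtain ⟨v, hv⟩ := hΦ.exists_hasVel (c.mdifferentiableAt_apply c.mem_U c.i)
  obtain ⟨w, hw⟩ := hΨ.exists_hasVel (c.mdifferentiableAt_apply c.mem_U c.i)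
  have hv0 := hv.nonneg hΦ c c.i_mem
  have hw0 := hw.nonneg hΨ c c.i_mem
  refine c.posPush (HasVel.comp hΦ hΨ (c.mdifferentiableAt_apply c.mem_U c.i) hv hw) ?_
  rcases h with h | h
  · have := lt_of_le_of_ne hv0 (h.hasVel_ne_zero hΦ c hv).symm
    positivity
  · have := lt_of_le_of_ne hw0 (h.hasVel_ne_zero hΨ c hw).symm
    positivity

theorem PosPush.congr {q : M} (hP : PosPush I F Φ q) (h : Φ =ᶠ[𝓝[cyl univ] (0, q)] Ψ) :
    PosPush I F Ψ q := by
  obtain ⟨r, w, hr, hrF, hw, hw0⟩ := hP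
  refine ⟨r, w, hr, hrF, ?_, hw0⟩
  rw [hasVel_iff_tendsto] at hw ⊢
  refine hw.congr' ?_
  filter_upwards [(tendsto_ray_cyl q).eventually h] with t ht
  rw [ht, h.self_of_nhdsWithin (mem_cyl_univ_zero q)]

theorem isPush_of_local (h0 : ∀ x, Φ (0, x) = x)
    (h : ∀ x, ∃ Ψ, IsPush I 𝒵 Ψ ∧ Φ =ᶠ[𝓝[cyl univ] (0, x)] Ψ) : IsPush I 𝒵 Φ := by
  refine ⟨h0, fun x => ?_⟩
  obtain ⟨Ψ, hΨ, hx⟩ := h x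
  filter_upwards [hΨ.germ x, eventually_eventually_nhdsWithin.2 hx, hx, self_mem_nhdsWithin]
    with z hz hz1 hz2 hz3
  refine ⟨hz.1.congr_of_eventuallyEq hz1 hz2, fun Z hZ => ?_⟩
  rw [hz.2 Z hZ, hz2]

end AdaptedChart

/-! ### Existence of a push transverse to `F` -/

section BasePush

variable {E : Type*} [NormedAddCommGroup E] [NormedSpace ℝ E] {H : Type*} [TopologicalSpace H]
  {M : Type*} [TopologicalSpace M] [ChartedSpace H M]
  {I : ModelWithCorners ℝ E H} {m : ℕ} {F : Set M} {𝒵 : Set (Set M)} {p : M}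

open Classical in
/-- The push with speed `b` in the direction of the distinguished coordinate of an adapted chart. -/
noncomputable def AdaptedChart.toPush (c : AdaptedChart I m F 𝒵 p) (b : M → ℝ) : ℝ × M → M :=
  fun z => if z.2 ∈ c.U then c.ψ (c.φ z.2 + (b z.2 * z.1) • Pi.single c.i 1) else z.2

theorem AdaptedChart.toPush_eq_self (c : AdaptedChart I m F 𝒵 p) {b : M → ℝ} {z : ℝ × M}
    (h : b z.2 = 0) : c.toPush b z = z.2 := by
  by_cases hz : z.2 ∈ c.U
  · simp [toPush, h, c.left_inv _ hz]
  · simp [toPush, hz]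

theorem AdaptedChart.eventually_toPush (c : AdaptedChart I m F 𝒵 p) {b : M → ℝ}
    (hb : Continuous b) (hb0 : ∀ x, 0 ≤ b x) {x : M} (hx : x ∈ c.U) :
    ∀ᶠ z in 𝓝[cyl univ] ((0 : ℝ), x), z.2 ∈ c.U ∧
      c.φ z.2 + (b z.2 * z.1) • Pi.single c.i 1 ∈ quad c.K ∩ c.W := by
  have h1 : ∀ᶠ z in 𝓝 ((0 : ℝ), x), z.2 ∈ c.U :=
    continuous_snd.continuousAt.eventually_mem (c.isOpen_U.mem_nhds hx)
  have h2 : ∀ᶠ z in 𝓝 ((0 : ℝ), x), c.φ z.2 + (b z.2 * z.1) • Pi.single c.i 1 ∈ c.W := by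
    have hφ : ContinuousAt (fun z : ℝ × M => c.φ z.2) ((0 : ℝ), x) :=
      ContinuousAt.comp (f := fun z : ℝ × M => z.2) (c.contMDiffAt hx).continuousAt
        continuousAt_snd
    have hb' : ContinuousAt (fun z : ℝ × M => (b z.2 * z.1) • (Pi.single c.i 1 : Fin m → ℝ))
        ((0 : ℝ), x) := by fun_prop
    refine (hφ.add hb').eventually_mem (c.isOpen_W.mem_nhds ?_)
    simpa using (c.map_mem hx).2
  filter_upwards [nhdsWithin_le_nhds h1, nhdsWithin_le_nhds h2, self_mem_nhdsWithin]
    with z hz1 hz2 hz3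
  refine ⟨hz1, fun l hl => ?_, hz2⟩
  have h3 := (c.map_mem hz1).1 l hl
  have h4 : 0 ≤ b z.2 * z.1 := mul_nonneg (hb0 _) hz3.1
  by_cases hli : l = c.i
  · subst hli; simpa using add_nonneg h3 h4
  · simpa [hli] using h3

theorem AdaptedChart.isPush_toPush (c : AdaptedChart I m F 𝒵 p) {b : M → ℝ}
    (hb : ContMDiff I 𝓘(ℝ, ℝ) ∞ b) (hb0 : ∀ x, 0 ≤ b x) (hbU : tsupport b ⊆ c.U) :
    IsPush I 𝒵 (c.toPush b) := by
  refine ⟨fun x => ?_, fun x => ?_⟩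
  · by_cases hx : x ∈ c.U
    · simp [toPush, c.left_inv x hx]
    · simp [toPush, hx]
  by_cases hx : x ∈ c.U
  · filter_upwards [c.eventually_toPush hb.continuous hb0 hx, self_mem_nhdsWithin]
      with z ⟨hzU, hzW⟩ hzc
    refine ⟨?_, fun Z hZ => ?_⟩
    · have hU : {w : ℝ × M | w.2 ∈ c.U} ∈ 𝓝 z :=
        continuous_snd.continuousAt.eventually_mem (c.isOpen_U.mem_nhds hzU)
      have h1 : ContMDiffWithinAt (𝓘(ℝ, ℝ).prod I) I ∞
          (fun w : ℝ × M => c.ψ (c.φ w.2 + (b w.2 * w.1) • Pi.single c.i 1))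
          (cyl univ ∩ {w | w.2 ∈ c.U}) z := by
        refine ContMDiffWithinAt.comp (I' := 𝓘(ℝ, Fin m → ℝ)) z
          (f := fun w : ℝ × M => c.φ w.2 + (b w.2 * w.1) • Pi.single c.i 1)
          (c.contMDiffWithinAt_symm hzW) ?_ ?_
        · have hφ : ContMDiffAt (𝓘(ℝ, ℝ).prod I) 𝓘(ℝ, Fin m → ℝ) ∞
              (fun w : ℝ × M => c.φ w.2) z :=
            ContMDiffAt.comp z (f := fun w : ℝ × M => w.2) (c.contMDiffAt hzU) contMDiffAt_snd
          have hb' : ContMDiffAt (𝓘(ℝ, ℝ).prod I) 𝓘(ℝ, Fin m → ℝ) ∞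
              (fun w : ℝ × M => (b w.2 * w.1) • (Pi.single c.i 1 : Fin m → ℝ)) z :=
            (((hb.comp contMDiff_snd).mul contMDiff_fst).smul contMDiff_const).contMDiffAt
          exact (hφ.add hb').contMDiffWithinAt
        · rintro w ⟨hw, hwU⟩ l hl
          have h3 := (c.map_mem hwU).1 l hl
          have h4 : 0 ≤ b w.2 * w.1 := mul_nonneg (hb0 _) hw.1
          by_cases hli : l = c.i
          · subst hli; simpa using add_nonneg h3 h4
          · simpa [hli] using h3
      refine (h1.mono_of_mem_nhdsWithin (inter_mem_nhdsWithin _ hU)).congr_of_eventuallyEq ?_ ?_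
      · filter_upwards [nhdsWithin_le_nhds hU] with w hw
        simp only [toPush, if_pos (show w.2 ∈ c.U from hw)]
      · simp only [toPush, if_pos hzU]
    · rw [toPush, if_pos hzU]
      exact c.push Z hZ _ hzU _ (mul_nonneg (hb0 _) hzc.1) hzW.2
  -- Off `c.U` the speed vanishes near `x`, so the push is locally the identity and the case
  -- distinction in `toPush` is harmless.
  · have h1 : ∀ᶠ y in 𝓝 x, b y = 0 := by
      have : x ∉ tsupport b := fun h => hx (hbU h)
      exact notMem_tsupport_iff_eventuallyEq.1 this
    have h2 : ∀ᶠ z in 𝓝 ((0 : ℝ), x), b z.2 = 0 :=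
      (continuous_snd.tendsto ((0 : ℝ), x)).eventually h1
    filter_upwards [nhdsWithin_le_nhds h2.eventually_nhds] with z hz
    have h3 : c.toPush b =ᶠ[𝓝 z] Prod.snd := hz.mono fun w hw => c.toPush_eq_self hw
    refine ⟨contMDiffAt_snd.congr_of_eventuallyEq h3 |>.contMDiffWithinAt, fun Z _ => ?_⟩
    rw [c.toPush_eq_self hz.self_of_nhds]

theorem AdaptedChart.posPush_toPush (c : AdaptedChart I m F 𝒵 p) {b : M → ℝ}
    (hb : Continuous b) (hb0 : ∀ x, 0 ≤ b x) {q : M} (hq : q ∈ c.U) (hbq : b q ≠ 0) :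
    PosPush I F (c.toPush b) q := by
  refine ⟨fun x => c.φ x c.i, b q, c.mdifferentiableAt_apply hq c.i, ?_, ?_, hbq⟩
  · filter_upwards [c.isOpen_U.mem_nhds hq] with x hx using (c.mem_F x hx).1
  · rw [hasVel_iff_tendsto]
    refine tendsto_const_nhds.congr' ?_
    filter_upwards [(tendsto_ray_cyl q).eventually (c.eventually_toPush hb hb0 hq),
      self_mem_nhdsWithin] with t ht ht'
    have ht0 : t ≠ 0 := ne_of_gt ht'
    simp only [AdaptedChart.toPush, if_pos hq]
    rw [c.right_inv ht.2]
    simp only [mul_zero, zero_smul, add_zero, c.left_inv q hq]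
    simp
    field_simp

/-- The composition of the first `n` members of a sequence of pushes. -/
def iterComp (Ψ : ℕ → ℝ × M → M) : ℕ → ℝ × M → M
  | 0 => Prod.snd
  | n + 1 => compPush (Ψ n) (iterComp Ψ n)

theorem isPush_iterComp {Ψ : ℕ → ℝ × M → M} (h : ∀ n, IsPush I 𝒵 (Ψ n)) (n : ℕ) :
    IsPush I 𝒵 (iterComp Ψ n) := by
  induction n with
  | zero => exact isPush_snd
  | succ n ih => exact (h n).comp ih

theorem posPush_iterComp {Ψ : ℕ → ℝ × M → M} (h : ∀ n, IsPush I 𝒵 (Ψ n))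
    (c : AdaptedChart I m F 𝒵 p) {k : ℕ} (hk : PosPush I F (Ψ k) p) {n : ℕ} (hn : k < n) :
    PosPush I F (iterComp Ψ n) p := by
  induction n with
  | zero => omega
  | succ n ih =>
    refine PosPush.comp c (h n) (isPush_iterComp h n) ?_
    rcases Nat.lt_succ_iff_lt_or_eq.1 hn with h | h
    · exact Or.inr (ih h)
    · exact Or.inl (h ▸ hk)

open Classical in
/-- The composition of a locally finite sequence of pushes. -/
noncomputable def infComp (Ψ : ℕ → ℝ × M → M) : ℝ × M → M := fun z =>
  if h : ∃ N, ∀ n ≥ N, iterComp Ψ n z = iterComp Ψ N z then iterComp Ψ h.choose z else z.2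

theorem infComp_eq {Ψ : ℕ → ℝ × M → M} {z : ℝ × M} {N : ℕ}
    (h : ∀ n ≥ N, iterComp Ψ n z = iterComp Ψ N z) : infComp Ψ z = iterComp Ψ N z := by
  have h' : ∃ N, ∀ n ≥ N, iterComp Ψ n z = iterComp Ψ N z := ⟨N, h⟩
  rw [infComp, dif_pos h']
  rw [← h'.choose_spec (max N h'.choose) (le_max_right _ _), h _ (le_max_left _ _)]

/-- Continuity at time zero keeps the images under the first `N` pushes inside `T`, where all later
pushes are the identity. -/
theorem infComp_eventuallyEq {Ψ : ℕ → ℝ × M → M} (h : ∀ n, IsPush I 𝒵 (Ψ n)) {S : ℕ → Set M}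
    (hS : ∀ n, ∀ z : ℝ × M, z.2 ∉ S n → Ψ n z = z.2) {x : M} {T : Set M} (hT : T ∈ 𝓝 x) {N : ℕ}
    (hN : ∀ n ≥ N, Disjoint (S n) T) :
    infComp Ψ =ᶠ[𝓝[cyl univ] (0, x)] iterComp Ψ N := by
  filter_upwards [((isPush_iterComp h N).tendsto x).eventually_mem hT] with z hz
  refine infComp_eq fun n hn => ?_
  induction n, hn using Nat.le_induction with
  | base => rfl
  | succ n hn ih =>
    rw [iterComp, compPush, ih, hS n]
    exact fun h => (hN n hn).le_bot ⟨h, hz⟩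

/-- Translations in adapted charts, slowed down by a subordinate partition of unity, are composed
instead of added. At a point of `F` some function of the partition is positive, and the other
factors cannot undo the normal velocity of that translation. -/
theorem exists_push [FiniteDimensional ℝ E] [T2Space M] [SecondCountableTopology M]
    [SigmaCompactSpace M] [IsManifold I ∞ M] (hF : IsClosed F)
    (hc : ∀ p ∈ F, Nonempty (AdaptedChart I m F 𝒵 p)) :
    ∃ Φ, IsPush I 𝒵 Φ ∧ ∀ q ∈ F, PosPush I F Φ q := by
  rcases F.eq_empty_or_nonempty with rfl | ⟨p₀, hp₀⟩
  · exact ⟨Prod.snd, isPush_snd, fun q hq => hq.elim⟩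
  have c : ∀ p : F, AdaptedChart I m F 𝒵 (p : M) := fun p => (hc p p.2).some
  obtain ⟨T, hT, hTu⟩ := TopologicalSpace.isOpen_iUnion_countable
    (fun p : F => (c p).U) (fun p => (c p).isOpen_U)
  have hcov : F ⊆ ⋃ p ∈ T, (c p).U := by
    rw [hTu]
    exact fun p hp => mem_iUnion.2 ⟨⟨p, hp⟩, (c ⟨p, hp⟩).mem_U⟩
  have hTne : T.Nonempty := by
    obtain ⟨p, hp, -⟩ := mem_iUnion₂.1 (hcov hp₀)
    exact ⟨p, hp⟩
  obtain ⟨e, rfl⟩ := hT.exists_eq_range hTne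
  obtain ⟨f, hf⟩ := SmoothPartitionOfUnity.exists_isSubordinate I hF (fun n => (c (e n)).U)
    (fun n => (c (e n)).isOpen_U) (by simpa using hcov)
  have hpush : ∀ n, IsPush I 𝒵 ((c (e n)).toPush (f n)) := fun n =>
    (c (e n)).isPush_toPush (f n).contMDiff (f.nonneg n) (hf n)
  -- `N` is taken beyond a prescribed `k`, so that a chosen factor occurs in the local composition.
  have hloc : ∀ x : M, ∀ k : ℕ, ∃ N > k, infComp (fun n => (c (e n)).toPush (f n))
      =ᶠ[𝓝[cyl univ] (0, x)] iterComp (fun n => (c (e n)).toPush (f n)) N := by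
    intro x k
    obtain ⟨T, hT, hfin⟩ := f.locallyFinite x
    obtain ⟨B, hB⟩ := hfin.bddAbove
    refine ⟨max B k + 1, by omega, infComp_eventuallyEq hpush
      (S := fun n => Function.support (f n))
      (fun n z hz => (c (e n)).toPush_eq_self (Function.notMem_support.1 hz)) hT fun n hn => ?_⟩
    rw [disjoint_iff_inter_eq_empty, ← not_nonempty_iff_eq_empty]
    intro h
    have := hB h
    omega
  refine ⟨infComp (fun n => (c (e n)).toPush (f n)), isPush_of_local (fun x => ?_) (fun x => ?_),
    fun q hq => ?_⟩
  · obtain ⟨N, -, hN⟩ := hloc x 0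
    rw [hN.self_of_nhdsWithin (mem_cyl_univ_zero x), (isPush_iterComp hpush N).zero]
  · obtain ⟨N, -, hN⟩ := hloc x 0
    exact ⟨_, isPush_iterComp hpush N, hN⟩
  · obtain ⟨k, hk⟩ := f.exists_pos_of_mem hq
    obtain ⟨N, hkN, hN⟩ := hloc q k
    have hkU : q ∈ (c (e k)).U := hf k (subset_tsupport _ hk.ne')
    have := (c (e k)).posPush_toPush (f k).contMDiff.continuous (f.nonneg k) hkU hk.ne'
    exact (posPush_iterComp hpush (c ⟨q, hq⟩) this hkN).congr hN.symm

end BasePush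

/-! ### Inverting a transverse push near `F` -/

section Tube

variable {E : Type*} [NormedAddCommGroup E] [NormedSpace ℝ E] {H : Type*} [TopologicalSpace H]
  {M : Type*} [TopologicalSpace M] [ChartedSpace H M]
  {I : ModelWithCorners ℝ E H} {m : ℕ} {F : Set M} {𝒵 : Set (Set M)} {p : M} {Φ : ℝ × M → M}

theorem tendsto_normal {K : Set (Fin m)} {i : Fin m} (hi : i ∈ K) {W : Set (Fin m → ℝ)}
    (hW : IsOpen W) (h0 : 0 ∈ W) : Tendsto (fun z : Fin m → ℝ => z - z i • Pi.single i (1 : ℝ))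
      (𝓝[quad K] 0) (𝓝[quad K ∩ W] 0) := by
  have hc : Continuous fun z : Fin m → ℝ => z - z i • Pi.single i (1 : ℝ) := by fun_prop
  have h1 : Tendsto (fun z : Fin m → ℝ => z - z i • Pi.single i (1 : ℝ)) (𝓝[quad K] 0) (𝓝 0) := by
    simpa using (hc.tendsto 0).mono_left nhdsWithin_le_nhds
  refine tendsto_nhdsWithin_iff.2 ⟨h1, ?_⟩
  filter_upwards [self_mem_nhdsWithin, h1.eventually_mem (hW.mem_nhds h0)] with z hz hz'
  refine ⟨fun l hl => ?_, hz'⟩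
  by_cases hli : l = i
  · subst hli; simp
  · simpa [hli] using hz l hl

/-- In the chart, `z c.i` serves as collar time and the point with that coordinate erased as base
point. The resulting map `f` is the identity on the hyperplane, has a positive diagonal entry in the
normal direction by transversality, and maps the other hyperplanes into themselves because they
belong to `𝒵`. So `quad_inverse` inverts it, and `ρ` and `π` are read off from the inverse. -/
theorem exists_local_inverse (hΦ : IsPush I 𝒵 Φ) (c : AdaptedChart I m F 𝒵 p)
    (hP : PosPush I F Φ p) :
    ∃ (V : Set M) (ρ : M → ℝ) (π : M → M), IsOpen V ∧ ContMDiffOn I 𝓘(ℝ, ℝ) ∞ ρ V ∧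
      ContMDiffOn I I ∞ π V ∧ (∀ x ∈ V, 0 ≤ ρ x ∧ π x ∈ F ∧ Φ (ρ x, π x) = x) ∧
      ∀ᶠ z in 𝓝[cyl F] ((0 : ℝ), p), Φ z ∈ V ∧ ρ (Φ z) = z.1 ∧ π (Φ z) = z.2 := by
  set e : Fin m → ℝ := Pi.single c.i 1 with he
  let μ : (Fin m → ℝ) → ℝ × M := fun z => (z c.i, c.ψ (z - z c.i • e))
  let f : (Fin m → ℝ) → Fin m → ℝ := fun z => c.φ (Φ (μ z))
  have hN := tendsto_normal c.i_mem c.isOpen_W c.zero_mem.2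
  have hμ : Tendsto μ (𝓝[quad c.K] 0) (𝓝[cyl univ] (0, p)) := by
    refine tendsto_nhdsWithin_iff.2 ⟨Tendsto.prodMk_nhds ?_ ?_, ?_⟩
    · exact ((continuous_apply c.i).tendsto (0 : Fin m → ℝ)).mono_left nhdsWithin_le_nhds
    · have h2 := (c.smooth_ψ 0 c.zero_mem).continuousWithinAt.tendsto
      rw [c.symm_zero] at h2
      exact h2.comp hN
    · filter_upwards [self_mem_nhdsWithin] with z hz
      exact ⟨hz _ c.i_mem, trivial⟩
  have hgood : ∀ᶠ z in 𝓝[quad c.K] (0 : Fin m → ℝ), z - z c.i • e ∈ quad c.K ∩ c.W ∧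
      z ∈ c.W ∧ Φ (μ z) ∈ c.U ∧ (ContMDiffWithinAt (𝓘(ℝ, ℝ).prod I) I ∞ Φ (cyl univ) (μ z) ∧
        ∀ Z ∈ 𝒵, ((μ z).2 ∈ Z ↔ Φ (μ z) ∈ Z)) := by
    filter_upwards [hN.eventually_mem self_mem_nhdsWithin,
      nhdsWithin_le_nhds (c.isOpen_W.mem_nhds c.zero_mem.2),
      ((hΦ.tendsto p).comp hμ).eventually_mem (c.isOpen_U.mem_nhds c.mem_U),
      hμ.eventually (hΦ.germ p)] with z h1 h2 h3 h4 using ⟨h1, h2, h3, h4⟩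
  obtain ⟨V₀, hV₀, h0V₀, hV₀g⟩ := mem_nhdsWithin.1 hgood
  replace hV₀g : ∀ z ∈ quad c.K ∩ V₀, z - z c.i • e ∈ quad c.K ∩ c.W ∧
      z ∈ c.W ∧ Φ (μ z) ∈ c.U ∧ (ContMDiffWithinAt (𝓘(ℝ, ℝ).prod I) I ∞ Φ (cyl univ) (μ z) ∧
        ∀ Z ∈ 𝒵, ((μ z).2 ∈ Z ↔ Φ (μ z) ∈ Z)) := fun z hz => hV₀g ⟨hz.2, hz.1⟩
  have hf : ContDiffOn ℝ ∞ f (quad c.K ∩ V₀) := by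
    rw [← contMDiffOn_iff_contDiffOn]
    intro z hz
    obtain ⟨h1, -, h3, h4, -⟩ := hV₀g z hz
    have hlin : ContMDiff 𝓘(ℝ, Fin m → ℝ) 𝓘(ℝ, Fin m → ℝ) ∞
        (fun z : Fin m → ℝ => z - z c.i • e) := by
      rw [contMDiff_iff_contDiff]; fun_prop
    have hψ : ContMDiffWithinAt 𝓘(ℝ, Fin m → ℝ) I ∞ (fun z => c.ψ (z - z c.i • e))
        (quad c.K ∩ V₀) z :=
      ContMDiffWithinAt.comp z (f := fun z : Fin m → ℝ => z - z c.i • e) (c.smooth_ψ _ h1)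
        hlin.contMDiffAt.contMDiffWithinAt fun w hw => (hV₀g w hw).1
    have hi : ContMDiff 𝓘(ℝ, Fin m → ℝ) 𝓘(ℝ, ℝ) ∞ (fun z : Fin m → ℝ => z c.i) := by
      rw [contMDiff_iff_contDiff]; fun_prop
    have hμs : ContMDiffWithinAt 𝓘(ℝ, Fin m → ℝ) (𝓘(ℝ, ℝ).prod I) ∞ μ (quad c.K ∩ V₀) z :=
      hi.contMDiffAt.contMDiffWithinAt.prodMk hψ
    have hΦμ : ContMDiffWithinAt 𝓘(ℝ, Fin m → ℝ) I ∞ (fun z => Φ (μ z)) (quad c.K ∩ V₀) z :=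
      ContMDiffWithinAt.comp (I' := 𝓘(ℝ, ℝ).prod I) z (f := μ) h4 hμs
        fun w hw => ⟨hw.1 _ c.i_mem, trivial⟩
    exact (c.contMDiffAt h3).comp_contMDiffWithinAt z hΦμ
  have f0 : f 0 = 0 := by simp [f, μ, hΦ.zero, c.symm_zero, c.map_center]
  have hfe : ∀ z ∈ quad c.K ∩ V₀, z c.i = 0 → f z = z := by
    intro z hz h
    have := (hV₀g z hz).2.1
    simp only [f, μ, h, zero_smul, sub_zero, hΦ.zero]
    exact c.right_inv ⟨hz.1, this⟩
  have hφμ : ∀ z ∈ quad c.K ∩ V₀, ∀ l, l ≠ c.i → c.φ (μ z).2 l = z l := by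
    intro z hz l hl
    change c.φ (c.ψ (z - z c.i • e)) l = z l
    rw [c.right_inv (hV₀g z hz).1]
    simp [he, hl]
  have hface : ∀ x ∈ quad c.K ∩ V₀, ∀ l ∈ c.K, x l = 0 → f x l = 0 := by
    intro z hz l hl hzl
    by_cases hli : l = c.i
    · rw [hfe z hz (hli ▸ hzl), hzl]
    · obtain ⟨Z, hZ, hZl⟩ := c.face l hl hli
      obtain ⟨h1, h2, h3, h4, h5⟩ := hV₀g z hz
      have hU : (μ z).2 ∈ c.U := c.symm_mem h1
      rw [← hZl _ h3, ← h5 Z hZ, hZl _ hU, hφμ z hz l hli, hzl]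
  have h0s : (0 : Fin m → ℝ) ∈ quad c.K ∩ V₀ := ⟨zero_mem_quad _, h0V₀⟩
  obtain ⟨A, hA⟩ : ∃ A, HasFDerivWithinAt f A (quad c.K ∩ V₀) 0 :=
    ⟨_, (hf.differentiableOn (by simp) 0 h0s).hasFDerivWithinAt⟩
  have hray : ∀ l, ∀ᶠ t in 𝓝[>] (0 : ℝ), (0 : Fin m → ℝ) + t • Pi.single l 1 ∈ quad c.K ∩ V₀ := by
    intro l
    have hc : Continuous fun t : ℝ => (0 : Fin m → ℝ) + t • Pi.single l (1 : ℝ) := by fun_prop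
    have h1 : ∀ᶠ t in 𝓝[>] (0 : ℝ), (0 : Fin m → ℝ) + t • Pi.single l 1 ∈ V₀ :=
      nhdsWithin_le_nhds (hc.continuousAt.eventually_mem (hV₀.mem_nhds (by simpa using h0V₀)))
    filter_upwards [h1, c.eventually_ray_mem l] with t ht ht' using ⟨ht'.1, ht⟩
  have hAl : ∀ l, l ≠ c.i → A (Pi.single l 1) = Pi.single l 1 := by
    intro l hl
    refine tendsto_nhds_unique (hA.tendsto_ray (hray l)) (tendsto_const_nhds.congr' ?_)
    filter_upwards [hray l, self_mem_nhdsWithin] with t ht ht'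
    rw [hfe _ ht (by simp [hl.symm]), f0, zero_add, sub_zero, smul_smul,
      inv_mul_cancel₀ (ne_of_gt ht'), one_smul]
  obtain ⟨v, hv, hv0⟩ := hP.exists_hasVel_pos hΦ c
  have hAi : A e c.i = v := by
    have h1 := ((continuous_apply c.i).tendsto _).comp (hA.tendsto_ray (hray c.i))
    refine tendsto_nhds_unique h1 ((hasVel_iff_tendsto.1 hv).congr fun t => ?_)
    simp [f, μ, he, c.symm_zero, hΦ.zero]
  have hAsum : ∀ w : Fin m → ℝ, A w = ∑ k, w k • A (Pi.single k 1) := by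
    intro w
    have hsum : w = ∑ k, w k • Pi.single k (1 : ℝ) := by
      ext j; simp [Finset.sum_apply, Pi.single_apply]
    conv_lhs => rw [hsum, map_sum]
    simp
  have hinj : Function.Injective A := by
    rw [injective_iff_map_eq_zero]
    intro w hw
    have h1 : A w c.i = w c.i * v := by
      rw [hAsum, Finset.sum_apply, Finset.sum_eq_single c.i]
      · rw [← hAi]; simp [he]
      · intro k _ hk; simp [hAl k hk, hk.symm]
      · simp
    have hwi : w c.i = 0 := by
      rw [hw, Pi.zero_apply] at h1
      exact (mul_eq_zero.1 h1.symm).resolve_right hv0.ne'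
    have h2 : A w = w := by
      rw [hAsum]
      ext j
      rw [Finset.sum_apply, Finset.sum_eq_single j]
      · by_cases hj : j = c.i
        · subst hj; simp [hwi]
        · simp [hAl j hj]
      · intro k _ hk
        by_cases hkc : k = c.i
        · subst hkc; simp [hwi]
        · simp [hAl k hkc, hk.symm]
      · simp
    rw [← h2, hw]
  obtain ⟨V', hV', h0V', hV'V, W', hW', g, himage, hg, hgf⟩ := quad_inverse hV₀ h0V₀ hf f0
    (fun z hz => (c.map_mem (hV₀g z hz).2.2.1).1) hface hA hinj
  have hsub : quad c.K ∩ V' ⊆ quad c.K ∩ V₀ := inter_subset_inter_right _ hV'V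
  have key : ∀ x ∈ c.U ∩ c.φ ⁻¹' W', ∃ z ∈ quad c.K ∩ V', f z = c.φ x ∧ g (c.φ x) = z := by
    rintro x ⟨hxU, hxW⟩
    have : c.φ x ∈ f '' (quad c.K ∩ V') := by
      rw [himage]; exact ⟨(c.map_mem hxU).1, hxW⟩
    obtain ⟨z, hz, hfz⟩ := this
    exact ⟨z, hz, hfz, by rw [← hfz, hgf z hz]⟩
  have hgφ : ContMDiffOn I 𝓘(ℝ, Fin m → ℝ) ∞ (fun x => g (c.φ x)) (c.U ∩ c.φ ⁻¹' W') :=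
    ContMDiffOn.comp (t := quad c.K ∩ W') (contMDiffOn_iff_contDiffOn.2 hg)
      (c.smooth_φ.mono inter_subset_left) fun x hx => ⟨(c.map_mem hx.1).1, hx.2⟩
  refine ⟨c.U ∩ c.φ ⁻¹' W', fun x => g (c.φ x) c.i,
    fun x => c.ψ (g (c.φ x) - g (c.φ x) c.i • e), ?_, ?_, ?_, ?_, ?_⟩
  · exact c.smooth_φ.continuousOn.isOpen_inter_preimage c.isOpen_U hW'
  · exact contMDiffOn_pi_space.1 hgφ c.i
  · refine ContMDiffOn.comp (t := quad c.K ∩ c.W) (I' := 𝓘(ℝ, Fin m → ℝ))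
      (f := fun x => g (c.φ x) - g (c.φ x) c.i • e) c.smooth_ψ ?_ ?_
    · have hlin : ContMDiff 𝓘(ℝ, Fin m → ℝ) 𝓘(ℝ, Fin m → ℝ) ∞
          (fun z : Fin m → ℝ => z - z c.i • e) := by
        rw [contMDiff_iff_contDiff]; fun_prop
      exact hlin.comp_contMDiffOn hgφ
    · intro x hx
      obtain ⟨z, hz, -, hgz⟩ := key x hx
      rw [mem_preimage, hgz]
      exact (hV₀g z (hsub hz)).1
  · intro x hx
    obtain ⟨z, hz, hfz, hgz⟩ := key x hx
    beta_reduce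
    rw [hgz]
    obtain ⟨h1, h2, h3, -⟩ := hV₀g z (hsub hz)
    refine ⟨hz.1 _ c.i_mem, (c.mem_F _ (c.symm_mem h1)).2 ?_, ?_⟩
    · rw [c.right_inv h1]; simp [he]
    · have := c.left_inv _ h3
      rw [← this]
      change c.ψ (f z) = x
      rw [hfz, c.left_inv x hx.1]
  · have hφ0 : Tendsto (fun z : ℝ × M => c.φ z.2 + z.1 • e) (𝓝[cyl F] (0, p)) (𝓝 0) := by
      have h1 : ContinuousAt (fun z : ℝ × M => c.φ z.2) ((0 : ℝ), p) :=
        ContinuousAt.comp (f := fun z : ℝ × M => z.2) (c.contMDiffAt c.mem_U).continuousAt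
          continuousAt_snd
      have h2 : ContinuousAt (fun z : ℝ × M => c.φ z.2 + z.1 • e) ((0 : ℝ), p) := by fun_prop
      have := h2.tendsto
      simp only [c.map_center, zero_smul, add_zero] at this
      exact this.mono_left nhdsWithin_le_nhds
    have hU : ∀ᶠ z in 𝓝[cyl F] ((0 : ℝ), p), z.2 ∈ c.U := nhdsWithin_le_nhds
      (continuous_snd.continuousAt.eventually_mem (c.isOpen_U.mem_nhds c.mem_U))
    filter_upwards [self_mem_nhdsWithin, hU, hφ0.eventually_mem (hV'.mem_nhds h0V')]
      with z hz hzU hzV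
    have hzi : c.φ z.2 c.i = 0 := (c.mem_F _ hzU).1 hz.2
    have hζi : (c.φ z.2 + z.1 • e) c.i = z.1 := by simp [hzi, he]
    have hζq : c.φ z.2 + z.1 • e ∈ quad c.K ∩ V' := by
      refine ⟨fun l hl => ?_, hzV⟩
      by_cases hli : l = c.i
      · subst hli; rw [hζi]; exact hz.1
      · simpa [he, hli] using (c.map_mem hzU).1 l hl
    have hμζ : μ (c.φ z.2 + z.1 • e) = z := by
      simp only [μ, hζi, add_sub_cancel_right, c.left_inv _ hzU]
    have hΦU : Φ z ∈ c.U := by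
      have := (hV₀g _ (hsub hζq)).2.2.1
      rwa [hμζ] at this
    have hfζ : f (c.φ z.2 + z.1 • e) = c.φ (Φ z) := by simp only [f, hμζ]
    have hgζ : g (c.φ (Φ z)) = c.φ z.2 + z.1 • e := by rw [← hfζ, hgf _ hζq]
    refine ⟨⟨hΦU, ?_⟩, ?_, ?_⟩
    · have : f (c.φ z.2 + z.1 • e) ∈ quad c.K ∩ W' := himage ▸ mem_image_of_mem _ hζq
      rw [mem_preimage, ← hfζ]; exact this.2
    · rw [hgζ, hζi]
    · simp only [hgζ, hζi, add_sub_cancel_right, c.left_inv _ hzU]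

/-- The inverse `x ↦ (ρ x, π x)`, defined on an open neighbourhood `O` of `F`, of a collar
`γ : ℝ₊ × F → M`. -/
structure IsTube (I : ModelWithCorners ℝ E H) (F : Set M) (𝒵 : Set (Set M)) (γ : ℝ × M → M)
    (O : Set M) (ρ : M → ℝ) (π : M → M) : Prop where
  isOpen : IsOpen O
  subset : F ⊆ O
  smooth_ρ : ContMDiffOn I 𝓘(ℝ, ℝ) ∞ ρ O
  smooth_π : ContMDiffOn I I ∞ π O
  nonneg : ∀ x ∈ O, 0 ≤ ρ x
  mem : ∀ x ∈ O, π x ∈ F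
  right_inv : ∀ x ∈ O, γ (ρ x, π x) = x
  zero : ∀ x ∈ F, ρ x = 0
  self : ∀ x ∈ F, π x = x
  germ : ∀ x ∈ O, ∀ᶠ z in 𝓝[cyl F] (ρ x, π x), γ z ∈ O ∧ ρ (γ z) = z.1 ∧ π (γ z) = z.2 ∧
    ContMDiffWithinAt (𝓘(ℝ, ℝ).prod I) I ∞ γ (cyl F) z
  strata : ∀ x ∈ O, ∀ Z ∈ 𝒵, (x ∈ Z ↔ π x ∈ Z)

/-- The local inverses are glued; on overlaps they agree because each recovers all nearby points of
the cylinder from their images. The property `P` is carried along so that a condition known near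
`{0} × F` is available over the whole domain of the inverse. -/
theorem exists_isTube [FiniteDimensional ℝ E] [T2Space M] [SigmaCompactSpace M]
    (hΦ : IsPush I 𝒵 Φ) (hc : ∀ p ∈ F, Nonempty (AdaptedChart I m F 𝒵 p))
    (hP : ∀ p ∈ F, PosPush I F Φ p) {P : ℝ × M → Prop}
    (hPr : ∀ p ∈ F, ∀ᶠ z in 𝓝[cyl F] ((0 : ℝ), p), P z) :
    ∃ O ρ π, IsTube I F 𝒵 Φ O ρ π ∧ ∀ x ∈ O, ∀ᶠ z in 𝓝[cyl F] (ρ x, π x), P z := by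
  classical
  have := Manifold.metrizableSpace I M
  let := TopologicalSpace.metrizableSpaceMetric M
  have hloc : ∀ p : F, ∃ (V : Set M) (ρ : M → ℝ) (π : M → M), IsOpen V ∧
      ContMDiffOn I 𝓘(ℝ, ℝ) ∞ ρ V ∧ ContMDiffOn I I ∞ π V ∧
      (∀ x ∈ V, 0 ≤ ρ x ∧ π x ∈ F ∧ Φ (ρ x, π x) = x) ∧
      ∀ᶠ z in 𝓝[cyl F] ((0 : ℝ), (p : M)), Φ z ∈ V ∧ ρ (Φ z) = z.1 ∧ π (Φ z) = z.2 :=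
    fun p => exists_local_inverse hΦ (hc p p.2).some (hP p p.2)
  choose V ρ π hV hρ hπ hVi hVe using hloc
  let Good : F → ℝ × M → Prop := fun p z => (Φ z ∈ V p ∧ ρ p (Φ z) = z.1 ∧ π p (Φ z) = z.2) ∧
    (ContMDiffWithinAt (𝓘(ℝ, ℝ).prod I) I ∞ Φ (cyl F) z ∧ ∀ Z ∈ 𝒵, (z.2 ∈ Z ↔ Φ z ∈ Z)) ∧ P z
  have hr : ∀ p : F, ∃ r > 0, ∀ z ∈ cyl F, z.1 < r → dist z.2 p < r → Good p z := by
    intro p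
    have h1 : ∀ᶠ z in 𝓝[cyl F] ((0 : ℝ), (p : M)), Good p z := by
      filter_upwards [hVe p, nhdsWithin_mono _ (cyl_mono (subset_univ F)) (hΦ.germ p),
        hPr p p.2] with z h1 h2 h3
      exact ⟨h1, ⟨h2.1.mono (cyl_mono (subset_univ F)), h2.2⟩, h3⟩
    rw [eventually_nhdsWithin_iff, Metric.eventually_nhds_iff] at h1
    obtain ⟨r, hr, h⟩ := h1
    refine ⟨r, hr, fun z hz hz1 hz2 => h ?_ hz⟩
    rw [Prod.dist_eq]
    refine max_lt ?_ hz2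
    rw [Real.dist_eq, sub_zero, abs_of_nonneg hz.1]
    exact hz1
  choose r hr0 hr using hr
  -- With quarter radii, if `x` lies in the sets of `p` and `q` and `r q ≤ r p`, the distances from
  -- `π q x` to `q`, on to `x` and on to `p` sum to less than `r p`; so the inverse around `p`
  -- recovers the values of the one around `q`.
  let O : F → Set M := fun p => V p ∩ {x | dist x p < r p / 4 ∧ ρ p x < r p / 4 ∧
    dist (π p x) p < r p / 4}
  have hO : ∀ p, IsOpen (O p) := by
    intro p
    have h1 : O p = {x : M | dist x p < r p / 4} ∩ ((V p ∩ ρ p ⁻¹' Iio (r p / 4)) ∩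
        (V p ∩ π p ⁻¹' {y | dist y p < r p / 4})) := by
      ext x; simp only [O, mem_inter_iff, mem_ofPred_eq, mem_preimage, mem_Iio]; tauto
    rw [h1]
    have h2 : IsOpen {y : M | dist y p < r p / 4} := Metric.isOpen_ball
    exact h2.inter (((hρ p).continuousOn.isOpen_inter_preimage (hV p) isOpen_Iio).inter
      ((hπ p).continuousOn.isOpen_inter_preimage (hV p) h2))
  have huniq' : ∀ p q : F, r q ≤ r p → ∀ x ∈ O p, x ∈ O q → ρ p x = ρ q x ∧ π p x = π q x := by
    rintro p q hpq x ⟨hxp, hp1, hp2, hp3⟩ ⟨hxq, hq1, hq2, hq3⟩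
    obtain ⟨h1, h2, h3⟩ := hVi q x hxq
    have h4 : dist (π q x) p < r p := by
      have := dist_triangle4 (π q x) q x p
      rw [dist_comm (q : M) x] at this
      have := hr0 p
      linarith
    obtain ⟨⟨-, h5, h6⟩, -⟩ := hr p (ρ q x, π q x) ⟨h1, h2⟩ (by
      have := hr0 p; change ρ q x < r p; linarith) h4
    rw [h3] at h5 h6
    exact ⟨h5, h6⟩
  have huniq : ∀ p q : F, ∀ x ∈ O p, x ∈ O q → ρ p x = ρ q x ∧ π p x = π q x := by
    intro p q x hp hq
    rcases le_total (r q) (r p) with h | h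
    · exact huniq' p q h x hp hq
    · exact ⟨(huniq' q p h x hq hp).1.symm, (huniq' q p h x hq hp).2.symm⟩
  let R : M → ℝ := fun x => if h : ∃ p, x ∈ O p then ρ h.choose x else 0
  let Q : M → M := fun x => if h : ∃ p, x ∈ O p then π h.choose x else x
  have hR : ∀ p, ∀ x ∈ O p, R x = ρ p x := by
    intro p x hx
    have h : ∃ p, x ∈ O p := ⟨p, hx⟩
    simp only [R, dif_pos h]
    exact (huniq _ _ x h.choose_spec hx).1
  have hQ : ∀ p, ∀ x ∈ O p, Q x = π p x := by
    intro p x hx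
    have h : ∃ p, x ∈ O p := ⟨p, hx⟩
    simp only [Q, dif_pos h]
    exact (huniq _ _ x h.choose_spec hx).2
  have hcenter : ∀ p : F, (p : M) ∈ O p ∧ ρ p p = 0 ∧ π p p = p := by
    intro p
    obtain ⟨⟨h1, h2, h3⟩, -⟩ := hr p ((0 : ℝ), (p : M)) ⟨le_refl (0 : ℝ), p.2⟩ (hr0 p)
      (by simpa using hr0 p)
    rw [hΦ.zero] at h1 h2 h3
    have := hr0 p
    refine ⟨⟨h1, ?_, ?_, ?_⟩, h2, h3⟩
    · simpa using this
    · rw [h2]; simpa using this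
    · rw [h3]; simpa using this
  have hgood : ∀ p, ∀ x ∈ O p, ((ρ p x, π p x) : ℝ × M) ∈ cyl F ∧
      ∀ᶠ z in 𝓝[cyl F] (ρ p x, π p x), Good p z := by
    rintro p x ⟨hxp, hp1, hp2, hp3⟩
    have h0 := hr0 p
    obtain ⟨h1, h2, h3⟩ := hVi p x hxp
    refine ⟨⟨h1, h2⟩, ?_⟩
    have e1 : ∀ᶠ z : ℝ × M in 𝓝 (ρ p x, π p x), z.1 < r p :=
      continuous_fst.continuousAt.eventually_lt continuousAt_const
        (show ρ p x < r p by linarith)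
    have e2 : ∀ᶠ z : ℝ × M in 𝓝 (ρ p x, π p x), dist z.2 p < r p :=
      (continuous_snd.dist continuous_const).continuousAt.eventually_lt continuousAt_const
        (show dist (π p x) p < r p by linarith)
    filter_upwards [self_mem_nhdsWithin, nhdsWithin_le_nhds e1, nhdsWithin_le_nhds e2]
      with z hz hz1 hz2 using hr p z hz hz1 hz2
  refine ⟨⋃ p, O p, R, Q, ⟨isOpen_iUnion hO, ?_, ?_, ?_, ?_, ?_, ?_, ?_, ?_, ?_, ?_⟩, ?_⟩
  · exact fun x hx => mem_iUnion.2 ⟨⟨x, hx⟩, (hcenter ⟨x, hx⟩).1⟩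
  · intro x hx
    obtain ⟨p, hp⟩ := mem_iUnion.1 hx
    refine ContMDiffAt.contMDiffWithinAt ?_
    refine ((hρ p).contMDiffAt ((hV p).mem_nhds hp.1)).congr_of_eventuallyEq ?_
    filter_upwards [(hO p).mem_nhds hp] with y hy using hR p y hy
  · intro x hx
    obtain ⟨p, hp⟩ := mem_iUnion.1 hx
    refine ContMDiffAt.contMDiffWithinAt ?_
    refine ((hπ p).contMDiffAt ((hV p).mem_nhds hp.1)).congr_of_eventuallyEq ?_
    filter_upwards [(hO p).mem_nhds hp] with y hy using hQ p y hy
  · intro x hx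
    obtain ⟨p, hp⟩ := mem_iUnion.1 hx
    rw [hR p x hp]; exact (hVi p x hp.1).1
  · intro x hx
    obtain ⟨p, hp⟩ := mem_iUnion.1 hx
    rw [hQ p x hp]; exact (hVi p x hp.1).2.1
  · intro x hx
    obtain ⟨p, hp⟩ := mem_iUnion.1 hx
    rw [hR p x hp, hQ p x hp]; exact (hVi p x hp.1).2.2
  · intro x hx
    rw [hR ⟨x, hx⟩ x (hcenter ⟨x, hx⟩).1, (hcenter ⟨x, hx⟩).2.1]
  · intro x hx
    rw [hQ ⟨x, hx⟩ x (hcenter ⟨x, hx⟩).1, (hcenter ⟨x, hx⟩).2.2]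
  · intro x hx
    obtain ⟨p, hp⟩ := mem_iUnion.1 hx
    rw [hR p x hp, hQ p x hp]
    obtain ⟨h1, h2⟩ := hgood p x hp
    have hcont := (h2.self_of_nhdsWithin h1).2.1.1.continuousWithinAt.tendsto
    rw [(hVi p x hp.1).2.2] at hcont
    filter_upwards [h2, hcont.eventually_mem ((hO p).mem_nhds hp)] with z hz hz'
    refine ⟨mem_iUnion.2 ⟨p, hz'⟩, ?_, ?_, hz.2.1.1⟩
    · rw [hR p _ hz', hz.1.2.1]
    · rw [hQ p _ hz', hz.1.2.2]
  · intro x hx Z hZ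
    obtain ⟨p, hp⟩ := mem_iUnion.1 hx
    obtain ⟨h1, h2⟩ := hgood p x hp
    have := (h2.self_of_nhdsWithin h1).2.1.2 Z hZ
    rw [hQ p x hp, this, (hVi p x hp.1).2.2]
  · intro x hx
    obtain ⟨p, hp⟩ := mem_iUnion.1 hx
    rw [hR p x hp, hQ p x hp]
    filter_upwards [(hgood p x hp).2] with z hz using hz.2.2

end Tube

/-! ### Systems of commuting tubes and functions constant along them -/

section System

variable {E : Type*} [NormedAddCommGroup E] [NormedSpace ℝ E] {H : Type*} [TopologicalSpace H]
  {M : Type*} [TopologicalSpace M] [ChartedSpace H M] {I : ModelWithCorners ℝ E H}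

section IsTube

variable {F : Set M} {𝒵 : Set (Set M)} {γ : ℝ × M → M} {O : Set M} {ρ : M → ℝ} {π : M → M}

theorem IsTube.contMDiffAt_ρ (h : IsTube I F 𝒵 γ O ρ π) {x : M} (hx : x ∈ O) :
    ContMDiffAt I 𝓘(ℝ, ℝ) ∞ ρ x := h.smooth_ρ.contMDiffAt (h.isOpen.mem_nhds hx)

theorem IsTube.contMDiffAt_π (h : IsTube I F 𝒵 γ O ρ π) {x : M} (hx : x ∈ O) :
    ContMDiffAt I I ∞ π x := h.smooth_π.contMDiffAt (h.isOpen.mem_nhds hx)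

theorem IsTube.tendsto (h : IsTube I F 𝒵 γ O ρ π) {x : M} (hx : x ∈ O) :
    Tendsto (fun y => (ρ y, π y)) (𝓝 x) (𝓝[cyl F] (ρ x, π x)) := by
  refine tendsto_nhdsWithin_iff.2 ⟨Tendsto.prodMk_nhds
    (h.contMDiffAt_ρ hx).continuousAt (h.contMDiffAt_π hx).continuousAt, ?_⟩
  filter_upwards [h.isOpen.mem_nhds hx] with y hy
  exact ⟨h.nonneg y hy, h.mem y hy⟩

theorem IsTube.tendsto_π (h : IsTube I F 𝒵 γ O ρ π) {x : M} (hx : x ∈ F) :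
    Tendsto π (𝓝 x) (𝓝 x) := by
  have := (h.contMDiffAt_π (h.subset hx)).continuousAt.tendsto
  rwa [h.self x hx] at this

theorem IsTube.apply_zero (h : IsTube I F 𝒵 γ O ρ π) {x : M} (hx : x ∈ F) : γ (0, x) = x := by
  have := h.right_inv x (h.subset hx)
  rwa [h.zero x hx, h.self x hx] at this

theorem IsTube.mem_of_eq_zero (h : IsTube I F 𝒵 γ O ρ π) {x : M} (hx : x ∈ O)
    (h0 : ρ x = 0) : x ∈ F := by
  have := h.right_inv x hx
  rw [h0, h.apply_zero (h.mem x hx)] at this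
  exact this ▸ h.mem x hx

end IsTube

/-- A system of collars of the sets `F j`, `j < k`, any two of which commute near the intersection
of the corresponding sets. -/
structure IsSystem (I : ModelWithCorners ℝ E H) (F : ℕ → Set M) (𝒵 : ℕ → Set (Set M)) (k : ℕ)
    (γ : ℕ → ℝ × M → M) (O : ℕ → Set M) (ρ : ℕ → M → ℝ) (π : ℕ → M → M) : Prop where
  tube : ∀ j < k, IsTube I (F j) (𝒵 j) (γ j) (O j) (ρ j) (π j)
  compat : ∀ i j, i < j → j < k → ∀ x ∈ O j, x ∈ F i → ∀ᶠ z in 𝓝[cyl (F j)] (ρ j x, π j x),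
    ρ i (γ j z) = ρ i z.2 ∧ π i (γ j z) = γ j (z.1, π i z.2)

variable {F : ℕ → Set M} {𝒵 : ℕ → Set (Set M)} {k : ℕ} {γ : ℕ → ℝ × M → M} {O : ℕ → Set M}
  {ρ : ℕ → M → ℝ} {π : ℕ → M → M}

/-- Compatibility at `(ρ j x, π j x)` reads `ρ i x = ρ i (π j x)` and `π i x = γ j (ρ j x, π i (π j
x))`; applying the inverse of `γ j` to the latter gives the other identities. -/
theorem IsSystem.commute (h : IsSystem I F 𝒵 k γ O ρ π) (hFZ : ∀ i j, i ≠ j → F i ∈ 𝒵 j)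
    {i j : ℕ} (hij : i < j) (hjk : j < k) {x₀ : M} (hx : x₀ ∈ O j) (hxi : x₀ ∈ F i) :
    ∀ᶠ x in 𝓝 x₀, x ∈ O j ∧ π i x ∈ O j ∧ ρ i x = ρ i (π j x) ∧
      ρ j (π i x) = ρ j x ∧ π j (π i x) = π i (π j x) := by
  have hi := h.tube i (hij.trans hjk)
  have hj := h.tube j hjk
  have hπ0 : π j x₀ ∈ F i := (hj.strata x₀ hx _ (hFZ i j hij.ne)).1 hxi
  have hπj : Tendsto (π j) (𝓝 x₀) (𝓝 (π j x₀)) := (hj.contMDiffAt_π hx).continuousAt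
  have hz' : Tendsto (fun x => (ρ j x, π i (π j x))) (𝓝 x₀)
      (𝓝[cyl (F j)] (ρ j x₀, π j x₀)) := by
    refine tendsto_nhdsWithin_iff.2 ⟨Tendsto.prodMk_nhds (hj.contMDiffAt_ρ hx).continuousAt
      ((hi.tendsto_π hπ0).comp hπj), ?_⟩
    filter_upwards [hj.isOpen.mem_nhds hx,
      hπj.eventually_mem (hi.isOpen.mem_nhds (hi.subset hπ0))] with y hy hy'
    exact ⟨hj.nonneg y hy, (hi.strata _ hy' _ (hFZ j i hij.ne')).1 (hj.mem y hy)⟩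
  filter_upwards [hj.isOpen.mem_nhds hx, (hj.tendsto hx).eventually
    (h.compat i j hij hjk x₀ hx hxi),
    hz'.eventually (hj.germ x₀ hx)] with x hxO h1 h2
  rw [hj.right_inv x hxO] at h1
  obtain ⟨h1a, h1b⟩ := h1
  rw [← h1b] at h2
  exact ⟨hxO, h2.1, h1a, h2.2.1, h2.2.2.1⟩

/-- `f` is constant along the collar with projection `π` near `F`. -/
def InvNear (F : Set M) (π : M → M) {α : Type*} (f : M → α) : Prop :=
  ∀ p ∈ F, ∀ᶠ x in 𝓝 p, f (π x) = f x

section Extension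

variable [FiniteDimensional ℝ E] [T2Space M] [SigmaCompactSpace M] [IsManifold I ∞ M]

/-- A Urysohn function is approximated by an invariant one up to `1/4` and then composed with a
smooth step that is `0` below `1/4` and `1` above `3/4`. This restores the exact values `0` and `1`
and keeps the invariance. -/
theorem exists_cutoff {n : ℕ} {A B : Set M} (hA : IsClosed A) (hB : IsOpen B) (hAB : A ⊆ B)
    (hinv : ∀ f₀ : M → ℝ, ContMDiff I 𝓘(ℝ, ℝ) ∞ f₀ → ∀ δ > 0, ∃ f : M → ℝ,
      ContMDiff I 𝓘(ℝ, ℝ) ∞ f ∧ (∀ x, |f x - f₀ x| < δ) ∧ ∀ i < n, InvNear (F i) (π i) f) :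
    ∃ b : M → ℝ, ContMDiff I 𝓘(ℝ, ℝ) ∞ b ∧ (∀ x, 0 ≤ b x) ∧ (∀ x, b x ≤ 1) ∧
      (∀ p ∈ A, ∀ᶠ x in 𝓝 p, b x = 1) ∧ tsupport b ⊆ B ∧ ∀ i < n, InvNear (F i) (π i) b := by
  have := Manifold.metrizableSpace I M
  obtain ⟨f₀, h0, h1, -⟩ := exists_contMDiffMap_zero_one_nhds_of_isClosed I (n := ⊤)
    hB.isClosed_compl hA (disjoint_compl_left_iff_subset.2 hAB)
  obtain ⟨f, hf, hff, hfi⟩ := hinv f₀ f₀.contMDiff (1 / 4) (by norm_num)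
  refine ⟨fun x => Real.smoothTransition (2 * f x - 1 / 2), ?_,
    fun x => Real.smoothTransition.nonneg _, fun x => Real.smoothTransition.le_one _, ?_, ?_, ?_⟩
  · have : ContDiff ℝ ∞ fun t : ℝ => Real.smoothTransition (2 * t - 1 / 2) :=
      Real.smoothTransition.contDiff.comp (by fun_prop)
    exact this.contMDiff.comp hf
  · intro p hp
    filter_upwards [eventually_nhdsSet_iff_forall.1 h1 p hp] with x hx
    have := abs_lt.1 (hff x)
    exact Real.smoothTransition.one_of_one_le (by linarith)
  · intro x hx
    by_contra hxB
    refine (notMem_tsupport_iff_eventuallyEq.2 ?_) hx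
    filter_upwards [eventually_nhdsSet_iff_forall.1 h0 x hxB] with y hy
    have := abs_lt.1 (hff y)
    exact Real.smoothTransition.zero_of_nonpos (by linarith)
  · intro i hi p hp
    filter_upwards [hfi i hi p hp] with x hx
    rw [hx]

/-- Each further tube is treated by interpolating from `f` to `f ∘ π n` near `F n`. The
interpolating cutoff must itself be constant along the earlier tubes; it comes from `exists_cutoff`
and the induction hypothesis. Earlier invariances survive since the projections commute near the
intersections. -/
theorem IsSystem.exists_inv (h : IsSystem I F 𝒵 k γ O ρ π) (hFZ : ∀ i j, i ≠ j → F i ∈ 𝒵 j)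
    (hFc : ∀ i, IsClosed (F i)) {n : ℕ} (hn : n ≤ k) :
    ∀ f₀ : M → ℝ, ContMDiff I 𝓘(ℝ, ℝ) ∞ f₀ → ∀ δ > 0, ∃ f : M → ℝ,
      ContMDiff I 𝓘(ℝ, ℝ) ∞ f ∧ (∀ x, |f x - f₀ x| < δ) ∧ ∀ i < n, InvNear (F i) (π i) f := by
  induction n with
  | zero => exact fun f₀ hf₀ δ hδ => ⟨f₀, hf₀, fun x => by simpa using hδ, fun i hi => by omega⟩
  | succ n ih =>
    intro f₀ hf₀ δ hδ
    have ih := ih (by omega)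
    obtain ⟨f, hf, hff, hfi⟩ := ih f₀ hf₀ (δ / 2) (by linarith)
    have hT := h.tube n hn
    have hcont : ContinuousOn (fun x => |f (π n x) - f x|) (O n) :=
      ((hf.continuous.comp_continuousOn hT.smooth_π.continuousOn).sub
        hf.continuous.continuousOn).abs
    -- The cutoff is supported where `f ∘ π n` is within `δ / 2` of `f`; this is the second half of
    -- the error.
    obtain ⟨b, hb, hb0, hb1, hbF, hbB, hbi⟩ := exists_cutoff (I := I) (hFc n)
      (hcont.isOpen_inter_preimage hT.isOpen (isOpen_Iio (a := δ / 2)))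
      (fun x hx => ⟨hT.subset hx, by simpa [hT.self x hx] using hδ⟩) ih
    refine ⟨fun x => f x + b x * (f (π n x) - f x), ?_, ?_, ?_⟩
    · intro x
      by_cases hx : x ∈ tsupport b
      · have h1 : ContMDiffAt I 𝓘(ℝ, ℝ) ∞ (fun x => f (π n x)) x :=
          hf.contMDiffAt.comp x (hT.contMDiffAt_π (hbB hx).1)
        exact (hf x).add ((hb x).mul (h1.sub (hf x)))
      · refine (hf x).congr_of_eventuallyEq ?_
        filter_upwards [notMem_tsupport_iff_eventuallyEq.1 hx] with y hy
        simp [hy]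
    · intro x
      have h1 := hff x
      by_cases hx : x ∈ tsupport b
      · have h2 : |f (π n x) - f x| < δ / 2 := (hbB hx).2
        have h3 : |b x * (f (π n x) - f x)| ≤ |f (π n x) - f x| := by
          rw [abs_mul, abs_of_nonneg (hb0 x)]
          exact mul_le_of_le_one_left (abs_nonneg _) (hb1 x)
        calc |f x + b x * (f (π n x) - f x) - f₀ x|
            = |(f x - f₀ x) + b x * (f (π n x) - f x)| := by ring_nf
          _ ≤ |f x - f₀ x| + |b x * (f (π n x) - f x)| := abs_add_le _ _
          _ < δ := by linarith
      · beta_reduce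
        rw [image_eq_zero_of_notMem_tsupport hx, zero_mul, add_zero]
        linarith
    · intro i hi p hp
      rcases Nat.lt_succ_iff_lt_or_eq.1 hi with hi | rfl
      · have hTi := h.tube i (by omega)
        by_cases hpb : p ∈ tsupport b
        · have hpO := (hbB hpb).1
          have hπp : π n p ∈ F i := (hT.strata p hpO _ (hFZ i n hi.ne)).1 hp
          filter_upwards [hfi i hi p hp, hbi i hi p hp, h.commute hFZ hi hn hpO hp,
            (hT.contMDiffAt_π hpO).continuousAt.tendsto.eventually (hfi i hi _ hπp)]
            with x h1 h2 h3 h4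
          rw [h1, h2, h3.2.2.2.2, h4]
        · have h0 := notMem_tsupport_iff_eventuallyEq.1 hpb
          filter_upwards [hfi i hi p hp, h0, (hTi.tendsto_π hp).eventually h0] with x h1 h2 h3
          simp [h1, h2, h3]
      · filter_upwards [hbF p hp, (hT.tendsto_π hp).eventually (hbF p hp),
          hT.isOpen.mem_nhds (hT.subset hp)] with x h1 h2 h3
        rw [h1, h2, hT.self _ (hT.mem x h3)]
        ring

end Extension

end System

/-! ### Transporting a push along a tube -/

section Transport

variable {E : Type*} [NormedAddCommGroup E] [NormedSpace ℝ E] {H : Type*} [TopologicalSpace H]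
  {M : Type*} [TopologicalSpace M] [ChartedSpace H M] {I : ModelWithCorners ℝ E H}

/-- The push `Φ` commutes with the collar of `F` with inverse `(ρ, π)`. -/
def CompatPush (F : Set M) (ρ : M → ℝ) (π : M → M) (Φ : ℝ × M → M) : Prop :=
  ∀ p ∈ F, ∀ᶠ z in 𝓝[cyl univ] ((0 : ℝ), p), ρ (Φ z) = ρ z.2 ∧ π (Φ z) = Φ (z.1, π z.2)

theorem tendsto_snd_cyl (x : M) : Tendsto Prod.snd (𝓝[cyl univ] ((0 : ℝ), x)) (𝓝 x) :=
  (continuous_snd.tendsto ((0 : ℝ), x)).mono_left nhdsWithin_le_nhds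

section

variable {F : Set M} {𝒵 : Set (Set M)} {ρ : M → ℝ} {π : M → M} {Φ Ψ : ℝ × M → M}

theorem CompatPush.comp (hΨp : IsPush I 𝒵 Ψ) (hΦ : CompatPush F ρ π Φ)
    (hΨ : CompatPush F ρ π Ψ) : CompatPush F ρ π (compPush Φ Ψ) := by
  intro p hp
  filter_upwards [hΨ p hp, (hΨp.tendsto_prodMk p).eventually (hΦ p hp)] with z h1 h2
  exact ⟨h2.1.trans h1.1, h2.2.trans (by simp only [compPush, h1.2])⟩

theorem CompatPush.scale (hΦ : CompatPush F ρ π Φ) {b : M → ℝ} (hb : Continuous b)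
    (hb0 : ∀ x, 0 ≤ b x) (hbi : InvNear F π b) : CompatPush F ρ π (scalePush b Φ) := by
  intro p hp
  filter_upwards [(tendsto_scale hb hb0 p).eventually (hΦ p hp),
    (tendsto_snd_cyl p).eventually (hbi p hp)] with z h1 h2
  exact ⟨h1.1, h1.2.trans (by simp only [scalePush, h2])⟩

open Classical in
/-- The push which on `O` preserves the collar coordinate `ρ` and acts by `Φ`, with speed `b`, on
the second component of the collar. -/
noncomputable def transPush (γ : ℝ × M → M) (O : Set M) (ρ : M → ℝ) (π : M → M) (b : M → ℝ)
    (Φ : ℝ × M → M) : ℝ × M → M :=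
  fun z => if z.2 ∈ O then γ (ρ z.2, Φ (b z.2 * z.1, π z.2)) else z.2

variable {𝒵' : Set (Set M)} {γ : ℝ × M → M} {O : Set M} {b : M → ℝ}

theorem IsTube.transPush_eq_self (h : IsTube I F 𝒵' γ O ρ π) (hΦ : IsPush I 𝒵 Φ) {z : ℝ × M}
    (hz : b z.2 = 0) : transPush γ O ρ π b Φ z = z.2 := by
  by_cases hzO : z.2 ∈ O
  · simp [transPush, hzO, hz, hΦ.zero, h.right_inv]
  · simp [transPush, hzO]

theorem IsTube.tendsto_inner (h : IsTube I F 𝒵' γ O ρ π) (hb : Continuous b)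
    (hb0 : ∀ x, 0 ≤ b x) {x : M} (hx : x ∈ O) :
    Tendsto (fun z : ℝ × M => (b z.2 * z.1, π z.2)) (𝓝[cyl univ] (0, x))
      (𝓝[cyl univ] (0, π x)) := by
  refine tendsto_nhdsWithin_iff.2 ⟨Tendsto.prodMk_nhds ?_
    ((h.contMDiffAt_π hx).continuousAt.tendsto.comp (tendsto_snd_cyl x)), ?_⟩
  · have : Continuous fun z : ℝ × M => b z.2 * z.1 := by fun_prop
    simpa using (this.tendsto ((0 : ℝ), x)).mono_left nhdsWithin_le_nhds
  · filter_upwards [self_mem_nhdsWithin] with z hz using ⟨mul_nonneg (hb0 _) hz.1, trivial⟩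

theorem IsTube.tendsto_outer (h : IsTube I F 𝒵' γ O ρ π) (hΦ : IsPush I 𝒵 Φ) (hF : F ∈ 𝒵)
    (hb : Continuous b) (hb0 : ∀ x, 0 ≤ b x) {x : M} (hx : x ∈ O) :
    Tendsto (fun z : ℝ × M => (ρ z.2, Φ (b z.2 * z.1, π z.2))) (𝓝[cyl univ] (0, x))
      (𝓝[cyl F] (ρ x, π x)) := by
  have hn := h.tendsto_inner hb hb0 hx
  refine tendsto_nhdsWithin_iff.2 ⟨Tendsto.prodMk_nhds
    ((h.contMDiffAt_ρ hx).continuousAt.tendsto.comp (tendsto_snd_cyl x))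
    ((hΦ.tendsto (π x)).comp hn), ?_⟩
  filter_upwards [hn.eventually (hΦ.germ (π x)),
    (tendsto_snd_cyl x).eventually_mem (h.isOpen.mem_nhds hx)] with z hz hzO
  exact ⟨h.nonneg _ hzO, (hz.2 F hF).1 (h.mem _ hzO)⟩

theorem IsTube.eventually_transPush (h : IsTube I F 𝒵' γ O ρ π) (hΦ : IsPush I 𝒵 Φ) (hF : F ∈ 𝒵)
    (hb : Continuous b) (hb0 : ∀ x, 0 ≤ b x) {x : M} (hx : x ∈ O) :
    ∀ᶠ z in 𝓝[cyl univ] ((0 : ℝ), x), transPush γ O ρ π b Φ z ∈ O ∧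
      ρ (transPush γ O ρ π b Φ z) = ρ z.2 ∧
      π (transPush γ O ρ π b Φ z) = Φ (b z.2 * z.1, π z.2) := by
  filter_upwards [(h.tendsto_outer hΦ hF hb hb0 hx).eventually (h.germ x hx),
    (tendsto_snd_cyl x).eventually_mem (h.isOpen.mem_nhds hx)] with z hz hzO
  simp only [transPush, if_pos hzO]
  exact ⟨hz.1, hz.2.1, hz.2.2.1⟩

/-- Membership in a set of `𝒵'` is determined by `π`, on which the push acts by `Φ`. Any other set
of `𝒵` lies in `F`, the zero set of `ρ`; since `ρ` is preserved only points of `F` matter, and there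
the push is `Φ` with speed `b`. -/
theorem IsTube.isPush_transPush (h : IsTube I F 𝒵' γ O ρ π) (hΦ : IsPush I 𝒵 Φ) (hF : F ∈ 𝒵)
    (h𝒵 : ∀ Z ∈ 𝒵, Z ∈ 𝒵' ∨ Z ⊆ F) (hb : ContMDiff I 𝓘(ℝ, ℝ) ∞ b) (hb0 : ∀ x, 0 ≤ b x)
    (hbO : tsupport b ⊆ O) : IsPush I 𝒵 (transPush γ O ρ π b Φ) := by
  refine ⟨fun x => ?_, fun x => ?_⟩
  · by_cases hx : x ∈ O
    · simp [transPush, hx, hΦ.zero, h.right_inv]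
    · simp [transPush, hx]
  by_cases hx : x ∈ O
  · have hn := h.tendsto_inner hb.continuous hb0 hx
    have hm := h.tendsto_outer hΦ hF hb.continuous hb0 hx
    have hmF := eventually_eventually_nhdsWithin.2 (hm.eventually_mem self_mem_nhdsWithin)
    have hOO := (tendsto_snd_cyl x).eventually_mem (h.isOpen.mem_nhds hx)
    filter_upwards [hn.eventually (hΦ.germ (π x)), hm.eventually (h.germ x hx), hOO, hmF,
      eventually_eventually_nhdsWithin.2 hOO, self_mem_nhdsWithin,
      h.eventually_transPush hΦ hF hb.continuous hb0 hx] with z h1 h2 h3 h4 h5 hzc h6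
    refine ⟨?_, fun Z hZ => ?_⟩
    · have hs : ContMDiffWithinAt (𝓘(ℝ, ℝ).prod I) I ∞
          (fun z : ℝ × M => γ (ρ z.2, Φ (b z.2 * z.1, π z.2)))
          (cyl univ ∩ {z | (ρ z.2, Φ (b z.2 * z.1, π z.2)) ∈ cyl F}) z := by
        refine ContMDiffWithinAt.comp (I' := 𝓘(ℝ, ℝ).prod I) z
          (f := fun z : ℝ × M => (ρ z.2, Φ (b z.2 * z.1, π z.2))) h2.2.2.2 ?_ fun w hw => hw.2
        refine ContMDiffWithinAt.prodMk ?_ ?_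
        · exact ((h.contMDiffAt_ρ h3).comp z contMDiffAt_snd).contMDiffWithinAt
        · refine ContMDiffWithinAt.comp (I' := 𝓘(ℝ, ℝ).prod I) z
            (f := fun z : ℝ × M => (b z.2 * z.1, π z.2)) h1.1 ?_ ?_
          · exact ((((hb.comp contMDiff_snd).mul contMDiff_fst).contMDiffAt).prodMk
              ((h.contMDiffAt_π h3).comp z contMDiffAt_snd)).contMDiffWithinAt
          · exact fun w hw => ⟨mul_nonneg (hb0 _) hw.1.1, trivial⟩
      have hs' := hs.mono_of_mem_nhdsWithin (t := cyl univ)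
        (inter_mem self_mem_nhdsWithin h4)
      refine hs'.congr_of_eventuallyEq ?_ ?_
      · filter_upwards [h5] with w hw
        simp only [transPush, if_pos (show w.2 ∈ O from hw)]
      · simp only [transPush, if_pos (show z.2 ∈ O from h3)]
    · obtain ⟨h6a, h6b, h6c⟩ := h6
      by_cases hZ' : Z ∈ 𝒵'
      · rw [h.strata _ h3 Z hZ', h1.2 Z hZ, h.strata _ h6a Z hZ', h6c]
      · have hZF := (h𝒵 Z hZ).resolve_left hZ'
        by_cases hzF : z.2 ∈ F
        · have e1 : π z.2 = z.2 := h.self _ hzF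
          have e2 : transPush γ O ρ π b Φ z = Φ (b z.2 * z.1, z.2) := by
            have := h.mem_of_eq_zero h6a (by rw [h6b, h.zero _ hzF])
            rw [← h.self _ this, h6c, e1]
          have := h1.2 Z hZ
          rw [e1] at this
          rw [e2, this]
        · refine ⟨fun hz => absurd (hZF hz) hzF, fun hz => absurd ?_ hzF⟩
          exact h.mem_of_eq_zero h3 (by rw [← h6b, h.zero _ (hZF hz)])
  · have h1 := notMem_tsupport_iff_eventuallyEq.1 fun hxb => hx (hbO hxb)
    have h2 : ∀ᶠ z in 𝓝 ((0 : ℝ), x), b z.2 = 0 :=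
      (continuous_snd.tendsto ((0 : ℝ), x)).eventually h1
    filter_upwards [nhdsWithin_le_nhds h2.eventually_nhds] with z hz
    have h3 : transPush γ O ρ π b Φ =ᶠ[𝓝 z] Prod.snd :=
      hz.mono fun w hw => h.transPush_eq_self hΦ hw
    refine ⟨contMDiffAt_snd.congr_of_eventuallyEq h3 |>.contMDiffWithinAt, fun Z _ => ?_⟩
    rw [h.transPush_eq_self hΦ hz.self_of_nhds]

/-- If `r` detects transversality of `Φ` at `π q`, then `r ∘ π` detects it here, with velocity
multiplied by `b q`; it vanishes on `F'` because `π` preserves `F'`. -/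
theorem IsTube.posPush_transPush {F' : Set M} (h : IsTube I F 𝒵' γ O ρ π) (hΦ : IsPush I 𝒵 Φ)
    (hF : F ∈ 𝒵) (hF' : F' ∈ 𝒵') (hb : Continuous b) (hb0 : ∀ x, 0 ≤ b x) {q : M} (hq : q ∈ O)
    (hbq : b q ≠ 0) (hP : PosPush I F' Φ (π q)) :
    PosPush I F' (transPush γ O ρ π b Φ) q := by
  obtain ⟨r, w, hr, hrF, hw, hw0⟩ := hP
  have hπ := h.contMDiffAt_π hq
  refine ⟨fun x => r (π x), b q * w, hr.comp q (hπ.mdifferentiableAt (by simp)), ?_, ?_,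
    mul_ne_zero hbq hw0⟩
  · filter_upwards [hπ.continuousAt.tendsto.eventually hrF, h.isOpen.mem_nhds hq]
      with x h1 h2 h3 using h1 ((h.strata x h2 _ hF').1 h3)
  · have h1 : HasVel (scalePush (fun _ => b q) Φ) (π q) r (b q * w) :=
      hw.scale (b := fun _ => b q) fun _ => hb0 q
    rw [hasVel_iff_tendsto] at h1 ⊢
    have h2 := h.eventually_transPush hΦ hF hb hb0 hq
    refine h1.congr' ?_
    filter_upwards [(tendsto_ray_cyl q).eventually h2] with t ht
    rw [ht.2.2, (h2.self_of_nhdsWithin (mem_cyl_univ_zero q)).2.2]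
    simp [scalePush]

end

end Transport

/-! ### Inductive construction of a commuting system -/

section Construction

variable {E : Type*} [NormedAddCommGroup E] [NormedSpace ℝ E] {H : Type*} [TopologicalSpace H]
  {M : Type*} [TopologicalSpace M] [ChartedSpace H M] {I : ModelWithCorners ℝ E H} {m : ℕ}
  {F : ℕ → Set M} {𝒵 : ℕ → Set (Set M)} {k : ℕ} {γ : ℕ → ℝ × M → M} {O : ℕ → Set M}
  {ρ : ℕ → M → ℝ} {π : ℕ → M → M} {Φ : ℝ × M → M}

/-- Every ingredient is compatible with the tube of `F i`: `γ j` and the projections by the system,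
`Φ` by assumption, `b` by invariance. Off `O j` the transported push is locally the identity. -/
theorem IsSystem.compatPush_transPush (h : IsSystem I F 𝒵 k γ O ρ π)
    (hFZ : ∀ i j, i ≠ j → F i ∈ 𝒵 j) {i j : ℕ} (hij : i < j) (hjk : j < k)
    (hΦ : IsPush I (𝒵 k) Φ) (hC : CompatPush (F i) (ρ i) (π i) Φ) {b : M → ℝ}
    (hb : Continuous b) (hb0 : ∀ x, 0 ≤ b x) (hbO : tsupport b ⊆ O j)
    (hbi : InvNear (F i) (π i) b) :
    CompatPush (F i) (ρ i) (π i) (transPush (γ j) (O j) (ρ j) (π j) b Φ) := by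
  have hi := h.tube i (hij.trans hjk)
  have hj := h.tube j hjk
  intro p hp
  by_cases hpO : p ∈ O j
  · have hπp : π j p ∈ F i := (hj.strata p hpO _ (hFZ i j hij.ne)).1 hp
    have hFj : F j ∈ 𝒵 k := hFZ j k hjk.ne
    filter_upwards [(tendsto_snd_cyl p).eventually (h.commute hFZ hij hjk hpO hp),
      (hj.tendsto_outer hΦ hFj hb hb0 hpO).eventually (h.compat i j hij hjk p hpO hp),
      (hj.tendsto_inner hb hb0 hpO).eventually (hC _ hπp),
      (tendsto_snd_cyl p).eventually (hbi p hp)] with z h1 h2 h3 h4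
    obtain ⟨h1a, h1b, h1c, h1d, h1e⟩ := h1
    simp only [transPush, if_pos h1a, if_pos h1b]
    exact ⟨by rw [h2.1, h3.1, h1c], by rw [h2.2, h3.2, h4, h1d, h1e]⟩
  · have h0 := notMem_tsupport_iff_eventuallyEq.1 fun hxb => hpO (hbO hxb)
    filter_upwards [(tendsto_snd_cyl p).eventually h0,
      ((hi.tendsto_π hp).comp (tendsto_snd_cyl p)).eventually h0] with z h1 h2
    rw [hj.transPush_eq_self hΦ h1, hj.transPush_eq_self (z := (z.1, π i z.2)) hΦ h2]
    exact ⟨rfl, rfl⟩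

/-- Near `F` the cutoff is `1`, so the factor with speed `1 - b` stands still and only the
transported push is left. That push keeps `ρ`, moves `π` by `Φ`, and coincides with `Φ` on `F`
itself. -/
theorem IsTube.compatPush_glue {F : Set M} {𝒵 𝒵' : Set (Set M)} {γ : ℝ × M → M} {O : Set M}
    {ρ : M → ℝ} {π : M → M} (h : IsTube I F 𝒵' γ O ρ π) (hΦ : IsPush I 𝒵 Φ) (hF : F ∈ 𝒵)
    {b : M → ℝ} (hb : Continuous b) (hb0 : ∀ x, 0 ≤ b x) (hbF : ∀ p ∈ F, ∀ᶠ x in 𝓝 p, b x = 1)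
    (hT : IsPush I 𝒵 (transPush γ O ρ π b Φ)) :
    CompatPush F ρ π (compPush (scalePush (fun x => 1 - b x) Φ) (transPush γ O ρ π b Φ)) := by
  intro p hp
  have hpO := h.subset hp
  have hn := h.tendsto_inner hb hb0 hpO
  rw [h.self p hp] at hn
  have hπ : Tendsto (fun z : ℝ × M => (z.1, π z.2)) (𝓝[cyl univ] (0, p))
      (𝓝[cyl univ] (0, p)) := by
    refine tendsto_nhdsWithin_iff.2 ⟨Tendsto.prodMk_nhds
      ((continuous_fst.tendsto ((0 : ℝ), p)).mono_left nhdsWithin_le_nhds)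
      ((h.tendsto_π hp).comp (tendsto_snd_cyl p)), ?_⟩
    filter_upwards [self_mem_nhdsWithin] with z hz using ⟨hz.1, trivial⟩
  have hb1 : ∀ᶠ z in 𝓝[cyl univ] ((0 : ℝ), p), b (transPush γ O ρ π b Φ z) = 1 :=
    (hT.tendsto p).eventually (hbF p hp)
  have hcomp : ∀ z : ℝ × M, b (transPush γ O ρ π b Φ z) = 1 →
      compPush (scalePush (fun x => 1 - b x) Φ) (transPush γ O ρ π b Φ) z =
        transPush γ O ρ π b Φ z := by
    intro z hz
    simp [compPush, scalePush, hz, hΦ.zero]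
  filter_upwards [hb1, hπ.eventually hb1, h.eventually_transPush hΦ hF hb hb0 hpO,
    (tendsto_snd_cyl p).eventually (hbF p hp),
    ((h.tendsto_π hp).comp (tendsto_snd_cyl p)).eventually (hbF p hp),
    (tendsto_snd_cyl p).eventually_mem (h.isOpen.mem_nhds hpO),
    hn.eventually (hΦ.germ p)] with z h1 h2 h3 h4 h5 h6 h7
  rw [hcomp z h1, hcomp _ h2]
  refine ⟨h3.2.1, ?_⟩
  have hπF := h.mem _ h6
  simp only [Function.comp_apply] at h5
  simp only [h4, one_mul] at h3 h7
  rw [h3.2.2]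
  simp only [transPush, if_pos (h.subset hπF), h.zero _ hπF, h.self _ hπF, h5, one_mul]
  exact (h.apply_zero ((h7.2 F hF).1 hπF)).symm

section Extension

variable [FiniteDimensional ℝ E] [T2Space M] [SigmaCompactSpace M] [IsManifold I ∞ M]

/-- The new push is the transport of `Φ` with speed `b`, followed by `Φ` with speed `1 - b`. At a
point of `F k` one of the two is transverse: the second if `b` vanishes there, the first otherwise.
As `b` is constant along the tubes with index below `j`, compatibility with those is not lost. -/
theorem IsSystem.exists_compatPush_succ (h : IsSystem I F 𝒵 k γ O ρ π)
    (hFZ : ∀ i j, i ≠ j → F i ∈ 𝒵 j) (h𝒵 : ∀ k j, ∀ Z ∈ 𝒵 k, Z ∈ 𝒵 j ∨ Z ⊆ F j)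
    (hFc : ∀ i, IsClosed (F i)) (hc : ∀ p ∈ F k, Nonempty (AdaptedChart I m (F k) (𝒵 k) p))
    {j : ℕ} (hjk : j < k) (hΦ : IsPush I (𝒵 k) Φ) (hP : ∀ q ∈ F k, PosPush I (F k) Φ q)
    (hC : ∀ i < j, CompatPush (F i) (ρ i) (π i) Φ) :
    ∃ Ψ, IsPush I (𝒵 k) Ψ ∧ (∀ q ∈ F k, PosPush I (F k) Ψ q) ∧
      ∀ i < j + 1, CompatPush (F i) (ρ i) (π i) Ψ := by
  have hj := h.tube j hjk
  have hFj : F j ∈ 𝒵 k := hFZ j k hjk.ne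
  obtain ⟨b, hb, hb0, hb1, hbF, hbO, hbi⟩ := exists_cutoff (I := I) (hFc j) hj.isOpen hj.subset
    (h.exists_inv hFZ hFc hjk.le)
  have hb' : ContMDiff I 𝓘(ℝ, ℝ) ∞ fun x => 1 - b x := contMDiff_const.sub hb
  have hb0' : ∀ x, 0 ≤ 1 - b x := fun x => sub_nonneg.2 (hb1 x)
  have hS : IsPush I (𝒵 k) (scalePush (fun x => 1 - b x) Φ) := hΦ.scale hb' hb0'
  have hT := hj.isPush_transPush hΦ hFj (h𝒵 k j) hb hb0 hbO
  refine ⟨_, hS.comp hT, fun q hq => ?_, fun i hi => ?_⟩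
  · refine PosPush.comp (hc q hq).some hS hT ?_
    by_cases hbq : b q = 0
    · exact Or.inl ((hP q hq).scale hb0' (by simp [hbq]))
    · have hqO : q ∈ O j := hbO (subset_tsupport _ hbq)
      have hFk : F k ∈ 𝒵 j := hFZ k j hjk.ne'
      exact Or.inr (hj.posPush_transPush hΦ hFj hFk hb.continuous hb0 hqO hbq
        (hP _ ((hj.strata q hqO _ hFk).1 hq)))
  · rcases Nat.lt_succ_iff_lt_or_eq.1 hi with hi | rfl
    · refine CompatPush.comp hT ((hC i hi).scale hb'.continuous hb0' fun p hp => ?_)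
        (h.compatPush_transPush hFZ hi hjk hΦ (hC i hi) hb.continuous hb0 hbO (hbi i hi))
      filter_upwards [hbi i hi p hp] with x hx
      rw [hx]
    · exact hj.compatPush_glue hΦ hFj hb.continuous hb0 hbF hT

theorem IsSystem.exists_compatPush [SecondCountableTopology M] (h : IsSystem I F 𝒵 k γ O ρ π)
    (hFZ : ∀ i j, i ≠ j → F i ∈ 𝒵 j) (h𝒵 : ∀ k j, ∀ Z ∈ 𝒵 k, Z ∈ 𝒵 j ∨ Z ⊆ F j)
    (hFc : ∀ i, IsClosed (F i)) (hc : ∀ p ∈ F k, Nonempty (AdaptedChart I m (F k) (𝒵 k) p))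
    {j : ℕ} (hjk : j ≤ k) :
    ∃ Ψ, IsPush I (𝒵 k) Ψ ∧ (∀ q ∈ F k, PosPush I (F k) Ψ q) ∧
      ∀ i < j, CompatPush (F i) (ρ i) (π i) Ψ := by
  induction j with
  | zero =>
    obtain ⟨Φ, hΦ, hP⟩ := exists_push (hFc k) hc
    exact ⟨Φ, hΦ, hP, fun i hi => by omega⟩
  | succ j ih =>
    obtain ⟨Φ, hΦ, hP, hC⟩ := ih (by omega)
    exact h.exists_compatPush_succ hFZ h𝒵 hFc hc hjk hΦ hP hC

/-- The push for `F k` is first made compatible with all earlier tubes; this condition, stated on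
neighbourhoods, then passes to the new tube through the property `P` of `exists_isTube`. -/
theorem exists_isSystem [SecondCountableTopology M]
    (hFZ : ∀ i j, i ≠ j → F i ∈ 𝒵 j) (h𝒵 : ∀ k j, ∀ Z ∈ 𝒵 k, Z ∈ 𝒵 j ∨ Z ⊆ F j)
    (hFc : ∀ i, IsClosed (F i))
    (hc : ∀ k, ∀ p ∈ F k, Nonempty (AdaptedChart I m (F k) (𝒵 k) p)) (k : ℕ) :
    ∃ γ O ρ π, IsSystem I F 𝒵 k γ O ρ π := by
  induction k with
  | zero =>
    exact ⟨fun _ => Prod.snd, fun _ => ∅, fun _ _ => 0, fun _ => id,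
      ⟨fun j hj => by omega, fun i j _ hj => by omega⟩⟩
  | succ k ih =>
    obtain ⟨γ, O, ρ, π, h⟩ := ih
    obtain ⟨Φ, hΦ, hP, hC⟩ := h.exists_compatPush hFZ h𝒵 hFc (hc k) le_rfl
    let Q : ℕ → ℝ × M → Prop := fun i w =>
      ρ i (Φ w) = ρ i w.2 ∧ π i (Φ w) = Φ (w.1, π i w.2)
    have hQ : ∀ p ∈ F k, ∀ᶠ z in 𝓝[cyl (F k)] ((0 : ℝ), p), ∀ i < k, z.2 ∈ F i →
        ∀ᶠ w in 𝓝[cyl (F k)] z, Q i w := by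
      intro p _
      refine (eventually_all_finite (finite_lt_nat k)).2 fun i hi => ?_
      -- Near `(0, p)` compatibility holds if `p ∈ F i`; otherwise the closed set `F i` is not met
      -- and nothing is required.
      by_cases hpi : p ∈ F i
      · have h1 : ∀ᶠ w in 𝓝[cyl (F k)] ((0 : ℝ), p), Q i w :=
          nhdsWithin_mono _ (cyl_mono (subset_univ _)) (hC i hi p hpi)
        filter_upwards [eventually_eventually_nhdsWithin.2 h1] with z hz _ using hz
      · have h1 : ∀ᶠ w in 𝓝 ((0 : ℝ), p), w.2 ∈ (F i)ᶜ :=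
          (continuous_snd.tendsto ((0 : ℝ), p)).eventually_mem
            ((hFc i).isOpen_compl.mem_nhds hpi)
        filter_upwards [nhdsWithin_le_nhds h1] with z hz hz' using absurd hz' hz
    obtain ⟨O', ρ', π', hT, hTQ⟩ := exists_isTube hΦ (hc k) hP hQ
    refine ⟨Function.update γ k Φ, Function.update O k O', Function.update ρ k ρ',
      Function.update π k π', ⟨fun j hj => ?_, fun i j hij hj => ?_⟩⟩
    · rcases Nat.lt_succ_iff_lt_or_eq.1 hj with hj | rfl
      · simpa [Function.update_of_ne hj.ne] using h.tube j hj
      · simpa using hT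
    · rcases Nat.lt_succ_iff_lt_or_eq.1 hj with hj | rfl
      · simpa [Function.update_of_ne hj.ne, Function.update_of_ne (hij.trans hj).ne]
          using h.compat i j hij hj
      · simp only [Function.update_self, Function.update_of_ne hij.ne]
        intro x hx hxi
        have h1 := (hTQ x hx).self_of_nhdsWithin ⟨hT.nonneg x hx, hT.mem x hx⟩ i hij
          ((hT.strata x hx _ (hFZ i _ hij.ne)).1 hxi)
        exact h1

end Extension

end Construction

/-! ### From tubes to collars defined on all of `ℝ₊ × F` -/

section Globalize

variable {E : Type*} [NormedAddCommGroup E] [NormedSpace ℝ E] {H : Type*} [TopologicalSpace H]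
  {M : Type*} [TopologicalSpace M] [ChartedSpace H M] {I : ModelWithCorners ℝ E H}

/-- `γ` is a collar of `F`: an open embedding of `ℝ₊ × F` whose inverse is `(T, π)`, and which
preserves all sets in `𝒵`. -/
structure IsCollar (I : ModelWithCorners ℝ E H) (F : Set M) (𝒵 : Set (Set M)) (γ : ℝ × M → M)
    (O : Set M) (T : M → ℝ) (π : M → M) : Prop where
  isOpen : IsOpen O
  smooth : ContMDiffOn (𝓘(ℝ, ℝ).prod I) I ∞ γ (cyl F)
  smooth_T : ContMDiffOn I 𝓘(ℝ, ℝ) ∞ T O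
  smooth_π : ContMDiffOn I I ∞ π O
  nonneg : ∀ x ∈ O, 0 ≤ T x
  mem : ∀ x ∈ O, π x ∈ F
  right_inv : ∀ x ∈ O, γ (T x, π x) = x
  map_mem : ∀ z ∈ cyl F, γ z ∈ O
  left_inv_T : ∀ z ∈ cyl F, T (γ z) = z.1
  left_inv_π : ∀ z ∈ cyl F, π (γ z) = z.2
  zero : ∀ x ∈ F, γ (0, x) = x
  strata : ∀ z ∈ cyl F, ∀ Z ∈ 𝒵, (γ z ∈ Z ↔ z.2 ∈ Z)

variable {F : ℕ → Set M} {𝒵 : ℕ → Set (Set M)} {n : ℕ} {γ : ℕ → ℝ × M → M} {O : ℕ → Set M}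
  {ρ : ℕ → M → ℝ} {π : ℕ → M → M}

/-- The collars of a system are exact and commute at `x` up to size `η`, and preserve `φ`. -/
def GoodAt (I : ModelWithCorners ℝ E H) (F : ℕ → Set M) (n : ℕ) (γ : ℕ → ℝ × M → M)
    (O : ℕ → Set M) (ρ : ℕ → M → ℝ) (π : ℕ → M → M) (φ : M → ℝ) (η : ℝ) (x : M) : Prop :=
  (∀ i < n, x ∈ F i → ∀ u, 0 ≤ u → u < η → (γ i (u, x) ∈ O i ∧ ρ i (γ i (u, x)) = u ∧
    π i (γ i (u, x)) = x ∧ ContMDiffWithinAt (𝓘(ℝ, ℝ).prod I) I ∞ (γ i) (cyl (F i)) (u, x)) ∧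
      φ (γ i (u, x)) = φ x) ∧
  ∀ j < n, ∀ i < j, x ∈ F i → x ∈ F j → ∀ u, 0 ≤ u → u < η → ∀ w, 0 ≤ w → w < η →
    γ j (w, γ i (u, x)) = γ i (u, γ j (w, x))

theorem GoodAt.mono {φ : M → ℝ} {η η' : ℝ} {x : M} (h : GoodAt I F n γ O ρ π φ η x)
    (hη : η' ≤ η) : GoodAt I F n γ O ρ π φ η' x :=
  ⟨fun i hi hx u hu hu' => h.1 i hi hx u hu (hu'.trans_le hη),
    fun j hj i hi hx hx' u hu hu' w hw hw' =>
      h.2 j hj i hi hx hx' u hu (hu'.trans_le hη) w hw (hw'.trans_le hη)⟩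

theorem exists_pos_of_eventually_cyl {F : Set M} {p : M} {P : ℝ × M → Prop}
    (h : ∀ᶠ z in 𝓝[cyl F] ((0 : ℝ), p), P z) :
    ∃ η > 0, ∀ᶠ x in 𝓝 p, x ∈ F → ∀ u, 0 ≤ u → u < η → P (u, x) := by
  rw [eventually_nhdsWithin_iff, nhds_prod_eq, eventually_prod_iff] at h
  obtain ⟨pa, ha, pb, hb, hab⟩ := h
  obtain ⟨η, hη, hη'⟩ := Metric.eventually_nhds_iff.1 ha
  refine ⟨η, hη, hb.mono fun x hx hxF u hu hu' => hab (hη' ?_) hx ⟨hu, hxF⟩⟩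
  rwa [Real.dist_eq, sub_zero, abs_of_nonneg hu]

theorem exists_pos_eventually_forall_lt {P : ℕ → ℝ → M → Prop}
    (hP : ∀ i η η' x, η' ≤ η → P i η x → P i η' x) {n : ℕ} {p : M}
    (h : ∀ i < n, ∃ η > 0, ∀ᶠ x in 𝓝 p, P i η x) :
    ∃ η > 0, ∀ᶠ x in 𝓝 p, ∀ i < n, P i η x := by
  induction n with
  | zero => exact ⟨1, one_pos, Eventually.of_forall fun x i hi => by omega⟩
  | succ n ih =>
    obtain ⟨η, hη, h1⟩ := ih fun i hi => h i (by omega)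
    obtain ⟨η', hη', h2⟩ := h n (by omega)
    refine ⟨min η η', lt_min hη hη', ?_⟩
    filter_upwards [h1, h2] with x h1 h2 i hi
    rcases Nat.lt_succ_iff_lt_or_eq.1 hi with hi | rfl
    · exact hP _ _ _ _ (min_le_left _ _) (h1 i hi)
    · exact hP _ _ _ _ (min_le_right _ _) h2

theorem IsTube.germ_zero {F : Set M} {𝒵 : Set (Set M)} {γ : ℝ × M → M} {O : Set M} {ρ : M → ℝ}
    {π : M → M} (h : IsTube I F 𝒵 γ O ρ π) {p : M} (hp : p ∈ F) :
    ∀ᶠ z in 𝓝[cyl F] ((0 : ℝ), p), γ z ∈ O ∧ ρ (γ z) = z.1 ∧ π (γ z) = z.2 ∧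
      ContMDiffWithinAt (𝓘(ℝ, ℝ).prod I) I ∞ γ (cyl F) z := by
  have := h.germ p (h.subset hp)
  rwa [h.zero p hp, h.self p hp] at this

theorem IsTube.tendsto_γ {F : Set M} {𝒵 : Set (Set M)} {γ : ℝ × M → M} {O : Set M} {ρ : M → ℝ}
    {π : M → M} (h : IsTube I F 𝒵 γ O ρ π) {p : M} (hp : p ∈ F) :
    Tendsto γ (𝓝[cyl F] (0, p)) (𝓝 p) := by
  have h1 := (h.germ_zero hp).self_of_nhdsWithin ⟨le_refl (0 : ℝ), hp⟩
  have := h1.2.2.2.continuousWithinAt.tendsto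
  rwa [h.apply_zero hp] at this

/-- For the commutation, compatibility is applied at `γ i (u, x)`: in the tube of `F i` the point `γ
j (w, γ i (u, x))` has coordinates `u` and `γ j (w, x)`, so it is `γ i (u, γ j (w, x))`. Finiteness
of the system lets one size serve all indices. -/
theorem IsSystem.eventually_goodAt (h : IsSystem I F 𝒵 n γ O ρ π)
    (hFZ : ∀ i j, i ≠ j → F i ∈ 𝒵 j) (hFc : ∀ i, IsClosed (F i)) {φ : M → ℝ}
    (hφ : ∀ i < n, InvNear (F i) (π i) φ) (p : M) :
    ∃ η > 0, ∀ᶠ x in 𝓝 p, GoodAt I F n γ O ρ π φ η x := by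
  have hA : ∃ η > 0, ∀ᶠ x in 𝓝 p, ∀ i < n, x ∈ F i → ∀ u, 0 ≤ u → u < η →
      (γ i (u, x) ∈ O i ∧ ρ i (γ i (u, x)) = u ∧ π i (γ i (u, x)) = x ∧
        ContMDiffWithinAt (𝓘(ℝ, ℝ).prod I) I ∞ (γ i) (cyl (F i)) (u, x)) ∧
          φ (γ i (u, x)) = φ x := by
    refine exists_pos_eventually_forall_lt
      (fun i η η' x hη hP hx u hu hu' => hP hx u hu (hu'.trans_le hη)) fun i hi => ?_
    by_cases hp : p ∈ F i
    · have hT := h.tube i hi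
      refine exists_pos_of_eventually_cyl (P := fun z => (γ i z ∈ O i ∧ ρ i (γ i z) = z.1 ∧
        π i (γ i z) = z.2 ∧ ContMDiffWithinAt (𝓘(ℝ, ℝ).prod I) I ∞ (γ i) (cyl (F i)) z) ∧
          φ (γ i z) = φ z.2) ?_
      filter_upwards [hT.germ_zero hp, (hT.tendsto_γ hp).eventually (hφ i hi p hp)] with z h1 h2
      exact ⟨h1, by rw [← h2, h1.2.2.1]⟩
    · refine ⟨1, one_pos, ?_⟩
      filter_upwards [(hFc i).isOpen_compl.mem_nhds hp] with x hx hx' using absurd hx' hx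
  have hB : ∃ η > 0, ∀ᶠ x in 𝓝 p, ∀ j < n, ∀ i < j, x ∈ F i → x ∈ F j →
      ∀ u, 0 ≤ u → u < η → ∀ w, 0 ≤ w → w < η → γ j (w, γ i (u, x)) = γ i (u, γ j (w, x)) := by
    refine exists_pos_eventually_forall_lt
      (fun j η η' x hη hP i hi hx hx' u hu hu' w hw hw' =>
        hP i hi hx hx' u hu (hu'.trans_le hη) w hw (hw'.trans_le hη)) fun j hj => ?_
    refine exists_pos_eventually_forall_lt
      (fun i η η' x hη hP hx hx' u hu hu' w hw hw' =>
        hP hx hx' u hu (hu'.trans_le hη) w hw (hw'.trans_le hη)) fun i hi => ?_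
    by_cases hp : p ∈ F i ∩ F j
    · obtain ⟨hpi, hpj⟩ := hp
      have hTi := h.tube i (hi.trans hj)
      have hTj := h.tube j hj
      have hcompat := h.compat i j hi hj p (hTj.subset hpj) hpi
      rw [hTj.zero p hpj, hTj.self p hpj] at hcompat
      obtain ⟨η, hη, h1⟩ := exists_pos_of_eventually_cyl
        (hcompat.and ((hTj.tendsto_γ hpj).eventually_mem (hTi.isOpen.mem_nhds (hTi.subset hpi))))
      -- apply `h1` at the points `γ i (u, x)`
      obtain ⟨η', hη', h2⟩ := exists_pos_of_eventually_cyl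
        ((hTi.germ_zero hpi).and ((hTi.tendsto_γ hpi).eventually h1))
      refine ⟨min η η', lt_min hη hη', ?_⟩
      filter_upwards [h2] with x h2 hxi hxj u hu hu' w hw hw'
      obtain ⟨h3, h4⟩ := h2 hxi u hu (hu'.trans_le (min_le_right _ _))
      have hFj : γ i (u, x) ∈ F j := (hTi.strata _ h3.1 _ (hFZ j i hi.ne')).2 (by
        rw [h3.2.2.1]; exact hxj)
      obtain ⟨h5, h6⟩ := h4 hFj w hw (hw'.trans_le (min_le_left _ _))
      rw [← hTi.right_inv _ h6, h5.1, h5.2, h3.2.1, h3.2.2.1]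
    · refine ⟨1, one_pos, ?_⟩
      filter_upwards [((hFc i).inter (hFc j)).isOpen_compl.mem_nhds hp] with x hx hxi hxj
        using absurd ⟨hxi, hxj⟩ hx
  obtain ⟨η, hη, h1⟩ := hA
  obtain ⟨η', hη', h2⟩ := hB
  refine ⟨min η η', lt_min hη hη', ?_⟩
  filter_upwards [h1, h2] with x h1 h2
  exact ⟨fun i hi hx u hu hu' => h1 i hi hx u hu (hu'.trans_le (min_le_left _ _)),
    fun j hj i hi hx hx' u hu hu' w hw hw' => h2 j hj i hi hx hx' u hu
      (hu'.trans_le (min_le_right _ _)) w hw (hw'.trans_le (min_le_right _ _))⟩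

theorem exists_goodAt_of_isCompact {φ : M → ℝ}
    (hloc : ∀ p, ∃ η > 0, ∀ᶠ x in 𝓝 p, GoodAt I F n γ O ρ π φ η x) {C : Set M}
    (hC : IsCompact C) : ∃ η > 0, ∀ x ∈ C, GoodAt I F n γ O ρ π φ η x := by
  refine hC.induction_on (p := fun C => ∃ η > 0, ∀ x ∈ C, GoodAt I F n γ O ρ π φ η x)
    ⟨1, one_pos, fun x hx => hx.elim⟩ ?_ ?_ ?_
  · rintro s t hst ⟨η, hη, h⟩
    exact ⟨η, hη, fun x hx => h x (hst hx)⟩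
  · rintro s t ⟨η, hη, h⟩ ⟨η', hη', h'⟩
    refine ⟨min η η', lt_min hη hη', fun x hx => ?_⟩
    rcases hx with hx | hx
    · exact (h x hx).mono (min_le_left _ _)
    · exact (h' x hx).mono (min_le_right _ _)
  · intro p _
    obtain ⟨η, hη, h⟩ := hloc p
    exact ⟨_, mem_nhdsWithin_of_mem_nhds h, η, hη, fun x hx => hx⟩

section Extension

variable [FiniteDimensional ℝ E] [T2Space M] [SigmaCompactSpace M] [IsManifold I ∞ M]

/-- The index function of a compact exhaustion is locally bounded, hence majorised by a smooth
function. -/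
theorem exists_smooth_exhaustion : ∃ ψ : M → ℝ, ContMDiff I 𝓘(ℝ, ℝ) ∞ ψ ∧
    ∀ c, ∃ C, IsCompact C ∧ ∀ x, ψ x ≤ c → x ∈ C := by
  have := Manifold.locallyCompact_of_finiteDimensional (M := M) I
  let K := CompactExhaustion.choice M
  obtain ⟨ψ, hψ⟩ := exists_contMDiffMap_forall_mem_convex_of_local_const (n := ⊤) I
    (t := fun x : M => {c : ℝ | (K.find x : ℝ) ≤ c}) (fun x => convex_Ici _) (fun x => by
      refine ⟨K.find x + 1, ?_⟩
      filter_upwards [isOpen_interior.mem_nhds (K.subset_interior_succ _ (K.mem_find x))]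
        with y hy
      have := K.mem_iff_find_le.1 (interior_subset hy)
      exact_mod_cast this)
  refine ⟨ψ, ψ.contMDiff, fun c => ⟨K ⌈c⌉₊, K.isCompact _, fun x hx => ?_⟩⟩
  rw [K.mem_iff_find_le]
  have h1 : (K.find x : ℝ) ≤ c := le_trans (hψ x) hx
  exact_mod_cast h1.trans (Nat.le_ceil c)

/-- The size must be constant along the collars, so it is sought as a function `e` of an exhaustion
function `φ` constant along the tubes. Sublevel sets of `φ` lie in compact sets, so a positive
constant is admissible near each value of `φ`. The admissible sizes at a value form an interval, so
a smooth `e` can be assembled on the line. -/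
theorem IsSystem.exists_size (h : IsSystem I F 𝒵 n γ O ρ π)
    (hFZ : ∀ i j, i ≠ j → F i ∈ 𝒵 j) (hFc : ∀ i, IsClosed (F i)) :
    ∃ ε : M → ℝ, ContMDiff I 𝓘(ℝ, ℝ) ∞ ε ∧ (∀ x, 0 < ε x) ∧
      ∀ x, GoodAt I F n γ O ρ π ε (ε x) x := by
  obtain ⟨ψ, hψ, hψc⟩ := exists_smooth_exhaustion (I := I) (M := M)
  obtain ⟨φ, hφ, hφψ, hφi⟩ := h.exists_inv hFZ hFc le_rfl ψ hψ 1 one_pos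
  have hloc := h.eventually_goodAt hFZ hFc hφi
  obtain ⟨e, he⟩ := exists_contMDiffMap_forall_mem_convex_of_local_const (n := ⊤) 𝓘(ℝ, ℝ)
    (t := fun s : ℝ => {c : ℝ | 0 < c ∧ ∀ x, φ x = s → GoodAt I F n γ O ρ π φ c x})
    (fun s => by
      refine OrdConnected.convex ⟨fun a ha b hb c hc => ⟨ha.1.trans_le hc.1, fun x hx => ?_⟩⟩
      exact (hb.2 x hx).mono hc.2) (fun s => by
      -- Values of `φ` below `s + 1` force `ψ` below `s + 2`, as the two functions differ by less
      -- than `1`.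
      obtain ⟨C, hC, hC'⟩ := hψc (s + 2)
      obtain ⟨η, hη, hg⟩ := exists_goodAt_of_isCompact hloc hC
      refine ⟨η, ?_⟩
      filter_upwards [gt_mem_nhds (show s < s + 1 by linarith)] with y hy
      refine ⟨hη, fun x hx => hg x (hC' x ?_)⟩
      have := abs_lt.1 (hφψ x)
      linarith)
  refine ⟨fun x => e (φ x), e.contMDiff.comp hφ, fun x => (he _).1, fun x => ?_⟩
  obtain ⟨h1, h2⟩ := (he (φ x)).2 x rfl
  exact ⟨fun i hi hx u hu hu' => ⟨(h1 i hi hx u hu hu').1,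
    congrArg e (h1 i hi hx u hu hu').2⟩, h2⟩

/-- Time is reparametrised by `t ↦ ε x * (t / (1 + t))`, which maps `ℝ₊` onto `[0, ε x)`; the new
collar time is recovered as `ρ / (ε ∘ π - ρ)`. Constancy of `ε` along the collars makes the rescaled
times independent of the order of application, so commutation persists. -/
theorem IsSystem.exists_collars (h : IsSystem I F 𝒵 n γ O ρ π)
    (hFZ : ∀ i j, i ≠ j → F i ∈ 𝒵 j) (hFc : ∀ i, IsClosed (F i)) :
    ∃ (γ' : ℕ → ℝ × M → M) (O' : ℕ → Set M) (T : ℕ → M → ℝ),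
      (∀ i < n, IsCollar I (F i) (𝒵 i) (γ' i) (O' i) (T i) (π i)) ∧
      ∀ i < n, ∀ j < n, i ≠ j → ∀ p ∈ F i, p ∈ F j → ∀ u, 0 ≤ u → ∀ t, 0 ≤ t →
        γ' i (u, γ' j (t, p)) = γ' j (t, γ' i (u, p)) := by
  obtain ⟨ε, hε, hε0, hg⟩ := h.exists_size hFZ hFc
  have hr : ∀ (x : M) (t : ℝ), 0 ≤ t → 0 ≤ ε x * (t / (1 + t)) ∧ ε x * (t / (1 + t)) < ε x := by
    intro x t ht
    have h0 := hε0 x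
    refine ⟨by positivity, ?_⟩
    have : t / (1 + t) < 1 := by rw [div_lt_one (by linarith)]; linarith
    nlinarith
  have hgood : ∀ i < n, ∀ z ∈ cyl (F i), _ := fun i hi (z : ℝ × M) (hz : z ∈ cyl (F i)) =>
    (hg z.2).1 i hi hz.2 _ (hr z.2 z.1 hz.1).1 (hr z.2 z.1 hz.1).2
  refine ⟨fun i z => γ i (ε z.2 * (z.1 / (1 + z.1)), z.2),
    fun i => O i ∩ {x | ρ i x - ε (π i x) < 0}, fun i x => ρ i x / (ε (π i x) - ρ i x),
    fun i hi => ?_, ?_⟩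
  · have hT := h.tube i hi
    have hεπ : ContMDiffOn I 𝓘(ℝ, ℝ) ∞ (fun x => ε (π i x)) (O i) :=
      hε.comp_contMDiffOn hT.smooth_π
    have hden : ∀ x ∈ O i ∩ {x | ρ i x - ε (π i x) < 0}, 0 < ε (π i x) - ρ i x := by
      rintro x ⟨-, hx⟩
      have : ρ i x - ε (π i x) < 0 := hx
      linarith
    refine ⟨?_, ?_, ?_, hT.smooth_π.mono inter_subset_left, ?_, fun x hx => hT.mem x hx.1, ?_, ?_,
      ?_, ?_, ?_, ?_⟩
    · exact (hT.smooth_ρ.sub hεπ).continuousOn.isOpen_inter_preimage hT.isOpen isOpen_Iio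
    · intro z hz
      refine ContMDiffWithinAt.comp (I' := 𝓘(ℝ, ℝ).prod I) z
        (f := fun z : ℝ × M => (ε z.2 * (z.1 / (1 + z.1)), z.2)) (hgood i hi z hz).1.2.2.2 ?_ ?_
      · have hz1 : (1 : ℝ) + z.1 ≠ 0 := by
          have : 0 ≤ z.1 := hz.1
          positivity
        have h1 : ContDiffAt ℝ ∞ (fun t : ℝ => t / (1 + t)) z.1 :=
          contDiffAt_id.div (contDiffAt_const.add contDiffAt_id) hz1
        have h2 : ContMDiffAt (𝓘(ℝ, ℝ).prod I) 𝓘(ℝ, ℝ) ∞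
            (fun z : ℝ × M => z.1 / (1 + z.1)) z :=
          ContMDiffAt.comp z (f := fun z : ℝ × M => z.1) h1.contMDiffAt contMDiffAt_fst
        exact (((hε.contMDiffAt.comp z contMDiffAt_snd).mul h2).prodMk
          contMDiffAt_snd).contMDiffWithinAt
      · exact fun w hw => ⟨(hr w.2 w.1 hw.1).1, hw.2⟩
    · intro x hx
      have h1 : ContMDiffWithinAt I 𝓘(ℝ, ℝ) ∞ (ρ i) (O i ∩ {x | ρ i x - ε (π i x) < 0}) x :=
        (hT.smooth_ρ x hx.1).mono inter_subset_left
      have h2 : ContMDiffWithinAt I 𝓘(ℝ, ℝ) ∞ (fun x => ε (π i x))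
        (O i ∩ {x | ρ i x - ε (π i x) < 0}) x := (hεπ x hx.1).mono inter_subset_left
      exact h1.div₀ (h2.sub h1) (hden x hx).ne'
    · intro x hx
      exact div_nonneg (hT.nonneg x hx.1) (hden x hx).le
    · intro x hx
      have hd := hden x hx
      have : ε (π i x) * (ρ i x / (ε (π i x) - ρ i x) / (1 + ρ i x / (ε (π i x) - ρ i x))) =
          ρ i x := by
        have := (hε0 (π i x)).ne'
        have hd' := hd.ne'
        have h1 : 1 + ρ i x / (ε (π i x) - ρ i x) = ε (π i x) / (ε (π i x) - ρ i x) := by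
          field_simp; ring
        rw [h1]
        field_simp
      beta_reduce
      rw [this, hT.right_inv x hx.1]
    · intro z hz
      obtain ⟨⟨h1, h2, h3, -⟩, -⟩ := hgood i hi z hz
      refine ⟨h1, ?_⟩
      change _ < (0 : ℝ)
      rw [h2, h3]
      linarith [(hr z.2 z.1 hz.1).2]
    · intro z hz
      obtain ⟨⟨h1, h2, h3, -⟩, -⟩ := hgood i hi z hz
      beta_reduce
      rw [h2, h3]
      have h4 := (hε0 z.2).ne'
      have h5 : (1 : ℝ) + z.1 ≠ 0 := by
        have : 0 ≤ z.1 := hz.1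
        positivity
      have h6 : ε z.2 - ε z.2 * (z.1 / (1 + z.1)) = ε z.2 / (1 + z.1) := by field_simp; ring
      rw [h6]
      field_simp
    · intro z hz
      exact (hgood i hi z hz).1.2.2.1
    · intro x hx
      simp [hT.apply_zero hx]
    · intro z hz Z hZ
      obtain ⟨⟨h1, h2, h3, -⟩, -⟩ := hgood i hi z hz
      rw [hT.strata _ h1 Z hZ, h3]
  · have key : ∀ j < n, ∀ i < j, ∀ p ∈ F i, p ∈ F j → ∀ u, 0 ≤ u → ∀ t, 0 ≤ t →
        γ j (ε (γ i (ε p * (u / (1 + u)), p)) * (t / (1 + t)), γ i (ε p * (u / (1 + u)), p)) =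
        γ i (ε (γ j (ε p * (t / (1 + t)), p)) * (u / (1 + u)), γ j (ε p * (t / (1 + t)), p)) := by
      intro j hj i hi p hpi hpj u hu t ht
      have h1 := (hgood i (hi.trans hj) (u, p) ⟨hu, hpi⟩).2
      have h2 := (hgood j hj (t, p) ⟨ht, hpj⟩).2
      simp only at h1 h2
      rw [h1, h2]
      exact (hg p).2 j hj i hi hpi hpj _ (hr p u hu).1 (hr p u hu).2 _ (hr p t ht).1 (hr p t ht).2
    intro i hi j hj hij p hpi hpj u hu t ht
    rcases lt_or_gt_of_ne hij with hij | hij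
    · exact (key j hj i hij p hpi hpj u hu t ht).symm
    · exact key i hi j hij p hpj hpi t ht u hu

end Extension

end Globalize

/-! ### Compositions of commuting collars -/

section Composition

variable {E : Type*} [NormedAddCommGroup E] [NormedSpace ℝ E] {H : Type*} [TopologicalSpace H]
  {M : Type*} [TopologicalSpace M] [ChartedSpace H M] {I : ModelWithCorners ℝ E H}
  {ι : Type*} {F : ι → Set M} {𝒵 : ι → Set (Set M)} {γ : ι → ℝ × M → M} {O : ι → Set M}
  {T : ι → M → ℝ} {π : ι → M → M}

/-- The composition of the maps `γ D (t D, ·)`, for `D` in a list. -/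
def listComp (γ : ι → ℝ × M → M) : List ι → (ι → ℝ) → M → M
  | [], _, p => p
  | D :: L, t, p => γ D (t D, listComp γ L t p)

theorem listComp_append (L L' : List ι) (t : ι → ℝ) (p : M) :
    listComp γ (L ++ L') t p = listComp γ L t (listComp γ L' t p) := by
  induction L with
  | nil => rfl
  | cons D L ih => simp only [List.cons_append, listComp, ih]

theorem listComp_congr {L : List ι} {t t' : ι → ℝ} (h : ∀ D ∈ L, t D = t' D) (p : M) :
    listComp γ L t p = listComp γ L t' p := by
  induction L with
  | nil => rfl
  | cons D L ih =>
    simp only [listComp]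
    rw [h D (by simp), ih fun D hD => h D (by simp [hD])]

/-- Each collar is applied at a point of its own face, since the collars applied before it preserve
that face. This is the same assertion for the set `F D`, hence the induction over all `Z`. -/
theorem listComp_mem_iff (hγ : ∀ D, IsCollar I (F D) (𝒵 D) (γ D) (O D) (T D) (π D))
    (hF : ∀ D D', D ≠ D' → F D ∈ 𝒵 D') {L : List ι} (hL : L.Nodup) {t : ι → ℝ}
    (ht : ∀ D ∈ L, 0 ≤ t D) {p : M} (hp : ∀ D ∈ L, p ∈ F D) {Z : Set M}
    (hZ : ∀ D ∈ L, ∀ z ∈ cyl (F D), γ D z ∈ Z ↔ z.2 ∈ Z) : listComp γ L t p ∈ Z ↔ p ∈ Z := by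
  induction L generalizing Z with
  | nil => rfl
  | cons D L ih =>
    rw [List.nodup_cons] at hL
    have hsub : ∀ D' ∈ L, D' ∈ D :: L := fun D' hD' => by simp [hD']
    have ih' := fun Z => ih (Z := Z) hL.2 (fun D' h => ht D' (hsub D' h))
      (fun D' h => hp D' (hsub D' h))
    rw [listComp, hZ D (by simp) (t D, listComp γ L t p) ⟨ht D (by simp), ?_⟩]
    · exact ih' Z fun D' h => hZ D' (hsub D' h)
    · refine (ih' (F D) fun D' hD' z hz => ?_).2 (hp D (by simp))
      exact (hγ D').strata z hz _ (hF D D' fun h => hL.1 (h ▸ hD'))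

theorem listComp_mem_face (hγ : ∀ D, IsCollar I (F D) (𝒵 D) (γ D) (O D) (T D) (π D))
    (hF : ∀ D D', D ≠ D' → F D ∈ 𝒵 D') {L : List ι} (hL : L.Nodup) {t : ι → ℝ}
    (ht : ∀ D ∈ L, 0 ≤ t D) {p : M} (hp : ∀ D ∈ L, p ∈ F D) {E : ι} (hE : E ∉ L) :
    listComp γ L t p ∈ F E ↔ p ∈ F E :=
  listComp_mem_iff hγ hF hL ht hp fun D hD z hz =>
    (hγ D).strata z hz _ (hF E D fun h => hE (h ▸ hD))

theorem listComp_zero (hγ : ∀ D, IsCollar I (F D) (𝒵 D) (γ D) (O D) (T D) (π D))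
    {L : List ι} {t : ι → ℝ} (ht : ∀ D ∈ L, t D = 0) {p : M} (hp : ∀ D ∈ L, p ∈ F D) :
    listComp γ L t p = p := by
  induction L with
  | nil => rfl
  | cons D L ih =>
    rw [listComp, ih (fun D h => ht D (by simp [h])) (fun D h => hp D (by simp [h])),
      ht D (by simp), (hγ D).zero p (hp D (by simp))]

/-- A transposition is the commutation of two collars at a point that still lies in both faces,
because the collars applied before preserve them. -/
theorem listComp_perm (hγ : ∀ D, IsCollar I (F D) (𝒵 D) (γ D) (O D) (T D) (π D))
    (hF : ∀ D D', D ≠ D' → F D ∈ 𝒵 D')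
    (hcomm : ∀ D D', D ≠ D' → ∀ p ∈ F D, p ∈ F D' → ∀ u, 0 ≤ u → ∀ t, 0 ≤ t →
      γ D (u, γ D' (t, p)) = γ D' (t, γ D (u, p)))
    {L L' : List ι} (hLL' : L.Perm L') (hL : L.Nodup) {t : ι → ℝ} (ht : ∀ D ∈ L, 0 ≤ t D)
    {p : M} (hp : ∀ D ∈ L, p ∈ F D) : listComp γ L t p = listComp γ L' t p := by
  induction hLL' with
  | nil => rfl
  | cons D _ ih =>
    rw [listComp, listComp, ih (List.nodup_cons.1 hL).2 (fun D h => ht D (by simp [h]))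
      (fun D h => hp D (by simp [h]))]
  | swap D D' L =>
    simp only [List.nodup_cons, List.mem_cons, not_or] at hL
    have hmem : ∀ E ∈ [D, D'], E ∉ L → listComp γ L t p ∈ F E := fun E hE hEL =>
      (listComp_mem_face hγ hF hL.2.2 (fun D h => ht D (by simp [h]))
        (fun D h => hp D (by simp [h])) hEL).2 (hp E (by
          simp only [List.mem_cons, List.not_mem_nil, or_false] at hE ⊢; tauto))
    simp only [listComp]
    exact hcomm _ _ hL.1.1 _ (hmem D' (by simp) hL.1.2) (hmem D (by simp) hL.2.1) _
      (ht _ (by simp)) _ (ht _ (by simp))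
  | trans h1 _ ih1 ih2 =>
    rw [ih1 hL ht hp, ih2 (h1.nodup_iff.1 hL) (fun D h => ht D (h1.mem_iff.2 h))
      (fun D h => hp D (h1.mem_iff.2 h))]

variable [Fintype ι]

theorem contMDiffOn_listComp (hγ : ∀ D, IsCollar I (F D) (𝒵 D) (γ D) (O D) (T D) (π D))
    (hF : ∀ D D', D ≠ D' → F D ∈ 𝒵 D') {L : List ι} (hL : L.Nodup) :
    ContMDiffOn (𝓘(ℝ, ι → ℝ).prod I) I ∞ (fun z : (ι → ℝ) × M => listComp γ L z.1 z.2)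
      ({t | ∀ D ∈ L, 0 ≤ t D} ×ˢ {p | ∀ D ∈ L, p ∈ F D}) := by
  induction L with
  | nil => exact contMDiff_snd.contMDiffOn
  | cons D L ih =>
    rw [List.nodup_cons] at hL
    simp only [listComp]
    refine (hγ D).smooth.comp (f := fun z : (ι → ℝ) × M => (z.1 D, listComp γ L z.1 z.2)) ?_ ?_
    · refine ContMDiffOn.prodMk ?_ ((ih hL.2).mono fun z hz =>
        ⟨fun D h => hz.1 D (by simp [h]), fun D h => hz.2 D (by simp [h])⟩)
      have h1 : ContMDiff 𝓘(ℝ, ι → ℝ) 𝓘(ℝ, ℝ) ∞ (fun t : ι → ℝ => t D) :=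
        (contDiff_apply ℝ ℝ D).contMDiff
      exact (h1.comp contMDiff_fst).contMDiffOn
    · exact fun z hz => ⟨hz.1 D (by simp), (listComp_mem_face hγ hF hL.2
        (fun D h => hz.1 D (by simp [h])) (fun D h => hz.2 D (by simp [h])) hL.1).2
          (hz.2 D (by simp))⟩

open Classical in
-- The outermost collar is inverted by `(T D, π D)`, which lands in `F D`, and the rest is inverted
-- inside `B ∩ F D`; this is why `B` varies in the induction. Working relative to `B` gives openness
-- of the image within each member of an arrangement.
theorem exists_listComp_inverse (hγ : ∀ D, IsCollar I (F D) (𝒵 D) (γ D) (O D) (T D) (π D))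
    (hF : ∀ D D', D ≠ D' → F D ∈ 𝒵 D') {L : List ι} (hL : L.Nodup) {B : Set M}
    (hB : ∀ D ∈ L, ∀ z ∈ cyl (F D), γ D z ∈ B ↔ z.2 ∈ B) :
    ∃ (W : Set M) (τ : M → ι → ℝ) (g : M → M), IsOpen W ∧
      ContMDiffOn I 𝓘(ℝ, ι → ℝ) ∞ τ (B ∩ W) ∧ ContMDiffOn I I ∞ g (B ∩ W) ∧
      (∀ x ∈ B ∩ W, (∀ D ∈ L, 0 ≤ τ x D ∧ g x ∈ F D) ∧ g x ∈ B ∧ listComp γ L (τ x) (g x) = x) ∧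
      ∀ t : ι → ℝ, (∀ D ∈ L, 0 ≤ t D) → ∀ p ∈ B, (∀ D ∈ L, p ∈ F D) →
        listComp γ L t p ∈ B ∩ W ∧ (∀ D ∈ L, τ (listComp γ L t p) D = t D) ∧
          g (listComp γ L t p) = p := by
  induction L generalizing B with
  | nil =>
    refine ⟨univ, fun _ => 0, id, isOpen_univ, contMDiffOn_const, contMDiffOn_id, ?_, ?_⟩
    · simp [listComp]
    · simp [listComp]
  | cons D L ih =>
    rw [List.nodup_cons] at hL
    obtain ⟨W, τ, g, hW, hτ, hg, h1, h2⟩ := ih hL.2 (B := B ∩ F D) (fun E hE z hz => by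
      simp only [mem_inter_iff]
      rw [hB E (by simp [hE]) z hz, (hγ E).strata z hz _ (hF D E fun h => hL.1 (h ▸ hE))])
    have hmaps : MapsTo (π D) (B ∩ (O D ∩ π D ⁻¹' W)) (B ∩ F D ∩ W) := by
      rintro x ⟨hxB, hxO, hxW⟩
      refine ⟨⟨?_, (hγ D).mem x hxO⟩, hxW⟩
      have := hB D (by simp) (T D x, π D x) ⟨(hγ D).nonneg x hxO, (hγ D).mem x hxO⟩
      rw [(hγ D).right_inv x hxO] at this
      exact this.1 hxB
    have hπ : ContMDiffOn I I ∞ (π D) (B ∩ (O D ∩ π D ⁻¹' W)) :=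
      (hγ D).smooth_π.mono fun x hx => hx.2.1
    refine ⟨O D ∩ π D ⁻¹' W, fun x => Function.update (τ (π D x)) D (T D x), fun x => g (π D x),
      (hγ D).smooth_π.continuousOn.isOpen_inter_preimage (hγ D).isOpen hW, ?_,
      hg.comp hπ hmaps, ?_, ?_⟩
    · rw [contMDiffOn_pi_space]
      intro E
      by_cases hE : E = D
      · subst hE
        simp only [Function.update_self]
        exact (hγ E).smooth_T.mono fun x hx => hx.2.1
      · simp only [Function.update_of_ne hE]
        exact (contMDiffOn_pi_space.1 (hτ.comp hπ hmaps)) E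
    · intro x hx
      obtain ⟨h3, h4, h5⟩ := h1 _ (hmaps hx)
      have hne : ∀ E ∈ L, E ≠ D := fun E hE h => hL.1 (h ▸ hE)
      refine ⟨fun E hE => ?_, h4.1, ?_⟩
      · by_cases hED : E = D
        · subst hED
          simp only [Function.update_self]
          exact ⟨(hγ E).nonneg x hx.2.1, h4.2⟩
        · simp only [Function.update_of_ne hED]
          exact h3 E (by simpa [hED] using hE)
      · beta_reduce
        rw [listComp, Function.update_self, listComp_congr (t' := τ (π D x))
          (fun E hE => Function.update_of_ne (hne E hE) _ _), h5, (hγ D).right_inv x hx.2.1]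
    · intro t ht p hp hpL
      have hL' : ∀ E ∈ L, E ∈ D :: L := fun E hE => by simp [hE]
      obtain ⟨h3, h4, h5⟩ := h2 t (fun E hE => ht E (hL' E hE)) p ⟨hp, hpL D (by simp)⟩
        (fun E hE => hpL E (hL' E hE))
      have hz : (t D, listComp γ L t p) ∈ cyl (F D) := ⟨ht D (by simp), h3.1.2⟩
      have hπz := (hγ D).left_inv_π _ hz
      have hTz := (hγ D).left_inv_T _ hz
      simp only [listComp]
      refine ⟨⟨(hB D (by simp) _ hz).2 h3.1.1, (hγ D).map_mem _ hz, ?_⟩, fun E hE => ?_, ?_⟩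
      · rw [mem_preimage, hπz]
        exact h3.2
      · rw [hπz, hTz]
        by_cases hED : E = D
        · subst hED
          simp
        · rw [Function.update_of_ne hED]
          exact h4 E (by simpa [hED] using hE)
      · rw [hπz, h5]

end Composition

/-! ### Labelled faces and the collaring built from their collars -/

theorem CornerMfd.sigmaCompactSpace (M : CornerMfd.{u}) : SigmaCompactSpace M := by
  have := Manifold.locallyCompact_of_finiteDimensional (M := M) M.model
  infer_instance

theorem CornerMfd.isClosed_face {M : CornerMfd.{u}} (C : M.Face) : IsClosed C.1 := by
  obtain ⟨p, -, hp⟩ := C.2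
  rw [hp]
  exact isClosed_closure

namespace PreEdging

variable {X : CornerMfd.{u}} {Y : CornerMfd.{v}} (β : PreEdging X Y)

/-- The union of the connected faces with label in `o`. -/
def labelFace (o : Option Y.Face) : Set X := {p | ∃ D ∈ o, ∃ C, β C = some D ∧ p ∈ C.1}

theorem mem_labelFace_some {D : Y.Face} {p : X} :
    p ∈ β.labelFace (some D) ↔ ∃ C, β C = some D ∧ p ∈ C.1 := by
  simp [labelFace]

theorem isClosed_labelFace (hX : X.bd.Finite) (o : Option Y.Face) :
    IsClosed (β.labelFace o) := by
  have : Finite X.Face := hX.to_subtype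
  have : β.labelFace o = ⋃ C : X.Face, ⋃ _ : ∃ D ∈ o, β C = some D, C.1 := by
    ext p
    simp only [labelFace, mem_ofPred_eq, mem_iUnion, exists_prop]
    constructor
    · rintro ⟨D, hD, C, h1, h2⟩
      exact ⟨C, ⟨D, hD, h1⟩, h2⟩
    · rintro ⟨C, ⟨D, hD, h1⟩, h2⟩
      exact ⟨D, hD, C, h1, h2⟩
  rw [this]
  exact isClosed_iUnion_of_finite fun C => isClosed_iUnion_of_finite fun _ =>
    CornerMfd.isClosed_face C

/-- One face for each label in `τ` suffices, so the union over all `σ` collapses to an intersection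
of labelled faces. -/
theorem mem_faceUnion {τ : Finset Y.Face} {p : X} :
    p ∈ β.faceUnion τ ↔ ∀ D ∈ τ, p ∈ β.labelFace (some D) := by
  classical
  constructor
  · rintro ⟨σ, rfl, hσ⟩ D hD
    obtain ⟨C, hC, hCD⟩ := Finset.mem_biUnion.1 hD
    exact β.mem_labelFace_some.2 ⟨C, by simpa using hCD, hσ C hC⟩
  · intro h
    choose c hc1 hc2 using fun D hD => β.mem_labelFace_some.1 (h D hD)
    refine ⟨τ.attach.image fun D => c D.1 D.2, ?_, ?_⟩
    · ext D
      simp only [push, Finset.mem_biUnion, Finset.mem_image, Option.mem_toFinset,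
        Option.mem_def]
      constructor
      · rintro ⟨_, ⟨D', -, rfl⟩, h1⟩
        rw [hc1 D'.1 D'.2, Option.some_inj] at h1
        exact h1 ▸ D'.2
      · exact fun hD => ⟨_, ⟨⟨D, hD⟩, Finset.mem_attach _ _, rfl⟩, hc1 D hD⟩
    · intro C hC
      obtain ⟨D, -, rfl⟩ := Finset.mem_image.1 hC
      exact hc2 D.1 D.2

end PreEdging

namespace Arrangement

variable {S : Type w} [Lattice S] [OrderTop S] (𝒳 : Arrangement.{u} S) {Y : CornerMfd.{v}}
  (β : PreEdging 𝒳.ambient Y)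

/-- The sets which have to be preserved by a collar of the faces with label in `o`. -/
def strata (o : Option Y.Face) : Set (Set 𝒳.ambient) :=
  {Z | (∃ s, Z = 𝒳.sub s) ∨ (∃ C : 𝒳.ambient.Face, (∀ D ∈ o, β C ≠ some D) ∧ Z = C.1) ∨
    ∃ o' : Option Y.Face, (∀ D ∈ o, D ∉ o') ∧ Z = β.labelFace o'}

variable {𝒳 β}

theorem exists_labelled_collars [Fintype S] (hX : 𝒳.ambient.bd.Finite) (hY : Y.bd.Finite) {m : ℕ}
    (hc : ∀ D : Y.Face, ∀ p ∈ β.labelFace (some D), Nonempty (AdaptedChart 𝒳.ambient.model m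
      (β.labelFace (some D)) (𝒳.strata β (some D)) p)) :
    ∃ (γ : Y.Face → ℝ × 𝒳.ambient → 𝒳.ambient) (O : Y.Face → Set 𝒳.ambient)
      (T : Y.Face → 𝒳.ambient → ℝ) (π : Y.Face → 𝒳.ambient → 𝒳.ambient),
      (∀ D, IsCollar 𝒳.ambient.model (β.labelFace (some D)) (𝒳.strata β (some D)) (γ D) (O D)
        (T D) (π D)) ∧
      ∀ D D', D ≠ D' → ∀ p ∈ β.labelFace (some D), p ∈ β.labelFace (some D') → ∀ u, 0 ≤ u →
        ∀ t, 0 ≤ t → γ D (u, γ D' (t, p)) = γ D' (t, γ D (u, p)) := by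
  have : Finite Y.Face := hY.to_subtype
  have := 𝒳.ambient.sigmaCompactSpace
  obtain ⟨n, ⟨e⟩⟩ := Finite.exists_equiv_fin Y.Face
  -- Indices from `n` on get no label, hence an empty face, so that families indexed by all of `ℕ`
  -- can be used.
  let lab : ℕ → Option Y.Face := fun i => if h : i < n then some (e.symm ⟨i, h⟩) else none
  have hlab : ∀ D, lab (e D) = some D := fun D => by simp [lab]
  have hinj : ∀ i j, i ≠ j → ∀ D ∈ lab j, D ∉ lab i := by
    intro i j hij D hj hi
    simp only [lab, Option.mem_def] at hi hj
    split_ifs at hi hj with h1 h2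
    rw [Option.some_inj] at hi hj
    have := e.symm.injective (hi.trans hj.symm)
    exact hij (by simpa using this)
  have hFZ : ∀ i j, i ≠ j → β.labelFace (lab i) ∈ 𝒳.strata β (lab j) := fun i j hij =>
    Or.inr (Or.inr ⟨lab i, hinj i j hij, rfl⟩)
  have hFc : ∀ i, IsClosed (β.labelFace (lab i)) := fun i => β.isClosed_labelFace hX _
  -- A face or labelled face that the collar of index `j` is not asked to preserve carries the label
  -- of `j`, and so lies in the corresponding labelled face.
  have h𝒵 : ∀ k j, ∀ Z ∈ 𝒳.strata β (lab k), Z ∈ 𝒳.strata β (lab j) ∨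
      Z ⊆ β.labelFace (lab j) := by
    rintro k j Z (hZ | ⟨C, -, rfl⟩ | ⟨o', -, rfl⟩)
    · exact Or.inl (Or.inl hZ)
    · by_cases h : ∀ D ∈ lab j, β C ≠ some D
      · exact Or.inl (Or.inr (Or.inl ⟨C, h, rfl⟩))
      · push Not at h
        obtain ⟨D, hD, hC⟩ := h
        exact Or.inr fun p hp => ⟨D, hD, C, hC, hp⟩
    · by_cases h : ∀ D ∈ lab j, D ∉ o'
      · exact Or.inl (Or.inr (Or.inr ⟨o', h, rfl⟩))
      · push Not at h
        obtain ⟨D, hD, hD'⟩ := h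
        refine Or.inr ?_
        rintro p ⟨D'', h1, C, h2, h3⟩
        obtain rfl : D = D'' := Option.mem_unique hD' h1
        exact ⟨D, hD, C, h2, h3⟩
  obtain ⟨γ, O, ρ, π, hsys⟩ := exists_isSystem (I := 𝒳.ambient.model) (m := m)
    (F := fun i => β.labelFace (lab i)) (𝒵 := fun i => 𝒳.strata β (lab i)) hFZ h𝒵 hFc
    (fun k p hp => by
      have hp' := hp
      obtain ⟨D, hD, -⟩ := hp'
      rw [Option.mem_def] at hD
      simp only [hD] at hp ⊢
      exact hc D p hp) n
  obtain ⟨γ', O', T, hcol, hcomm⟩ := hsys.exists_collars hFZ hFc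
  refine ⟨fun D => γ' (e D), fun D => O' (e D), fun D => T (e D), fun D => π (e D),
    fun D => ?_, fun D D' hD p hp hp' => ?_⟩
  · have := hcol (e D) (e D).2
    simpa only [hlab] using this
  · exact hcomm _ (e D).2 _ (e D').2 (fun h => hD (e.injective (Fin.ext h))) p
      (by simpa only [hlab] using hp) (by simpa only [hlab] using hp')

open Classical in
/-- Extension of a vector by zero. -/
noncomputable def extendZero {ι : Type*} {σ : Finset ι} (t : {D // D ∈ σ} → ℝ) (D : ι) : ℝ :=
  if h : D ∈ σ then t ⟨D, h⟩ else 0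

theorem contDiff_extendZero {ι : Type*} [Fintype ι] {σ : Finset ι} :
    ContDiff ℝ ∞ (extendZero : ({D // D ∈ σ} → ℝ) → ι → ℝ) := by
  rw [contDiff_pi]
  intro D
  by_cases h : D ∈ σ
  · simpa only [extendZero, h, dite_true] using contDiff_apply ℝ ℝ (⟨D, h⟩ : {D // D ∈ σ})
  · simpa only [extendZero, h, dite_false] using contDiff_const

theorem extendZero_nonneg {ι : Type*} {σ : Finset ι} {t : {D // D ∈ σ} → ℝ}
    (ht : t ∈ orthant {D // D ∈ σ}) (D : ι) : 0 ≤ extendZero t D := by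
  unfold extendZero
  split_ifs with h
  · exact ht _
  · exact le_rfl

/-- The maps are compositions over listings of `τ \ τ'`. Listings of `τ' \ τ''` and `τ \ τ'`
concatenate to a rearrangement of one of `τ \ τ''`, so the composition law reduces to
`listComp_perm`. -/
theorem exists_isCollaring [Fintype S] (hX : 𝒳.ambient.bd.Finite) (hY : Y.bd.Finite) {m : ℕ}
    (hc : ∀ D : Y.Face, ∀ p ∈ β.labelFace (some D), Nonempty (AdaptedChart 𝒳.ambient.model m
      (β.labelFace (some D)) (𝒳.strata β (some D)) p)) :
    ∃ γ : 𝒳.CollarFamily Y, 𝒳.IsCollaring β γ ∧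
      ∀ τ τ' : Finset Y.Face, τ' ⊆ τ → ∀ p ∈ β.faceUnion τ, γ τ τ' (0, p) = p := by
  have : Finite Y.Face := hY.to_subtype
  have := Fintype.ofFinite Y.Face
  obtain ⟨γ, O, T, π, hγ, hcomm⟩ := exists_labelled_collars hX hY hc
  have hF : ∀ D D', D ≠ D' → β.labelFace (some D) ∈ 𝒳.strata β (some D') := fun D D' h =>
    Or.inr (Or.inr ⟨some D, by simpa using h, rfl⟩)
  have hsub : ∀ s D, ∀ z ∈ cyl (β.labelFace (some D)), γ D z ∈ 𝒳.sub s ↔ z.2 ∈ 𝒳.sub s :=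
    fun s D z hz => (hγ D).strata z hz _ (Or.inl ⟨s, rfl⟩)
  have hmem : ∀ {τ τ' : Finset Y.Face} {p}, p ∈ β.faceUnion τ → ∀ D ∈ (τ \ τ').toList,
      p ∈ β.labelFace (some D) := fun hp D hD =>
    β.mem_faceUnion.1 hp D (Finset.mem_sdiff.1 (Finset.mem_toList.1 hD)).1
  have hface : ∀ τ τ' : Finset Y.Face, ∀ D ∈ (τ \ τ').toList,
      ∀ z ∈ cyl (β.labelFace (some D)), γ D z ∈ β.faceUnion τ' ↔ z.2 ∈ β.faceUnion τ' := by
    intro τ τ' D hD z hz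
    rw [Finset.mem_toList, Finset.mem_sdiff] at hD
    simp only [β.mem_faceUnion]
    refine forall₂_congr fun E hE => (hγ D).strata z hz _ (hF E D ?_)
    rintro rfl
    exact hD.2 hE
  have hanti : ∀ {τ τ' : Finset Y.Face}, τ' ⊆ τ → β.faceUnion τ ⊆ β.faceUnion τ' :=
    fun h p hp => β.mem_faceUnion.2 fun D hD => β.mem_faceUnion.1 hp D (h hD)
  refine ⟨fun τ τ' z => listComp γ (τ \ τ').toList (extendZero z.1) z.2, ⟨?_, ?_, ?_⟩, ?_⟩
  · intro τ τ' hτ s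
    -- With `B` the target member, the points of `B` in all faces with labels in `τ \ τ'` are
    -- exactly those of the source member.
    obtain ⟨W, θ, g, hW, hθ, hg, h1, h2⟩ := exists_listComp_inverse hγ hF
      (Finset.nodup_toList (τ \ τ')) (B := 𝒳.faceSub β τ' s) (fun D hD z hz =>
        and_congr (hsub s D z hz) (hface τ τ' D hD z hz))
    have himage : (fun z : ({D // D ∈ τ \ τ'} → ℝ) × 𝒳.ambient =>
        listComp γ (τ \ τ').toList (extendZero z.1) z.2) ''
        (orthant {D // D ∈ τ \ τ'} ×ˢ 𝒳.faceSub β τ s) = 𝒳.faceSub β τ' s ∩ W := by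
      ext x
      constructor
      · rintro ⟨z, hz, rfl⟩
        exact (h2 _ (fun D _ => extendZero_nonneg hz.1 D) z.2 ⟨hz.2.1, hanti hτ hz.2.2⟩
          (hmem hz.2.2)).1
      · intro hx
        obtain ⟨h3, h4, h5⟩ := h1 x hx
        refine ⟨(fun D => θ x D.1, g x), ⟨fun D => (h3 D.1 (Finset.mem_toList.2 D.2)).1, h4.1,
          β.mem_faceUnion.2 fun D hD => ?_⟩, ?_⟩
        · by_cases hD' : D ∈ τ'
          · exact β.mem_faceUnion.1 h4.2 D hD'
          · exact (h3 D (Finset.mem_toList.2 (Finset.mem_sdiff.2 ⟨hD, hD'⟩))).2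
        · refine Eq.trans (listComp_congr (fun D hD => ?_) _) h5
          simp [extendZero, Finset.mem_toList.1 hD]
    refine ⟨?_, ⟨W, hW, himage⟩, ⟨fun x => (fun D => θ x D.1, g x), ?_, ?_⟩⟩
    · refine (contMDiffOn_listComp hγ hF (Finset.nodup_toList (τ \ τ'))).comp
        (f := fun z : ({D // D ∈ τ \ τ'} → ℝ) × 𝒳.ambient => (extendZero z.1, z.2)) ?_ ?_
      · exact ((contDiff_extendZero.contMDiff.comp contMDiff_fst).prodMk
          contMDiff_snd).contMDiffOn
      · exact fun z hz => ⟨fun D _ => extendZero_nonneg hz.1 D, hmem hz.2.2⟩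
    · rw [himage]
      refine ContMDiffOn.prodMk ?_ hg
      rw [contMDiffOn_pi_space] at hθ ⊢
      exact fun D => hθ D.1
    · intro z hz
      obtain ⟨-, h4, h5⟩ := h2 _ (fun D _ => extendZero_nonneg hz.1 D) z.2
        ⟨hz.2.1, hanti hτ hz.2.2⟩ (hmem hz.2.2)
      refine Prod.ext (funext fun D => ?_) h5
      refine (h4 D.1 (Finset.mem_toList.2 D.2)).trans ?_
      simp [extendZero]
  · intro τ τ' hτ s t ht p hp hps
    exact (listComp_mem_iff hγ hF (Finset.nodup_toList _) (fun D _ => extendZero_nonneg ht D)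
      (hmem hp) (fun D _ => hsub s D)).1 hps
  · intro τ τ' τ'' h h' u hu t ht p hp
    have hnd : ((τ' \ τ'').toList ++ (τ \ τ').toList).Nodup := by
      refine (Finset.nodup_toList _).append (Finset.nodup_toList _) fun D h1 h2 => ?_
      rw [Finset.mem_toList, Finset.mem_sdiff] at h1 h2
      exact h2.2 h1.1
    have hperm : ((τ' \ τ'').toList ++ (τ \ τ').toList).Perm (τ \ τ'').toList := by
      rw [List.perm_ext_iff_of_nodup hnd (Finset.nodup_toList _)]
      intro D
      simp only [List.mem_append, Finset.mem_toList, Finset.mem_sdiff]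
      have h1 := @h D
      have h2 := @h' D
      tauto
    have hglue : glue u t ∈ orthant {D // D ∈ τ \ τ''} := by
      intro D
      unfold glue
      split_ifs
      · exact hu _
      · exact ht _
    -- Each list sees only its own part of the glued vector, so both factors can be evaluated at
    -- that one vector.
    rw [listComp_congr (L := (τ \ τ').toList) (t' := extendZero (glue u t)),
      listComp_congr (L := (τ' \ τ'').toList) (t' := extendZero (glue u t)),
      ← listComp_append]
    · refine listComp_perm hγ hF hcomm hperm hnd (fun D _ => extendZero_nonneg hglue D) ?_
      exact fun D hD => hmem (τ' := τ'') hp D (hperm.mem_iff.1 hD)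
    · intro D hD
      have hD' := Finset.mem_sdiff.1 (Finset.mem_toList.1 hD)
      have hD'' : D ∈ τ \ τ'' := Finset.mem_sdiff.2 ⟨h hD'.1, hD'.2⟩
      simp only [extendZero, Finset.mem_toList.1 hD, hD'', dite_true, glue, hD'.1]
    · intro D hD
      have hD' := Finset.mem_sdiff.1 (Finset.mem_toList.1 hD)
      have hD'' : D ∈ τ \ τ'' := Finset.mem_sdiff.2 ⟨hD'.1, fun h'' => hD'.2 (h' h'')⟩
      simp only [extendZero, Finset.mem_toList.1 hD, hD'', dite_true, glue, hD'.2, dite_false]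
  · intro τ τ' hτ p hp
    exact listComp_zero hγ (fun D hD => by simp [extendZero]) (hmem hp)

end Arrangement

/-! ### Independence of the codimension from the chart -/

section QuadChart

/-- Extension by zero, then `T`, then restriction to `B` is an injective map `ℝ^A → ℝ^B`. -/
theorem ncard_le_of_linearMap {α β : Type*} [Finite α] [Finite β] (T : (α → ℝ) →ₗ[ℝ] β → ℝ)
    {A : Set α} {B : Set β} (h : ∀ v, (∀ b ∈ B, T v b = 0) → ∀ a ∈ A, v a = 0) :
    A.ncard ≤ B.ncard := by
  classical
  have := Fintype.ofFinite α
  have := Fintype.ofFinite β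
  let R : (A → ℝ) →ₗ[ℝ] B → ℝ := LinearMap.funLeft ℝ ℝ Subtype.val ∘ₗ T ∘ₗ
    Function.ExtendByZero.linearMap ℝ Subtype.val
  have hR : Function.Injective R := by
    rw [← LinearMap.ker_eq_bot, LinearMap.ker_eq_bot']
    intro v hv
    ext a
    have := h (Function.extend Subtype.val v 0) (fun b hb => congrFun hv ⟨b, hb⟩) a.1 a.2
    rwa [Subtype.val_injective.extend_apply] at this
  have := LinearMap.finrank_le_finrank_of_injective hR
  rw [Module.finrank_fintype_fun_eq_card, Module.finrank_fintype_fun_eq_card] at this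
  rwa [← Nat.card_coe_set_eq, ← Nat.card_coe_set_eq, Nat.card_eq_fintype_card,
    Nat.card_eq_fintype_card]

variable {E : Type*} [NormedAddCommGroup E] [NormedSpace ℝ E] {H : Type*} [TopologicalSpace H]
  {M : Type*} [TopologicalSpace M] [ChartedSpace H M] {I : ModelWithCorners ℝ E H}
  {α β : Type*} [Fintype α] [Fintype β]

/-- The germ at `q` of a chart `c` with values in the quadrant `quad K` and inverse `d`. -/
structure IsQuadChartAt (I : ModelWithCorners ℝ E H) (K : Set α) (c : M → α → ℝ) (d : (α → ℝ) → M)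
    (q : M) : Prop where
  tendsto : Tendsto c (𝓝 q) (𝓝[quad K] (c q))
  tendsto_symm : Tendsto d (𝓝[quad K] (c q)) (𝓝 q)
  left_inv : ∀ᶠ x in 𝓝 q, d (c x) = x
  right_inv : ∀ᶠ y in 𝓝[quad K] (c q), c (d y) = y
  contMDiffAt : ContMDiffAt I 𝓘(ℝ, α → ℝ) ∞ c q
  contMDiffWithinAt_symm : ContMDiffWithinAt 𝓘(ℝ, α → ℝ) I ∞ d (quad K) (c q)

namespace IsQuadChartAt

variable {K : Set α} {c : M → α → ℝ} {d : (α → ℝ) → M} {K' : Set β} {c' : M → β → ℝ}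
  {d' : (β → ℝ) → M} {q : M}

theorem left_inv_self (h : IsQuadChartAt I K c d q) : d (c q) = q := h.left_inv.self_of_nhds

theorem mem_quad (h : IsQuadChartAt I K c d q) : c q ∈ quad K := by
  by_contra hq
  have h1 : (quad K)ᶜ ∈ 𝓝 (c q) := (isClosed_quad K).isOpen_compl.mem_nhds hq
  have h2 : ∀ᶠ x in 𝓝 q, c x ∈ quad K := h.tendsto self_mem_nhdsWithin
  exact hq h2.self_of_nhds

theorem exists_deriv (h : IsQuadChartAt I K c d q) :
    ∃ (C : E →L[ℝ] α → ℝ) (D : (α → ℝ) →L[ℝ] E), HasMFDerivAt I 𝓘(ℝ, α → ℝ) c q C ∧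
      HasMFDerivWithinAt 𝓘(ℝ, α → ℝ) I d (quad K) (c q) D ∧ (∀ v, C (D v) = v) ∧
        ∀ v, D (C v) = v := by
  obtain ⟨C, hC⟩ : ∃ C : E →L[ℝ] α → ℝ, HasMFDerivAt I 𝓘(ℝ, α → ℝ) c q C :=
    ⟨_, (h.contMDiffAt.mdifferentiableAt (by simp)).hasMFDerivAt⟩
  obtain ⟨D, hD⟩ : ∃ D : (α → ℝ) →L[ℝ] E, HasMFDerivWithinAt 𝓘(ℝ, α → ℝ) I d (quad K) (c q) D :=
    ⟨_, (h.contMDiffWithinAt_symm.mdifferentiableWithinAt (by simp)).hasMFDerivWithinAt⟩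
  have hC' : HasMFDerivAt I 𝓘(ℝ, α → ℝ) c (d (c q)) C := by rwa [h.left_inv_self]
  refine ⟨C, D, hC, hD, fun v => ?_, fun v => ?_⟩
  · have h1 : HasFDerivWithinAt (c ∘ d) (C.comp D) (quad K) (c q) :=
      (hC'.comp_hasMFDerivWithinAt (c q) hD).hasFDerivWithinAt
    have h2 : HasFDerivWithinAt (c ∘ d) (ContinuousLinearMap.id ℝ (α → ℝ)) (quad K) (c q) :=
      (hasFDerivWithinAt_id _ _).congr_of_eventuallyEq h.right_inv
        (h.right_inv.self_of_nhdsWithin h.mem_quad)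
    exact DFunLike.congr_fun ((uniqueDiffOn_quad K _ h.mem_quad).eq h1 h2) v
  · have h1 := (HasMFDerivWithinAt.comp (s := c ⁻¹' quad K) q hD hC.hasMFDerivWithinAt
      subset_rfl).hasMFDerivAt (h.tendsto self_mem_nhdsWithin)
    have h2 : HasMFDerivAt I I (d ∘ c) q (ContinuousLinearMap.id ℝ E) :=
      (hasMFDerivAt_id q).congr_of_eventuallyEq h.left_inv
    exact DFunLike.congr_fun (hasMFDerivAt_unique h1 h2) v

theorem eventually_ray_mem {x : α → ℝ} (hx : x ∈ quad K) {v : α → ℝ}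
    (hv : ∀ l ∈ K, x l = 0 → 0 ≤ v l) : ∀ᶠ t in 𝓝[>] (0 : ℝ), x + t • v ∈ quad K := by
  have : ∀ l, ∀ᶠ t in 𝓝[>] (0 : ℝ), l ∈ K → 0 ≤ x l + t * v l := by
    intro l
    by_cases hl : l ∈ K
    · by_cases hxl : x l = 0
      · filter_upwards [self_mem_nhdsWithin] with t ht _
        rw [hxl, zero_add]
        exact mul_nonneg (le_of_lt ht) (hv l hl hxl)
      · have h0 : 0 < x l := lt_of_le_of_ne (hx l hl) (Ne.symm hxl)
        have : Continuous fun t : ℝ => x l + t * v l := by fun_prop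
        have h1 : ∀ᶠ t in 𝓝 (0 : ℝ), 0 < x l + t * v l :=
          this.tendsto 0 |>.eventually (lt_mem_nhds (by simpa using h0))
        exact (h1.filter_mono nhdsWithin_le_nhds).mono fun t ht _ => ht.le
    · exact Eventually.of_forall fun t h => absurd h hl
  filter_upwards [eventually_all.2 this] with t ht l hl
  exact ht l hl

theorem deriv_nonneg {V : Type*} [NormedAddCommGroup V] [NormedSpace ℝ V] {f : V → β → ℝ}
    {T : V →L[ℝ] β → ℝ} {s : Set V} {x v : V} (hT : HasFDerivWithinAt f T s x)
    (hv : ∀ᶠ t in 𝓝[>] (0 : ℝ), x + t • v ∈ s) (hf : ∀ᶠ z in 𝓝[s] x, f z ∈ quad K')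
    {l : β} (hl : l ∈ K') (hx : f x l = 0) : 0 ≤ T v l := by
  have h1 := (tendsto_pi_nhds.1 (hT.tendsto_ray hv)) l
  have h2 : Tendsto (fun t : ℝ => x + t • v) (𝓝[>] 0) (𝓝[s] x) := by
    refine tendsto_nhdsWithin_iff.2 ⟨?_, hv⟩
    have : Continuous fun t : ℝ => x + t • v := by fun_prop
    simpa using (this.tendsto 0).mono_left nhdsWithin_le_nhds
  refine ge_of_tendsto h1 ?_
  filter_upwards [h2.eventually hf, self_mem_nhdsWithin] with t ht ht0
  simp only [Pi.smul_apply, Pi.sub_apply, hx, sub_zero, smul_eq_mul]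
  exact mul_nonneg (inv_nonneg.2 (le_of_lt ht0)) (ht l hl)

theorem tendsto_transition (h : IsQuadChartAt I K c d q) (h' : IsQuadChartAt I K' c' d' q) :
    Tendsto (c' ∘ d) (𝓝[quad K] (c q)) (𝓝[quad K'] (c' q)) :=
  h'.tendsto.comp h.tendsto_symm

/-- If the chart change sends `v` to a vector that vanishes in the boundary coordinates of `c'`,
this vector and its negative both point into the quadrant of `c'`. Hence `v` and `-v` have
non-negative boundary coordinates for `c`, which must vanish; `ncard_le_of_linearMap` compares the
counts. -/
theorem ncard_le (h : IsQuadChartAt I K c d q) (h' : IsQuadChartAt I K' c' d' q) :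
    {l ∈ K | c q l = 0}.ncard ≤ {l ∈ K' | c' q l = 0}.ncard := by
  obtain ⟨C, D, hC, hD, hCD, hDC⟩ := h.exists_deriv
  obtain ⟨C', D', hC', hD', hCD', hDC'⟩ := h'.exists_deriv
  have hS : HasFDerivWithinAt (c ∘ d') (C.comp D') (quad K') (c' q) := by
    have : HasMFDerivAt I 𝓘(ℝ, α → ℝ) c (d' (c' q)) C := by rwa [h'.left_inv_self]
    exact (this.comp_hasMFDerivWithinAt (c' q) hD').hasFDerivWithinAt
  refine ncard_le_of_linearMap (C'.comp D).toLinearMap fun v hv l hl => ?_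
  have key : ∀ w : β → ℝ, (∀ k ∈ K', c' q k = 0 → w k = 0) → 0 ≤ C (D' w) l := fun w hw =>
    deriv_nonneg hS (eventually_ray_mem h'.mem_quad fun k hk hk' => (hw k hk hk').ge)
      ((h'.tendsto_transition h) self_mem_nhdsWithin) hl.1 (by
        simp only [Function.comp, h'.left_inv_self, hl.2])
  have h1 := key (C' (D v)) fun k hk hk' => hv k ⟨hk, hk'⟩
  have h2 := key (C' (D (-v))) fun k hk hk' => by
    have := hv k ⟨hk, hk'⟩
    simp only [map_neg, Pi.neg_apply]
    exact neg_eq_zero.2 this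
  rw [hDC', hCD] at h1 h2
  simp only [Pi.neg_apply] at h2
  linarith

theorem ncard_eq (h : IsQuadChartAt I K c d q) (h' : IsQuadChartAt I K' c' d' q) :
    {l ∈ K | c q l = 0}.ncard = {l ∈ K' | c' q l = 0}.ncard :=
  le_antisymm (h.ncard_le h') (h'.ncard_le h)

end IsQuadChartAt

namespace CornerMfd

variable (X : CornerMfd.{u})

theorem range_model : range X.model = {y | ∀ i, 0 ≤ y i} := range_euclideanQuadrant X.dim

theorem isQuadChartAt_chartAt (q : X) : IsQuadChartAt X.model univ
    (fun x => WithLp.ofLp (extChartAt X.model q x))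
    (fun y => (extChartAt X.model q).symm (WithLp.toLp 2 y)) q := by
  have hto : Tendsto (WithLp.toLp 2 : (Fin X.dim → ℝ) → EuclideanSpace ℝ (Fin X.dim))
      (𝓝[quad univ] (WithLp.ofLp (extChartAt X.model q q)))
      (𝓝[range X.model] (extChartAt X.model q q)) := by
    refine tendsto_nhdsWithin_iff.2 ⟨?_, ?_⟩
    · exact ((PiLp.continuous_toLp 2 _).tendsto _).mono_left nhdsWithin_le_nhds
    · filter_upwards [self_mem_nhdsWithin] with y hy
      rw [X.range_model]
      exact fun i => hy i trivial
  refine ⟨?_, ?_, ?_, ?_, ?_, ?_⟩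
  · refine tendsto_nhdsWithin_iff.2 ⟨?_, ?_⟩
    · exact ((PiLp.continuous_ofLp 2 _).tendsto _).comp (continuousAt_extChartAt q)
    · filter_upwards [extChartAt_source_mem_nhds (I := X.model) q] with x hx i _
      have := extChartAt_target_subset_range q ((extChartAt X.model q).map_source hx)
      rw [X.range_model] at this
      exact this i
  · have := (continuousAt_extChartAt_symm (I := X.model) q).tendsto
    rw [extChartAt_to_inv] at this
    exact (this.mono_left nhdsWithin_le_nhds).comp hto
  · filter_upwards [extChartAt_source_mem_nhds (I := X.model) q] with x hx
    exact (extChartAt X.model q).left_inv hx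
  · filter_upwards [hto (extChartAt_target_mem_nhdsWithin (I := X.model) q)] with y hy
    rw [(extChartAt X.model q).right_inv hy]
  · exact (PiLp.contDiff_ofLp.contMDiff.contMDiffAt).comp q
      (contMDiffAt_extChartAt (n := ∞))
  · have h1 : ContMDiffWithinAt 𝓘(ℝ, EuclideanSpace ℝ (Fin X.dim)) X.model ∞
        (extChartAt X.model q).symm (range X.model)
        (WithLp.toLp 2 (WithLp.ofLp (extChartAt X.model q q))) :=
      contMDiffWithinAt_extChartAt_symm_range q (mem_extChartAt_target (I := X.model) q)
    have h2 : ContDiff ℝ ∞ (WithLp.toLp 2 : (Fin X.dim → ℝ) → EuclideanSpace ℝ (Fin X.dim)) :=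
      PiLp.contDiff_toLp
    refine h1.comp _ h2.contMDiff.contMDiffAt.contMDiffWithinAt ?_
    intro y hy
    change WithLp.toLp 2 y ∈ range X.model
    rw [X.range_model]
    exact fun i => hy i trivial

theorem codim_eq {K : Set α} {c : X → α → ℝ} {d : (α → ℝ) → X} {q : X}
    (h : IsQuadChartAt X.model K c d q) : X.codim q = {l ∈ K | c q l = 0}.ncard := by
  rw [h.ncard_eq (X.isQuadChartAt_chartAt q)]
  simp only [mem_univ, true_and]
  rfl

end CornerMfd

end QuadChart

/-! ### Connected faces inside a quadrant chart -/

section QuadNbhd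

/-- A chart centred at `p` on the open set `U`, with inverse `g`, whose image is the intersection of
a quadrant with a ball. -/
structure QuadNbhd (X : CornerMfd.{u}) {m : ℕ} (p : X) (U : Set X) (K : Set (Fin m)) (ε : ℝ)
    (φ : X → Fin m → ℝ) (g : (Fin m → ℝ) → X) : Prop where
  isOpen : IsOpen U
  mem : p ∈ U
  map_center : φ p = 0
  pos : 0 < ε
  image_eq : φ '' U = quad K ∩ Metric.ball 0 ε
  left_inv : ∀ q ∈ U, g (φ q) = q
  smooth : ContMDiffOn X.model 𝓘(ℝ, Fin m → ℝ) ∞ φ U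
  smooth_symm : ContMDiffOn 𝓘(ℝ, Fin m → ℝ) X.model ∞ g (quad K ∩ Metric.ball 0 ε)

namespace QuadNbhd

variable {X : CornerMfd.{u}} {m : ℕ} {p : X} {U : Set X} {K : Set (Fin m)} {ε : ℝ}
  {φ : X → Fin m → ℝ} {g : (Fin m → ℝ) → X}

theorem map_mem (h : QuadNbhd X p U K ε φ g) {q : X} (hq : q ∈ U) :
    φ q ∈ quad K ∩ Metric.ball 0 ε := h.image_eq ▸ mem_image_of_mem _ hq

theorem symm_mem (h : QuadNbhd X p U K ε φ g) {x : Fin m → ℝ}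
    (hx : x ∈ quad K ∩ Metric.ball 0 ε) : g x ∈ U := by
  rw [← h.image_eq] at hx
  obtain ⟨q, hq, rfl⟩ := hx
  rwa [h.left_inv q hq]

theorem right_inv (h : QuadNbhd X p U K ε φ g) {x : Fin m → ℝ}
    (hx : x ∈ quad K ∩ Metric.ball 0 ε) : φ (g x) = x := by
  rw [← h.image_eq] at hx
  obtain ⟨q, hq, rfl⟩ := hx
  rw [h.left_inv q hq]

theorem isQuadChartAt (h : QuadNbhd X p U K ε φ g) {q : X} (hq : q ∈ U) :
    IsQuadChartAt X.model K φ g q := by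
  have hU := h.isOpen.mem_nhds hq
  have hφ := h.smooth.contMDiffAt hU
  have hW : quad K ∩ Metric.ball 0 ε ∈ 𝓝[quad K] (φ q) :=
    inter_mem_nhdsWithin _ (Metric.isOpen_ball.mem_nhds (h.map_mem hq).2)
  have hg : ContMDiffWithinAt 𝓘(ℝ, Fin m → ℝ) X.model ∞ g (quad K) (φ q) :=
    (h.smooth_symm _ (h.map_mem hq)).mono_of_mem_nhdsWithin hW
  refine ⟨?_, ?_, ?_, ?_, hφ, hg⟩
  · refine tendsto_nhdsWithin_iff.2 ⟨hφ.continuousAt, ?_⟩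
    filter_upwards [hU] with x hx using (h.map_mem hx).1
  · have := hg.continuousWithinAt.tendsto
    rwa [h.left_inv q hq] at this
  · filter_upwards [hU] with x hx using h.left_inv x hx
  · filter_upwards [hW] with x hx using h.right_inv hx

theorem codim_eq (h : QuadNbhd X p U K ε φ g) {q : X} (hq : q ∈ U) :
    X.codim q = {l ∈ K | φ q l = 0}.ncard := X.codim_eq (h.isQuadChartAt hq)

/-- The points of the quadrant whose only vanishing coordinate in `K` is that of index `l`. -/
def openFacet (K : Set (Fin m)) (ε : ℝ) (l : Fin m) : Set (Fin m → ℝ) :=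
  {x | x ∈ Metric.ball 0 ε ∧ x l = 0 ∧ ∀ k ∈ K, k ≠ l → 0 < x k}

theorem openFacet_subset {l : Fin m} : openFacet K ε l ⊆ quad K ∩ Metric.ball 0 ε := by
  rintro x ⟨h1, h2, h3⟩
  refine ⟨fun k hk => ?_, h1⟩
  by_cases hkl : k = l
  · rw [hkl, h2]
  · exact (h3 k hk hkl).le

theorem convex_openFacet {l : Fin m} : Convex ℝ (openFacet K ε l) := by
  rintro x ⟨hx1, hx2, hx3⟩ y ⟨hy1, hy2, hy3⟩ a b ha hb hab
  refine ⟨convex_ball _ _ hx1 hy1 ha hb hab, by simp [hx2, hy2], fun k hk hkl => ?_⟩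
  exact (convex_Ioi (0 : ℝ)) (hx3 k hk hkl) (hy3 k hk hkl) ha hb hab

theorem nonempty_openFacet (hε : 0 < ε) (l : Fin m) : (openFacet K ε l).Nonempty := by
  refine ⟨fun k => if k = l then 0 else ε / 2, ?_, by simp, fun k hk hkl => by simp [hkl, hε]⟩
  rw [mem_ball_zero_iff, pi_norm_lt_iff hε]
  intro k
  split_ifs
  · simpa using hε
  · rw [Real.norm_of_nonneg (by positivity)]
    linarith

theorem image_openFacet_subset (h : QuadNbhd X p U K ε φ g) {l : Fin m} (hl : l ∈ K) :
    g '' openFacet K ε l ⊆ X.corners 1 := by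
  rintro _ ⟨x, hx, rfl⟩
  have hx' := openFacet_subset hx
  change X.codim (g x) = 1
  rw [h.codim_eq (h.symm_mem hx'), h.right_inv hx', ncard_eq_one]
  refine ⟨l, ?_⟩
  ext k
  simp only [mem_ofPred_eq, mem_singleton_iff]
  constructor
  · rintro ⟨hk, hk0⟩
    by_contra hkl
    exact (hx.2.2 k hk hkl).ne' hk0
  · rintro rfl
    exact ⟨hl, hx.2.1⟩

theorem mem_openFacet_of_codim_eq_one (h : QuadNbhd X p U K ε φ g) {q : X} (hq : q ∈ U)
    (hq1 : X.codim q = 1) : ∃ l ∈ K, φ q ∈ openFacet K ε l := by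
  rw [h.codim_eq hq, ncard_eq_one] at hq1
  obtain ⟨l, hl⟩ := hq1
  have hl' : l ∈ {l ∈ K | φ q l = 0} := hl ▸ mem_singleton l
  refine ⟨l, hl'.1, (h.map_mem hq).2, hl'.2, fun k hk hkl => ?_⟩
  refine lt_of_le_of_ne ((h.map_mem hq).1 k hk) fun h0 => hkl ?_
  have : k ∈ {l ∈ K | φ q l = 0} := ⟨hk, h0.symm⟩
  rwa [hl] at this

theorem continuousOn_symm_openFacet (h : QuadNbhd X p U K ε φ g) (l : Fin m) :
    ContinuousOn g (openFacet K ε l) := h.smooth_symm.continuousOn.mono openFacet_subset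

theorem isPreconnected_image_openFacet (h : QuadNbhd X p U K ε φ g) (l : Fin m) :
    IsPreconnected (g '' openFacet K ε l) :=
  convex_openFacet.isPreconnected.image g (h.continuousOn_symm_openFacet l)

theorem mem_closure_image_openFacet (h : QuadNbhd X p U K ε φ g) {q : X} (hq : q ∈ U)
    {l : Fin m} (hql : φ q l = 0) : q ∈ closure (g '' openFacet K ε l) := by
  let x : ℝ → Fin m → ℝ := fun t k => if k = l then 0 else φ q k + t
  have hx : Continuous x := by
    refine continuous_pi fun k => ?_
    by_cases hk : k = l
    · simp only [x, hk, if_true]; fun_prop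
    · simp only [x, hk, if_false]; fun_prop
  have hx0 : x 0 = φ q := by
    ext k
    by_cases hk : k = l
    · simp [x, hk, hql]
    · simp [x, hk]
  have hx1 : Tendsto x (𝓝[>] 0) (𝓝 (φ q)) :=
    hx0 ▸ (hx.tendsto 0).mono_left nhdsWithin_le_nhds
  have hfacet : ∀ᶠ t in 𝓝[>] (0 : ℝ), x t ∈ openFacet K ε l := by
    filter_upwards [hx1 (Metric.isOpen_ball.mem_nhds (h.map_mem hq).2), self_mem_nhdsWithin]
      with t ht ht0
    refine ⟨ht, by simp [x], fun k hk hkl => ?_⟩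
    simp only [x, hkl, if_false]
    exact add_pos_of_nonneg_of_pos ((h.map_mem hq).1 k hk) ht0
  have hg := (h.isQuadChartAt hq).tendsto_symm.comp (tendsto_nhdsWithin_iff.2
    ⟨hx1, hfacet.mono fun t ht => (openFacet_subset ht).1⟩)
  exact mem_closure_of_tendsto hg (hfacet.mono fun t ht => mem_image_of_mem g ht)

/-- The connected faces of `X` which meet `U` correspond to the boundary hyperplanes of the
quadrant. -/
theorem exists_faces (h : QuadNbhd X p U K ε φ g) (hX : X.HasFiniteFaces) :
    ∃ C : Fin m → Set X, (∀ l ∈ K, C l ∈ X.bd) ∧ InjOn C K ∧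
      (∀ l ∈ K, ∀ q ∈ U, q ∈ C l ↔ φ q l = 0) ∧
      ∀ C' ∈ X.bd, (C' ∩ U).Nonempty → ∃ l ∈ K, C' = C l := by
  choose x hx using fun l : Fin m => nonempty_openFacet (K := K) h.pos l
  let C : Fin m → Set X := fun l => closure (connectedComponentIn (X.corners 1) (g (x l)))
  have hbd : ∀ l ∈ K, C l ∈ X.bd := fun l hl =>
    ⟨g (x l), h.image_openFacet_subset hl (mem_image_of_mem g (hx l)), rfl⟩
  have hsub : ∀ l ∈ K, g '' openFacet K ε l ⊆ connectedComponentIn (X.corners 1) (g (x l)) :=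
    fun l hl => (h.isPreconnected_image_openFacet l).subset_connectedComponentIn
      (mem_image_of_mem g (hx l)) (h.image_openFacet_subset hl)
  have hmem : ∀ l ∈ K, ∀ q ∈ U, φ q l = 0 → q ∈ C l := fun l hl q hq hql =>
    closure_mono (hsub l hl) (h.mem_closure_image_openFacet hq hql)
  -- A face meeting the open set `U` has a point of its component of `∂₁ X` in `U`; that point lies
  -- in an open facet, and components sharing a point are equal.
  have hmeet : ∀ C' ∈ X.bd, (C' ∩ U).Nonempty → ∃ l ∈ K, C' = C l := by
    rintro _ ⟨b, hb, rfl⟩ ⟨q, hqC, hqU⟩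
    obtain ⟨z, hzU, hz⟩ := mem_closure_iff.1 hqC U h.isOpen hqU
    obtain ⟨l, hl, hzl⟩ := h.mem_openFacet_of_codim_eq_one hzU
      (show z ∈ X.corners 1 from connectedComponentIn_subset _ _ hz)
    refine ⟨l, hl, ?_⟩
    have hz' := hsub l hl (mem_image_of_mem g hzl)
    rw [h.left_inv z hzU] at hz'
    rw [connectedComponentIn_eq hz, ← connectedComponentIn_eq hz']
  -- All faces through the centre are of the form `C l`, and there are as many of them as elements
  -- of `K`, so no two of the `C l` coincide.
  have hinj : InjOn C K := by
    have h1 : {C' ∈ X.bd | p ∈ C'} = C '' K := by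
      ext C'
      constructor
      · rintro ⟨hC', hp⟩
        obtain ⟨l, hl, rfl⟩ := hmeet C' hC' ⟨p, hp, h.mem⟩
        exact mem_image_of_mem C hl
      · rintro ⟨l, hl, rfl⟩
        exact ⟨hbd l hl, hmem l hl p h.mem (by simp [h.map_center])⟩
    have h2 := hX.faces p
    rw [h1, h.codim_eq h.mem] at h2
    have h3 : {l ∈ K | φ p l = 0} = K := by simp [h.map_center]
    rw [h3] at h2
    exact injOn_of_ncard_image_eq h2
  refine ⟨C, hbd, hinj, fun l hl q hq => ⟨fun hqC => ?_, hmem l hl q hq⟩, hmeet⟩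
  -- The faces `C k` with `φ q k = 0` already make up the full number of faces through `q`, so no
  -- other face contains `q`.
  have h1 : C '' {l ∈ K | φ q l = 0} ⊆ {C' ∈ X.bd | q ∈ C'} := by
    rintro _ ⟨k, hk, rfl⟩
    exact ⟨hbd k hk.1, hmem k hk.1 q hq hk.2⟩
  have h2 : C '' {l ∈ K | φ q l = 0} = {C' ∈ X.bd | q ∈ C'} := by
    refine eq_of_subset_of_ncard_le h1 ?_ (hX.finite.subset fun C' hC' => hC'.1)
    rw [hX.faces q, h.codim_eq hq, (hinj.mono fun k hk => hk.1).ncard_image]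
  have h3 : C l ∈ C '' {l ∈ K | φ q l = 0} := h2 ▸ ⟨hbd l hl, hqC⟩
  obtain ⟨k, hk, hkl⟩ := h3
  rw [← hinj hk.1 hl hkl]
  exact hk.2

end QuadNbhd

end QuadNbhd

/-! ### Adapted charts of neat arrangements -/

namespace Arrangement

variable {S : Type w} [Lattice S] [OrderTop S] [Fintype S] {𝒳 : Arrangement.{u} S}
  {p : 𝒳.ambient} {U : Set 𝒳.ambient} {J J₀ : S → Finset (Fin 𝒳.ambient.dim)}
  {φ : 𝒳.ambient → Fin 𝒳.ambient.dim → ℝ}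

theorem IsChart.exists_quadNbhd (h : 𝒳.IsChart p U J J₀ φ) :
    ∃ U' ⊆ U, ∃ ε g, QuadNbhd 𝒳.ambient p U' {l | l ∉ J₀ ⊤} ε φ g := by
  have hstd : stdCorner (J ⊤) (J₀ ⊤) = quad {l | l ∉ J₀ ⊤} := by
    ext x
    simp [stdCorner, quad, h.top]
  obtain ⟨hφ, ⟨W, hW, himage⟩, g, hg, hgφ⟩ := h.openEmb
  rw [hstd] at himage
  have h0 : (0 : Fin 𝒳.ambient.dim → ℝ) ∈ W := by
    have := mem_image_of_mem φ h.mem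
    rw [h.map_center, himage] at this
    exact this.2
  obtain ⟨ε, hε, hball⟩ := Metric.isOpen_iff.1 hW 0 h0
  have hsub : quad {l | l ∉ J₀ ⊤} ∩ Metric.ball 0 ε ⊆ φ '' U := by
    rw [himage]
    exact inter_subset_inter_right _ hball
  refine ⟨U ∩ φ ⁻¹' Metric.ball 0 ε, inter_subset_left, ε, g, ?_, ⟨h.mem, ?_⟩, h.map_center, hε,
    ?_, fun q hq => hgφ hq.1, hφ.mono inter_subset_left, hg.mono hsub⟩
  · exact hφ.continuousOn.isOpen_inter_preimage h.isOpen Metric.isOpen_ball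
  · simp [h.map_center, hε]
  · ext x
    constructor
    · rintro ⟨q, hq, rfl⟩
      have := mem_image_of_mem φ hq.1
      rw [himage] at this
      exact ⟨this.1, hq.2⟩
    · intro hx
      obtain ⟨q, hq, rfl⟩ := hsub hx
      exact ⟨q, ⟨hq, hx.2⟩, rfl⟩

/-- The image of a one-sided coordinate direction under an immersion of a quadrant leaves the image
of that quadrant when it is reversed. -/
theorem not_eventually_reverse_mem {α V : Type*} [Fintype α] [DecidableEq α]
    [NormedAddCommGroup V] [NormedSpace ℝ V]
    {f : (α → ℝ) → V} {A : (α → ℝ) →L[ℝ] V} {y : α → ℝ} {i : α} (hy : y i = 0)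
    (hA : HasFDerivWithinAt f A (quad univ) y) (hinj : Function.Injective A) {η : ℝ → α → ℝ}
    (hη : Tendsto η (𝓝[>] 0) (𝓝[quad univ] y)) :
    ¬ ∀ᶠ t in 𝓝[>] (0 : ℝ), f (η t) = f y - t • A (Pi.single i 1) := by
  intro hf
  obtain ⟨k, hk, hkA⟩ := A.toLinearMap.exists_antilipschitzWith (LinearMap.ker_eq_bot.2 hinj)
  have hbound : ∀ v, ‖v‖ ≤ k * ‖A v‖ := fun v => by
    simpa using hkA.le_mul_dist v 0
  have hk' : (0 : ℝ) < k := hk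
  have hlit := hη.eventually (hA.isLittleO.def (c := (1 / (4 * k : ℝ))) (by positivity))
  obtain ⟨t, ⟨⟨h1, h2⟩, h3⟩, ht⟩ := (((hlit.and hf).and (hη self_mem_nhdsWithin)).and
    self_mem_nhdsWithin).exists
  have ht' : (0 : ℝ) < t := ht
  -- `r` is the deviation of `η t` from the reversed ray. Its norm is at most a quarter of that of
  -- `η t - y`, hence of `‖r‖ + t`; yet its coordinate `i` is at least `t`, as `η t` lies in the
  -- quadrant.
  set r := η t - y + t • Pi.single i 1 with hr
  have h4 : f (η t) - f y - A (η t - y) = -A r := by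
    rw [h2, hr, map_add, map_smul]
    abel
  have h5 : ‖r‖ ≤ 1 / 4 * ‖η t - y‖ := by
    refine (hbound r).trans ?_
    rw [h4, norm_neg] at h1
    calc k * ‖A r‖ ≤ k * (1 / (4 * k) * ‖η t - y‖) := by gcongr
      _ = 1 / 4 * ‖η t - y‖ := by field_simp
  have h6 : ‖η t - y‖ ≤ ‖r‖ + t := by
    have : η t - y = r - t • Pi.single i 1 := by rw [hr]; abel
    rw [this]
    refine (norm_sub_le _ _).trans ?_
    rw [norm_smul, Real.norm_of_nonneg ht'.le, Pi.norm_single]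
    simp
  have h7 : t ≤ ‖r‖ := by
    have h8 : r i = η t i + t := by simp [hr, hy]
    have h9 : 0 ≤ η t i := h3 i trivial
    have := (le_abs_self _).trans (norm_le_pi_norm r i)
    linarith
  linarith

/-- Were `l` missing from `J s`, the chart would contain a point of `𝒳(s)` whose coordinates are
positive in `J s` and zero elsewhere, in particular at `l`. By neatness this is a corner of `𝒳(s)`
of positive codimension. But around it the member fills the coordinate subspace of `J s`, so a
direction entering `𝒳(s)` at this corner can be reversed, against `not_eventually_reverse_mem`. -/
theorem IsNeat.mem_of_isChart (h𝒳 : 𝒳.IsNeat) (h : 𝒳.IsChart p U J J₀ φ) {s : S}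
    (hs : 𝒳.scope p ≤ s) {l : Fin 𝒳.ambient.dim} (hl : l ∉ J₀ ⊤) : l ∈ J s := by
  by_contra hls
  obtain ⟨U', hU', ε, g, hN⟩ := h.exists_quadNbhd
  have hε := hN.pos
  let x : Fin 𝒳.ambient.dim → ℝ := fun k => if k ∈ J s then ε / 2 else 0
  have hx : x ∈ quad {l | l ∉ J₀ ⊤} ∩ Metric.ball 0 ε := by
    refine ⟨fun k _ => ?_, ?_⟩
    · simp only [x]
      split_ifs <;> positivity
    · rw [mem_ball_zero_iff, pi_norm_lt_iff hε]
      intro k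
      simp only [x]
      split_ifs
      · rw [Real.norm_of_nonneg (by positivity)]
        linarith
      · simpa using hε
  have hxs : x ∈ stdCorner (J s) (J₀ s) :=
    ⟨fun k hk => by simp [x, hk], fun k hk _ => by
    simp only [x, hk, if_true]
    positivity⟩
  have hqU : g x ∈ U' := hN.symm_mem hx
  have hqs : g x ∈ 𝒳.sub s := by
    rw [h.pullback s hs _ (hU' hqU), hN.right_inv hx]
    exact hxs
  obtain ⟨z, hz, hzx⟩ := (h𝒳.corners s (𝒳.ambient.codim (g x))).ge ⟨hqs, rfl⟩
  set c : 𝒳.obj s → Fin (𝒳.obj s).dim → ℝ :=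
    fun x => WithLp.ofLp (extChartAt (𝒳.obj s).model z x)
  set d : (Fin (𝒳.obj s).dim → ℝ) → 𝒳.obj s :=
    fun y => (extChartAt (𝒳.obj s).model z).symm (WithLp.toLp 2 y)
  have hcd : IsQuadChartAt (𝒳.obj s).model univ c d z := (𝒳.obj s).isQuadChartAt_chartAt z
  obtain ⟨i, -, hi⟩ : {i ∈ univ | c z i = 0}.Nonempty := by
    rw [← ncard_pos, ← CornerMfd.codim_eq _ hcd]
    have : (𝒳.obj s).codim z = 𝒳.ambient.codim (g x) := hz
    rw [this, hN.codim_eq hqU, ncard_pos, hN.right_inv hx]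
    exact ⟨l, hl, by simp [x, hls]⟩
  set emb : 𝒳.obj s → 𝒳.ambient := 𝒳.map (le_top : s ≤ ⊤)
  have hemb : CornerMfd.IsEmb (N := 𝒳.ambient) emb := 𝒳.isEmb (le_top : s ≤ ⊤)
  obtain ⟨C, D, hC, hD, hCD, hDC⟩ := hcd.exists_deriv
  obtain ⟨C', D', hC', hD', hCD', hDC'⟩ := (hN.isQuadChartAt hqU).exists_deriv
  have hB : HasMFDerivAt (𝒳.obj s).model 𝒳.ambient.model emb z
      (mfderiv (𝒳.obj s).model 𝒳.ambient.model emb z) :=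
    (hemb.contMDiff.contMDiffAt.mdifferentiableAt (by simp)).hasMFDerivAt
  obtain ⟨B, hBdef⟩ : ∃ B : EuclideanSpace ℝ (Fin (𝒳.obj s).dim) →L[ℝ]
      EuclideanSpace ℝ (Fin 𝒳.ambient.dim),
      B = mfderiv (𝒳.obj s).model 𝒳.ambient.model emb z := ⟨_, rfl⟩
  have hBinj : Function.Injective B := hBdef ▸ hemb.immersion z
  rw [← hBdef] at hB
  have hφB : HasMFDerivAt (𝒳.obj s).model 𝓘(ℝ, Fin 𝒳.ambient.dim → ℝ) (φ ∘ emb) z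
      (C'.comp B) := by
    rw [← hzx] at hC'
    exact hC'.comp z hB
  have hdz : d (c z) = z := hcd.left_inv_self
  have hA : HasFDerivWithinAt (φ ∘ emb ∘ d) ((C'.comp B).comp D) (quad univ) (c z) := by
    rw [← hdz] at hφB
    exact (hφB.comp_hasMFDerivWithinAt (c z) hD).hasFDerivWithinAt
  obtain ⟨A, hAdef⟩ : ∃ A, A = (C'.comp B).comp D := ⟨_, rfl⟩
  have hAinj : Function.Injective A := by
    rw [hAdef]
    exact ((Function.LeftInverse.injective hDC').comp hBinj).comp
      (Function.LeftInverse.injective hCD)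
  rw [← hAdef] at hA
  have hfz : (φ ∘ emb ∘ d) (c z) = x := by
    simp only [Function.comp, hdz]
    rw [hzx, hN.right_inv hx]
  have hfs : ∀ᶠ y in 𝓝[quad univ] (c z), (φ ∘ emb ∘ d) y ∈ stdCorner (J s) (J₀ s) := by
    have h1 : Tendsto (emb ∘ d) (𝓝[quad univ] (c z)) (𝓝 (emb z)) :=
      (hemb.isEmbedding.continuous.tendsto z).comp hcd.tendsto_symm
    filter_upwards [h1 (hzx ▸ hN.isOpen.mem_nhds hqU)] with y hy
    exact (h.pullback s hs _ (hU' hy)).1 ⟨d y, rfl⟩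
  -- the reversed direction stays tangent to the member `s`
  have hw : ∀ k ∉ J s, A (Pi.single i 1) k = 0 := by
    intro k hk
    have hray := IsQuadChartAt.eventually_ray_mem hcd.mem_quad
      (v := Pi.single i 1) fun j _ _ => by
        by_cases hj : j = i
        · subst hj; simp
        · simp [hj]
    have h0 : (φ ∘ emb ∘ d) (c z) k = 0 := by rw [hfz]; simp [x, hk]
    have h1 := IsQuadChartAt.deriv_nonneg (K' := {k}) hA hray
      (hfs.mono fun y hy j hj => (hy.1 j (by rwa [mem_singleton_iff.1 hj])).ge) rfl h0
    have h2 := IsQuadChartAt.deriv_nonneg (K' := {k}) hA.neg hray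
      (hfs.mono fun y hy j hj => by
        rw [Pi.neg_apply, Pi.neg_apply, hy.1 j (by rwa [mem_singleton_iff.1 hj]), neg_zero]) rfl
      (by rw [Pi.neg_apply, Pi.neg_apply, h0, neg_zero])
    have h3 : 0 ≤ -(A (Pi.single i 1) k) := h2
    linarith
  set w := A (Pi.single i 1)
  have hxt : Tendsto (fun t : ℝ => x - t • w) (𝓝[>] 0) (𝓝 x) := by
    have : Continuous fun t : ℝ => x - t • w := by fun_prop
    simpa using (this.tendsto 0).mono_left nhdsWithin_le_nhds
  have hpos : ∀ᶠ t in 𝓝[>] (0 : ℝ), ∀ k, k ∈ J s → 0 < (x - t • w) k := by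
    refine eventually_all.2 fun k => ?_
    by_cases hk : k ∈ J s
    · have h1 : Tendsto (fun t : ℝ => (x - t • w) k) (𝓝[>] 0) (𝓝 (x k)) :=
        tendsto_pi_nhds.1 hxt k
      have h2 : 0 < x k := by simp [x, hk, hε]
      filter_upwards [h1 (lt_mem_nhds h2)] with t ht _ using ht
    · exact Eventually.of_forall fun t h => absurd h hk
  have hzero : ∀ t : ℝ, ∀ k ∉ J s, (x - t • w) k = 0 := fun t k hk => by
    simp [x, hk, hw k hk]
  have hmem : ∀ᶠ t in 𝓝[>] (0 : ℝ), x - t • w ∈ quad {l | l ∉ J₀ ⊤} ∩ Metric.ball 0 ε ∧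
      x - t • w ∈ stdCorner (J s) (J₀ s) := by
    filter_upwards [hpos, hxt (Metric.isOpen_ball.mem_nhds hx.2)] with t ht ht'
    refine ⟨⟨fun k _ => ?_, ht'⟩, hzero t, fun k hk _ => (ht k hk).le⟩
    by_cases hk : k ∈ J s
    · exact (ht k hk).le
    · exact (hzero t k hk).ge
  -- For small `t` the reversed ray lies in the local model of the member, hence comes from points
  -- `θ t` of `𝒳(s)`; they converge to `z` because the inclusion is a topological embedding.
  have hlift : ∀ t : ℝ, ∃ m, x - t • w ∈ quad {l | l ∉ J₀ ⊤} ∩ Metric.ball 0 ε ∧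
      x - t • w ∈ stdCorner (J s) (J₀ s) → emb m = g (x - t • w) := by
    intro t
    by_cases ht : x - t • w ∈ quad {l | l ∉ J₀ ⊤} ∩ Metric.ball 0 ε ∧
      x - t • w ∈ stdCorner (J s) (J₀ s)
    · have : g (x - t • w) ∈ 𝒳.sub s := by
        rw [h.pullback s hs _ (hU' (hN.symm_mem ht.1)), hN.right_inv ht.1]
        exact ht.2
      obtain ⟨m, hm⟩ := this
      exact ⟨m, fun _ => hm⟩
    · exact ⟨z, fun h => absurd h ht⟩
  choose θ hlift using hlift
  have hlift' : ∀ᶠ t in 𝓝[>] (0 : ℝ), emb (θ t) = g (x - t • w) :=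
    hmem.mono fun t ht => hlift t ht
  have htend : Tendsto θ (𝓝[>] 0) (𝓝 z) := by
    rw [hemb.isEmbedding.tendsto_nhds_iff, hzx]
    have h1 : Tendsto g (𝓝[quad {l | l ∉ J₀ ⊤}] x) (𝓝 (g x)) := by
      have := (hN.isQuadChartAt hqU).tendsto_symm
      rwa [hN.right_inv hx] at this
    exact (h1.comp (tendsto_nhdsWithin_iff.2 ⟨hxt, hmem.mono fun t ht => ht.1.1⟩)).congr'
      (hlift'.mono fun t ht => ht.symm)
  refine not_eventually_reverse_mem hi hA hAinj (hcd.tendsto.comp htend) ?_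
  filter_upwards [hlift', htend.eventually hcd.left_inv, hmem] with t h1 h2 h3
  rw [hfz]
  simp only [Function.comp, h2, h1]
  exact hN.right_inv h3.1

end Arrangement

namespace Arrangement

variable {S : Type w} [Lattice S] [OrderTop S] [Fintype S] {𝒳 : Arrangement.{u} S}
  {Y : CornerMfd.{v}} {β : PreEdging 𝒳.ambient Y}

/-- By `exists_faces` the boundary hyperplanes of an `𝒳`-chart are the faces that meet it. Exactly
one, of index `i`, has label `D`. Translation in its direction changes no other coordinate, so faces
with other labels are preserved; members are preserved because `i` belongs to `J s` whenever `𝒳(s)`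
meets the chart. -/
theorem IsNeat.nonempty_adaptedChart (h𝒳 : 𝒳.IsNeat) (hβ : β.IsEdging) (D : Y.Face)
    {p : 𝒳.ambient} (hp : p ∈ β.labelFace (some D)) :
    Nonempty (AdaptedChart 𝒳.ambient.model 𝒳.ambient.dim (β.labelFace (some D))
      (𝒳.strata β (some D)) p) := by
  classical
  obtain ⟨U₀, J, J₀, φ, hchart⟩ := h𝒳.excellent p
  obtain ⟨U, hU, ε, g, hN⟩ := hchart.exists_quadNbhd
  obtain ⟨C, hC, hinj, hCU, hmeet⟩ := hN.exists_faces (h𝒳.finiteFaces ⊤)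
  set K : Set (Fin 𝒳.ambient.dim) := {l | l ∉ J₀ ⊤}
  obtain ⟨C', hC'D, hpC'⟩ := β.mem_labelFace_some.1 hp
  have hlift : ∀ l, ∃ C'' : 𝒳.ambient.Face, l ∈ K → C''.1 = C l := fun l => by
    by_cases hl : l ∈ K
    · exact ⟨⟨C l, hC l hl⟩, fun _ => rfl⟩
    · exact ⟨C', fun h => absurd h hl⟩
  choose G hG using hlift
  have hGU : ∀ l ∈ K, ∀ q ∈ U, q ∈ (G l).1 ↔ φ q l = 0 := fun l hl => by
    rw [hG l hl]
    exact hCU l hl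
  have hpG : ∀ l ∈ K, p ∈ (G l).1 := fun l hl => (hGU l hl p hN.mem).2 (by simp [hN.map_center])
  have hface : ∀ C' : 𝒳.ambient.Face, ∀ q ∈ U, q ∈ C'.1 → ∃ l ∈ K, C' = G l := by
    intro C' q hq hqC
    obtain ⟨l, hl, hl'⟩ := hmeet C'.1 C'.2 ⟨q, hqC, hq⟩
    exact ⟨l, hl, Subtype.ext (hl'.trans (hG l hl).symm)⟩
  obtain ⟨i, hi, hi'⟩ := hface C' p hN.mem hpC'
  rw [hi'] at hC'D
  -- Two faces with label `D` through `p` coincide, since an edging separates faces with a common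
  -- point.
  have huniq : ∀ l ∈ K, β (G l) = some D → l = i := by
    intro l hl hlD
    have h1 : ∀ C' ∈ ({G l, G i} : Finset 𝒳.ambient.Face), C' = G l ∨ C' = G i := fun C' h => by
      simpa only [Finset.mem_insert, Finset.mem_singleton] using h
    have := (hβ {G l, G i} (Finset.insert_nonempty _ _)
      (fun C' h => by rcases h1 C' h with rfl | rfl <;> simp [hlD, hC'D])
      ⟨p, fun C' h => by
        rcases h1 C' h with rfl | rfl
        exacts [hpG l hl, hpG i hi]⟩).2 (G l) (Finset.mem_insert_self _ _) (G i)
        (Finset.mem_insert_of_mem (Finset.mem_singleton_self _)) (by rw [hlD, hC'D])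
    refine hinj hl hi ?_
    rw [← hG l hl, ← hG i hi, this]
  have hadd : ∀ (y : Fin 𝒳.ambient.dim → ℝ) (t : ℝ) (l : Fin 𝒳.ambient.dim), l ≠ i →
      (y + t • (Pi.single i 1 : Fin 𝒳.ambient.dim → ℝ)) l = y l := fun y t l hl => by
    simp [hl]
  -- faces with a different label are invariant
  have hinv : ∀ C' : 𝒳.ambient.Face, β C' ≠ some D → ∀ q ∈ U, ∀ q' ∈ U,
      (∀ l, l ≠ i → φ q' l = φ q l) → q ∈ C'.1 → q' ∈ C'.1 := by
    intro C' hC' q hq q' hq' hqq' hqC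
    obtain ⟨l, hl, rfl⟩ := hface C' q hq hqC
    have hli : l ≠ i := by
      rintro rfl
      exact hC' hC'D
    rw [hGU l hl q' hq', hqq' l hli, ← hGU l hl q hq]
    exact hqC
  have hinv' : ∀ C' : 𝒳.ambient.Face, β C' ≠ some D → ∀ q ∈ U, ∀ q' ∈ U,
      (∀ l, l ≠ i → φ q' l = φ q l) → (q ∈ C'.1 ↔ q' ∈ C'.1) := fun C' hC' q hq q' hq' hqq' =>
    ⟨hinv C' hC' q hq q' hq' hqq', hinv C' hC' q' hq' q hq fun l hl => (hqq' l hl).symm⟩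
  refine ⟨⟨U, φ, g, K, i, Metric.ball 0 ε, hN.isOpen, hN.mem, hN.map_center, hi,
    Metric.isOpen_ball, hN.image_eq, hN.left_inv, hN.smooth, hN.smooth_symm, ?_, ?_, ?_⟩⟩
  · intro q hq
    rw [β.mem_labelFace_some]
    constructor
    · rintro ⟨C', hC', hqC'⟩
      obtain ⟨l, hl, rfl⟩ := hface C' q hq hqC'
      obtain rfl := huniq l hl hC'
      exact (hGU l hl q hq).1 hqC'
    · exact fun h => ⟨_, hC'D, (hGU i hi q hq).2 h⟩
  · intro Z hZ q hq t ht hW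
    have hquad : φ q + t • Pi.single i 1 ∈ quad K ∩ Metric.ball 0 ε := by
      refine ⟨fun l hl => ?_, hW⟩
      have h0 := (hN.map_mem hq).1 l hl
      by_cases hli : l = i
      · subst hli
        simpa using add_nonneg h0 ht
      · rwa [hadd _ _ _ hli]
    have hq' := hN.symm_mem hquad
    have hφ' := hN.right_inv hquad
    set q' := g (φ q + t • Pi.single i 1)
    have hqq' : ∀ l, l ≠ i → φ q' l = φ q l := fun l hl => by rw [hφ', hadd _ _ _ hl]
    rcases hZ with ⟨s, rfl⟩ | ⟨C', hC', rfl⟩ | ⟨o', ho', rfl⟩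
    · by_cases hs : 𝒳.scope p ≤ s
      · have hiJ : i ∈ J s := h𝒳.mem_of_isChart hchart hs hi
        rw [hchart.pullback s hs q (hU hq), hchart.pullback s hs q' (hU hq')]
        -- Only coordinate `i` differs; it is not among those required to vanish, and its
        -- non-negativity holds throughout `U`.
        refine and_congr (forall₂_congr fun l hl => ?_) (forall₃_congr fun l hl hl' => ?_)
        · rw [hqq' l fun h => hl (h ▸ hiJ)]
        · by_cases hli : l = i
          · subst hli
            exact iff_of_true ((hN.map_mem hq).1 l hi) ((hN.map_mem hq').1 l hi)
          · rw [hqq' l hli]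
      · have hdisj : ∀ x ∈ U, x ∉ 𝒳.sub s := fun x hx hxs =>
          hs (hchart.scope_le s ⟨x, hU hx, hxs⟩)
        exact iff_of_false (hdisj q hq) (hdisj q' hq')
    · exact hinv' C' (hC' D rfl) q hq q' hq' hqq'
    · have ho : D ∉ o' := ho' D rfl
      refine exists_congr fun D' => and_congr_right fun hD' => exists_congr fun C' =>
        and_congr_right fun hC' => hinv' C' (fun h => ho ?_) q hq q' hq' hqq'
      rw [h, Option.some_inj] at hC'
      exact hC' ▸ hD'
  · intro l hl hli
    refine ⟨(G l).1, Or.inr (Or.inl ⟨G l, ?_, rfl⟩), fun q hq => hGU l hl q hq⟩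
    intro D' hD' h
    rw [Option.mem_def, Option.some_inj] at hD'
    exact hli (huniq l hl (hD' ▸ h))

end Arrangement

theorem mainTheorem6 {S : Type w} [Lattice S] [OrderTop S] [Fintype S]
    (𝒳 : Arrangement.{u} S) (h𝒳 : 𝒳.IsNeat) (Y : CornerMfd.{v}) (hY : Y.HasFiniteFaces)
    (β : PreEdging 𝒳.ambient Y) (hβ : β.IsEdging) :
    ∃ γ : 𝒳.CollarFamily Y, 𝒳.IsCollaring β γ ∧
      ∀ τ τ' : Finset Y.Face, τ' ⊆ τ → ∀ p ∈ β.faceUnion τ, γ τ τ' (0, p) = p := by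
  exact Arrangement.exists_isCollaring (h𝒳.finiteFaces ⊤).finite hY.finite
    fun D _ hp => h𝒳.nonempty_adaptedChart hβ D hp
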